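/- Let $K$ be a number field with $r_1$ real and $r_2$ complex places, let $V=K\otimes_{\mathbb Q}\mathbb R\cong\mathbb R^{r_1}\times\mathbb C^{r_2}$, equipped with the Lebesgue measure $\mathrm{Leb}$ (the product of the standard Lebesgue measures on $\mathbb R$ and $\mathbb C$), and let $V^\times=(\mathbb R^\times)^{r_1}\times(\mathbb C^\times)^{r_2}$ be its group of invertible elements. For $x=(x_1,\dots,x_{r_1+r_2})\in V$ put $\|x\|=\prod_{i=1}^{r_1}|x_i|\cdot\prod_{i=r_1+1}^{r_1+r_2}|x_i|^2$, the extension of $|N_{K/\mathbb Q}|$ to $V$. For a compactly supported probability measure $\nu$ on $V$ that is absolutely continuous with respect to $\mathrm{Leb}$ with bounded density, define its energy by $$I(\nu)=\int_V\int_V\log\|x-y\|\,d\nu(x)\,d\nu(y).$$ Let $\nu$ be a compactly supported probability measure on $V$, absolutely continuous with respect to $\mathrm{Leb}$ with density at most $1$, such that $I(\nu)\le I(\nu')$ for every such measure $\nu'$. Then there exist an open set $U\subseteq V$ and a vector $v\in V$ such that 1. $\nu=\mathrm{Leb}|_U$; 2. $\lambda(\overline U-v)\subseteq U-v$ for every real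 $\lambda$ with $0\le\lambda<1$; 3. $(\partial U-v)\cap V^\times$ is a codimension $1$ submanifold of $V^\times$ of class $C^1$. -/

import Mathlib

open MeasureTheory NumberField
open scoped Pointwise Classical

namespace LogNormEnergy

/-- Subsets `M` of the open set `Ω` in a real normed space `E` that are (embedded) submanifolds
of `Ω` of class `C¹` and of codimension `k`: near each of its points, `M` is the zero set of a
`C¹` submersion to `ℝᵏ`. -/
def IsC1Submanifold {E : Type*} [NormedAddCommGroup E] [NormedSpace ℝ E]
    (k : ℕ) (Ω M : Set E) : Prop :=
  M ⊆ Ω ∧ ∀ x ∈ M, ∃ W : Set E, IsOpen W ∧ x ∈ W ∧ W ⊆ Ω ∧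
    ∃ g : E → (Fin k → ℝ), ContDiffOn ℝ 1 g W ∧
      (∀ y ∈ W, Function.Surjective (fderiv ℝ g y)) ∧
      M ∩ W = {y ∈ W | g y = 0}

variable (K : Type*) [Field K] [NumberField K]

/-- The group `V^×` of invertible elements of the ring `V = K ⊗ ℝ = ℝ^{r₁} × ℂ^{r₂}`, as a
subset of `V`. -/
def unitSet : Set (mixedEmbedding.mixedSpace K) := {x | IsUnit x}

/-- Compactly supported probability measures on `V = K ⊗ ℝ` that are absolutely continuous with
respect to Lebesgue measure, with density at most `1`. -/
structure IsAdmissible (ν : Measure (mixedEmbedding.mixedSpace K)) : Prop where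
  prob : IsProbabilityMeasure ν
  compactSupport : ∃ C : Set (mixedEmbedding.mixedSpace K), IsCompact C ∧ ν Cᶜ = 0
  density : ∃ f : mixedEmbedding.mixedSpace K → ENNReal,
    Measurable f ∧ (∀ x, f x ≤ 1) ∧ ν = volume.withDensity f

/-- The energy `I(ν) = ∫∫ log ‖x - y‖ dν(x) dν(y)`. Here `‖x‖` is the absolute value of the norm
form, i.e. the product of the `|x_i|` over the real and of the `|x_i|²` over the complex
coordinates (it is not a vector space norm). For a compactly supported measure of bounded density
the set of `(x, y)` with `‖x - y‖ = 0` is null and both integrals converge absolutely. -/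
noncomputable def energy (ν : Measure (mixedEmbedding.mixedSpace K)) : ℝ :=
  ∫ y, ∫ x, Real.log (mixedEmbedding.norm (x - y)) ∂ν ∂ν

/-- `ν` has the least energy among all compactly supported probability measures of density at
most `1`. -/
def IsEnergyMinimizer (ν : Measure (mixedEmbedding.mixedSpace K)) : Prop :=
  IsAdmissible K ν ∧ ∀ ν', IsAdmissible K ν' → energy K ν ≤ energy K ν'

end LogNormEnergy

/-! Write `ν = f dx`. Since `log ‖x - y‖` is a weighted sum of logarithms of distances in the real
and complex coordinates, the energy is a positive combination of the logarithmic energies of the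
coordinate projections of `f`. Everything is done for an abstract finite family of independent
Euclidean coordinates.

Polarization: let `T` reflect one coordinate in a hyperplane, and exchange `f` and `f ∘ T` where the
smaller value lies on a chosen side. The result is again an admissible density, and the energies in
the other coordinates do not change. In the reflected coordinate the energy drops unless the
exchange did nothing or was a full reflection, because points on the same side are closer than their
mirror images. Hence a minimizer is ordered by every such reflection
(`IsMinimizer.ae_nonneg_or_ae_nonpos`), and the centre of mass decides in which direction
(`IsMinimizer.ae_refl`). It follows that the potential in each coordinate is strictly increasing in
the distance from the centre (`IsMinimizer.pot_lt`), so the total potential `h` increases strictly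
along rays from the centre point `v`.

Shape: by the first variation, `f` minimizes `∫ g h` among admissible `g`. Level sets of `h` are
null by homothety about `v`, so the bathtub principle gives `f = 1` on `U = {h < s}` and `f = 0`
elsewhere, up to a null set. Monotonicity along rays makes `U` starlike and gives `∂U = {h = s}`.

Regularity: with a single place, `U` is a ball or an interval. With several places, `h` is shown to
be `C¹`. A bounded density alone does not give this, as the derivative of the kernel is not
integrable on a line. The remedy is a quantitative form of monotonicity
(`IsSharpMinimizer.exists_le_pot_sub_pot`): it makes the layers `|h - s| ≤ δ` thin in the direction
of a second coordinate, so the projection of `f` to the first is regular enough for the symmetrized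
singular integral of the gradient to converge locally uniformly. The same bound shows that the
gradient is nonzero off the centre, and the implicit description `h = s` of the boundary is regular.
-/

namespace LogNormEnergy

set_option linter.unusedSectionVars false

open Metric Set Filter Topology
open scoped ENNReal NNReal

/-! ### Integrals of functions of a linear projection. -/

section Averaging

variable {V F : Type*} [NormedAddCommGroup V] [NormedSpace ℝ V] [FiniteDimensional ℝ V]
  [MeasurableSpace V] [BorelSpace V] (μ : Measure V) [μ.IsAddHaarMeasure]
  [NormedAddCommGroup F] [NormedSpace ℝ F] [FiniteDimensional ℝ F]
  [MeasurableSpace F] [BorelSpace F]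

/-- Averaging an integral over translations along the image of `s : F → V`. -/
theorem addHaar_mul_lintegral (s : F →L[ℝ] V) {G : V → ℝ≥0∞} (hG : Measurable G) (B : Set F) :
    (Measure.addHaar : Measure F) B * ∫⁻ x, G x ∂μ
      = ∫⁻ x, ∫⁻ z in B, G (x + s z) ∂Measure.addHaar ∂μ := by
  rw [lintegral_lintegral_swap]
  · simp_rw [lintegral_add_right_eq_self]
    simp [mul_comm]
  · have : Measurable fun p : V × F => G (p.1 + s p.2) := hG.comp (by fun_prop)
    exact this.aemeasurable

/-- The image of a bounded piece of `μ` has bounded density. Instead of disintegrating `μ`, one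
averages over translations by `s z` with `z` in the unit ball: along such a translation `π` runs
through translates of `z`, so the inner integral is at most that of `φ` over a fixed ball, and it
vanishes for large `x`. -/
theorem exists_lintegral_comp_le (π : V →L[ℝ] F) (s : F →L[ℝ] V) (hπs : ∀ z, π (s z) = z) (R : ℝ) :
    ∃ C : ℝ≥0, ∀ φ : F → ℝ≥0∞, Measurable φ →
      ∫⁻ x in closedBall 0 R, φ (π x) ∂μ
        ≤ C * ∫⁻ z in closedBall 0 (‖π‖ * R), φ z ∂Measure.addHaar := by
  set lam : Measure F := Measure.addHaar
  set B : Set F := closedBall 0 1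
  have hB0 : lam B ≠ 0 := (measure_closedBall_pos lam 0 one_pos).ne'
  have hBtop : lam B ≠ ∞ := (isCompact_closedBall 0 1).measure_ne_top
  have hV : μ (closedBall 0 (R + ‖s‖)) ≠ ∞ := (isCompact_closedBall 0 _).measure_ne_top
  refine ⟨(μ (closedBall 0 (R + ‖s‖)) / lam B).toNNReal, fun φ hφ => ?_⟩
  rw [ENNReal.coe_toNNReal (ENNReal.div_ne_top hV hB0)]
  set J := ∫⁻ z in closedBall 0 (‖π‖ * R), φ z ∂lam
  set G : V → ℝ≥0∞ := (closedBall 0 R).indicator fun x => φ (π x)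
  have hG : Measurable G := (hφ.comp π.continuous.measurable).indicator measurableSet_closedBall
  have key := addHaar_mul_lintegral μ s hG B
  rw [lintegral_indicator measurableSet_closedBall] at key
  have h1 : ∫⁻ x, ∫⁻ z in B, G (x + s z) ∂lam ∂μ ≤ μ (closedBall 0 (R + ‖s‖)) * J := by
    calc _ ≤ ∫⁻ x, (closedBall (0 : V) (R + ‖s‖)).indicator (fun _ => J) x ∂μ := by
          refine lintegral_mono fun x => ?_
          by_cases hx : x ∈ closedBall (0 : V) (R + ‖s‖)
          · rw [indicator_of_mem hx]
            calc ∫⁻ z in B, G (x + s z) ∂lam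
                ≤ ∫⁻ z, (closedBall 0 (‖π‖ * R)).indicator φ (π x + z) ∂lam := by
                  refine (lintegral_mono fun z => ?_).trans (setLIntegral_le_lintegral _ _)
                  simp only [G]
                  by_cases h : x + s z ∈ closedBall (0 : V) R
                  · rw [indicator_of_mem h, map_add, hπs, indicator_of_mem]
                    rw [mem_closedBall_zero_iff] at h ⊢
                    calc ‖π x + z‖ = ‖π (x + s z)‖ := by rw [map_add, hπs]
                      _ ≤ ‖π‖ * R := (π.le_opNorm _).trans (by gcongr)
                  · rw [indicator_of_notMem h]; exact zero_le
              _ = J := by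
                  rw [lintegral_add_left_eq_self, lintegral_indicator measurableSet_closedBall]
          · rw [indicator_of_notMem hx]
            refine (setLIntegral_eq_zero measurableSet_closedBall fun z hz => ?_).le
            refine indicator_of_notMem (fun h => hx ?_) _
            simp only [mem_closedBall_zero_iff] at h hz ⊢
            calc ‖x‖ = ‖x + s z - s z‖ := by simp
              _ ≤ ‖x + s z‖ + ‖s z‖ := norm_sub_le _ _
              _ ≤ R + ‖s‖ := by
                gcongr
                exact (s.le_opNorm z).trans (mul_le_of_le_one_right (norm_nonneg _) hz)
      _ = μ (closedBall 0 (R + ‖s‖)) * J := by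
          rw [lintegral_indicator measurableSet_closedBall, setLIntegral_const, mul_comm]
  rw [← key] at h1
  rwa [← ENNReal.mul_div_right_comm, ENNReal.le_div_iff_mul_le (.inl hB0) (.inl hBtop), mul_comm]

theorem lintegral_rpow_closedBall_lt_top [Nontrivial F] {β : ℝ} (hβ : β < 1) (R : ℝ) :
    ∫⁻ z in closedBall (0 : F) R, ENNReal.ofReal (‖z‖ ^ (-β)) ∂Measure.addHaar < ∞ := by
  have hd : 1 ≤ Module.finrank ℝ F := Module.finrank_pos
  have hl : LocallyIntegrable (fun z : F => ‖z‖ ^ (-β)) Measure.addHaar := by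
    refine locallyIntegrable_of_norm_le_rpow (C := 1) (α := β) hd ?_ ?_ ?_
    · exact hβ.trans_le (by exact_mod_cast hd)
    · filter_upwards with z
      rw [one_mul, Real.norm_of_nonneg (by positivity)]
    · exact (measurable_norm.pow_const _).aestronglyMeasurable
  exact (hl.integrableOn_isCompact (isCompact_closedBall 0 R)).lintegral_lt_top

/-- Uniformity in `t` comes from splitting at distance one: near `t` translation invariance gives a
fixed integral, and away from `t` the integrand is at most one. The restriction `β < 1` makes this
work in every dimension of `F`, including one. -/
theorem exists_lintegral_rpow_le [Nontrivial F] (π : V →L[ℝ] F) (s : F →L[ℝ] V)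
    (hπs : ∀ z, π (s z) = z) (R : ℝ) {β : ℝ} (hβ0 : 0 ≤ β) (hβ : β < 1) :
    ∃ C : ℝ≥0, ∀ t : F, ∫⁻ x in closedBall 0 R, ENNReal.ofReal (‖t - π x‖ ^ (-β)) ∂μ ≤ C := by
  obtain ⟨C, hC⟩ := exists_lintegral_comp_le μ π s hπs R
  set lam : Measure F := Measure.addHaar
  set I := ∫⁻ z in closedBall (0 : F) 1, ENNReal.ofReal (‖z‖ ^ (-β)) ∂lam
  have hI : I ≠ ∞ := (lintegral_rpow_closedBall_lt_top hβ 1).ne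
  have hV : lam (closedBall 0 (‖π‖ * R)) ≠ ∞ := (isCompact_closedBall 0 _).measure_ne_top
  refine ⟨C * (I + lam (closedBall 0 (‖π‖ * R))).toNNReal, fun t => ?_⟩
  rw [ENNReal.coe_mul, ENNReal.coe_toNNReal (by finiteness)]
  have hm : Measurable fun z : F => ENNReal.ofReal (‖z‖ ^ (-β)) :=
    (measurable_norm.pow_const _).ennreal_ofReal
  refine (hC (fun z => ENNReal.ofReal (‖t - z‖ ^ (-β)))
    (hm.comp (measurable_const.sub measurable_id))).trans ?_
  gcongr
  calc ∫⁻ z in closedBall 0 (‖π‖ * R), ENNReal.ofReal (‖t - z‖ ^ (-β)) ∂lam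
      ≤ ∫⁻ z in closedBall 0 (‖π‖ * R),
          ((closedBall 0 1).indicator (fun z => ENNReal.ofReal (‖z‖ ^ (-β))) (t - z) + 1) ∂lam := by
        refine lintegral_mono fun z => ?_
        by_cases h : t - z ∈ closedBall (0 : F) 1
        · simp only [indicator_of_mem h]
          exact le_self_add
        · simp only [indicator_of_notMem h, zero_add]
          rw [← ENNReal.ofReal_one]
          apply ENNReal.ofReal_le_ofReal
          rw [mem_closedBall_zero_iff, not_le] at h
          exact Real.rpow_le_one_of_one_le_of_nonpos h.le (by linarith)
    _ = ∫⁻ z in closedBall 0 (‖π‖ * R),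
          (closedBall 0 1).indicator (fun z => ENNReal.ofReal (‖z‖ ^ (-β))) (t - z) ∂lam
          + lam (closedBall 0 (‖π‖ * R)) := by
        rw [lintegral_add_right _ measurable_const]
        simp
    _ ≤ I + lam (closedBall 0 (‖π‖ * R)) := by
        gcongr
        refine (setLIntegral_le_lintegral _ _).trans ?_
        rw [lintegral_sub_left_eq_self, lintegral_indicator measurableSet_closedBall]

end Averaging

/-! ### Coordinates and local integrability of the logarithmic kernel. -/

/-- A linear projection `V → F` together with a linear section. -/
structure Coordinate (V F : Type*) [NormedAddCommGroup V] [NormedSpace ℝ V]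
    [NormedAddCommGroup F] [NormedSpace ℝ F] where
  proj : V →L[ℝ] F
  sec : F →L[ℝ] V
  proj_sec : ∀ z, proj (sec z) = z

/-- Bounded measurable functions of bounded support. -/
structure IsBump {V : Type*} [NormedAddCommGroup V] [MeasurableSpace V] (f : V → ℝ) : Prop where
  meas : Measurable f
  bdd : ∃ C, ∀ x, |f x| ≤ C
  supp : ∃ R, ∀ x, R < ‖x‖ → f x = 0

/-- The logarithmic singularity is traded for a power of exponent below one, which is integrable in
every dimension; `r` takes care of infinity. -/
theorem abs_log_le {r : ℝ} (hr : 0 ≤ r) : |Real.log r| ≤ 2 * r ^ (-(1 / 2) : ℝ) + r := by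
  rcases hr.eq_or_lt with rfl | hr
  · simp
  have h1 : Real.log r ≤ r := (Real.log_le_sub_one_of_pos hr).trans (by linarith)
  have h2 := Real.log_le_rpow_div (inv_nonneg.mpr hr.le) (ε := 1 / 2) (by norm_num)
  rw [Real.log_inv, Real.inv_rpow hr.le, ← Real.rpow_neg hr.le] at h2
  have h3 : 0 ≤ r ^ (-(1 / 2) : ℝ) := by positivity
  rw [abs_le]
  constructor <;> linarith

section

variable {V F : Type*} [NormedAddCommGroup V] [NormedSpace ℝ V] [FiniteDimensional ℝ V]
  [MeasurableSpace V] [BorelSpace V] (μ : Measure V) [μ.IsAddHaarMeasure]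
  [NormedAddCommGroup F] [NormedSpace ℝ F] [FiniteDimensional ℝ F]
  [MeasurableSpace F] [BorelSpace F] [Nontrivial F] (c : Coordinate V F)

theorem exists_integral_rpow_le (R : ℝ) {β : ℝ} (hβ0 : 0 ≤ β) (hβ : β < 1) :
    ∃ C : ℝ, 0 ≤ C ∧ ∀ t : F,
      IntegrableOn (fun x => ‖t - c.proj x‖ ^ (-β)) (closedBall 0 R) μ ∧
      ∫ x in closedBall 0 R, ‖t - c.proj x‖ ^ (-β) ∂μ ≤ C := by
  obtain ⟨C, hC⟩ := exists_lintegral_rpow_le μ c.proj c.sec c.proj_sec R hβ0 hβ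
  refine ⟨C, C.2, fun t => ?_⟩
  have hm : Measurable fun x : V => ‖t - c.proj x‖ ^ (-β) := by fun_prop
  have h0 : ∀ x : V, 0 ≤ ‖t - c.proj x‖ ^ (-β) := fun x => by positivity
  constructor
  · refine ⟨hm.aestronglyMeasurable, ?_⟩
    rw [hasFiniteIntegral_iff_ofReal (ae_of_all _ h0)]
    exact (hC t).trans_lt ENNReal.coe_lt_top
  · rw [integral_eq_lintegral_of_nonneg_ae (ae_of_all _ h0) hm.aestronglyMeasurable]
    exact ENNReal.toReal_le_of_le_ofReal C.2 (by simpa using hC t)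

theorem exists_integral_abs_log_le (R : ℝ) :
    ∃ C : ℝ, 0 ≤ C ∧ ∀ t : F,
      IntegrableOn (fun x => Real.log ‖t - c.proj x‖) (closedBall 0 R) μ ∧
      ∫ x in closedBall 0 R, |Real.log ‖t - c.proj x‖| ∂μ ≤ C * (1 + ‖t‖) := by
  obtain ⟨C, hC0, hC⟩ := exists_integral_rpow_le μ c R (β := 1 / 2) (by norm_num) (by norm_num)
  have hfin : μ (closedBall 0 R) ≠ ∞ := (isCompact_closedBall 0 R).measure_ne_top
  set M := μ.real (closedBall (0 : V) R)
  have hM : 0 ≤ M := measureReal_nonneg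
  refine ⟨2 * C + M * ‖c.proj‖ * |R| + M, by positivity, fun t => ?_⟩
  have hm : Measurable fun x : V => Real.log ‖t - c.proj x‖ := by fun_prop
  have hb : ∀ x ∈ closedBall (0 : V) R, ‖Real.log ‖t - c.proj x‖‖
      ≤ 2 * ‖t - c.proj x‖ ^ (-(1 / 2) : ℝ) + (‖t‖ + ‖c.proj‖ * |R|) := fun x hx => by
    refine (abs_log_le (norm_nonneg _)).trans ?_
    gcongr
    refine (norm_sub_le _ _).trans ?_
    gcongr
    refine (c.proj.le_opNorm x).trans ?_
    gcongr
    exact (mem_closedBall_zero_iff.mp hx).trans (le_abs_self R)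
  have hi : IntegrableOn (fun x => 2 * ‖t - c.proj x‖ ^ (-(1 / 2) : ℝ) + (‖t‖ + ‖c.proj‖ * |R|))
      (closedBall 0 R) μ :=
    ((hC t).1.const_mul 2).add (integrableOn_const hfin)
  have hlog : IntegrableOn (fun x => Real.log ‖t - c.proj x‖) (closedBall 0 R) μ :=
    Integrable.mono' hi hm.aestronglyMeasurable
      ((ae_restrict_iff' measurableSet_closedBall).mpr (ae_of_all _ hb))
  refine ⟨hlog, ?_⟩
  calc ∫ x in closedBall 0 R, |Real.log ‖t - c.proj x‖| ∂μ
      ≤ ∫ x in closedBall 0 R, (2 * ‖t - c.proj x‖ ^ (-(1 / 2) : ℝ) + (‖t‖ + ‖c.proj‖ * |R|)) ∂μ :=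
        setIntegral_mono_on hlog.abs hi measurableSet_closedBall hb
    _ = 2 * (∫ x in closedBall 0 R, ‖t - c.proj x‖ ^ (-(1 / 2) : ℝ) ∂μ)
          + M * (‖t‖ + ‖c.proj‖ * |R|) := by
        rw [integral_add ((hC t).1.const_mul 2) (integrableOn_const hfin), integral_const_mul,
          setIntegral_const, smul_eq_mul]
    _ ≤ 2 * C + M * (‖t‖ + ‖c.proj‖ * |R|) := by gcongr; exact (hC t).2
    _ ≤ _ := by
      have : 0 ≤ (2 * C + M * ‖c.proj‖ * |R|) * ‖t‖ := by positivity
      nlinarith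

theorem integrableOn_prod_log (R : ℝ) :
    IntegrableOn (fun z : V × V => Real.log ‖c.proj z.1 - c.proj z.2‖)
      (closedBall 0 R ×ˢ closedBall 0 R) (μ.prod μ) := by
  obtain ⟨C, hC0, hC⟩ := exists_integral_abs_log_le μ c R
  have hm : Measurable fun z : V × V => Real.log ‖c.proj z.1 - c.proj z.2‖ := by fun_prop
  have : IsFiniteMeasure (μ.restrict (closedBall (0 : V) R)) :=
    ⟨by simpa using (isCompact_closedBall (0 : V) R).measure_lt_top⟩
  rw [IntegrableOn, ← Measure.prod_restrict, integrable_prod_iff hm.aestronglyMeasurable]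
  refine ⟨ae_of_all _ fun x => (hC (c.proj x)).1, ?_⟩
  refine Integrable.mono' (g := fun _ => C * (1 + ‖c.proj‖ * |R|)) (integrable_const _) ?_ ?_
  · exact hm.norm.stronglyMeasurable.integral_prod_right.aestronglyMeasurable
  · rw [ae_restrict_iff' measurableSet_closedBall]
    refine ae_of_all _ fun x hx => ?_
    rw [Real.norm_of_nonneg (integral_nonneg fun _ => norm_nonneg _)]
    refine (hC (c.proj x)).2.trans ?_
    gcongr
    refine (c.proj.le_opNorm x).trans ?_
    gcongr
    exact (mem_closedBall_zero_iff.mp hx).trans (le_abs_self R)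

end

/-! ### Operations on bounded functions of bounded support. -/

section Bump

variable {V : Type*} [NormedAddCommGroup V] [MeasurableSpace V] {f g : V → ℝ}

theorem IsBump.exists_bound (hf : IsBump f) :
    ∃ C R, 0 ≤ C ∧ 0 < R ∧ (∀ x, |f x| ≤ C) ∧ ∀ x, x ∉ closedBall 0 R → f x = 0 := by
  obtain ⟨C, hC⟩ := hf.bdd
  obtain ⟨R, hR⟩ := hf.supp
  refine ⟨C, max R 1, (abs_nonneg _).trans (hC 0), by positivity, hC, fun x hx => hR x ?_⟩
  rw [mem_closedBall_zero_iff, not_le] at hx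
  exact (le_max_left _ _).trans_lt hx

theorem IsBump.add (hf : IsBump f) (hg : IsBump g) : IsBump (fun x => f x + g x) := by
  obtain ⟨C, R, -, -, hC, hR⟩ := hf.exists_bound
  obtain ⟨C', R', -, -, hC', hR'⟩ := hg.exists_bound
  refine ⟨hf.meas.add hg.meas, ⟨C + C', fun x => ?_⟩, max R R', fun x hx => ?_⟩
  · exact (abs_add_le _ _).trans (add_le_add (hC x) (hC' x))
  · rw [hR, hR', add_zero] <;> rw [mem_closedBall_zero_iff, not_le]
    exacts [(le_max_right _ _).trans_lt hx, (le_max_left _ _).trans_lt hx]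

theorem IsBump.mul (hf : IsBump f) {φ : V → ℝ} (hφ : Measurable φ) {C' : ℝ}
    (hC' : ∀ x, |φ x| ≤ C') : IsBump (fun x => φ x * f x) := by
  obtain ⟨C, R, hC0, -, hC, hR⟩ := hf.exists_bound
  refine ⟨hφ.mul hf.meas, ⟨C' * C, fun x => ?_⟩, R, fun x hx => ?_⟩
  · rw [abs_mul]
    exact mul_le_mul (hC' x) (hC x) (abs_nonneg _) ((abs_nonneg _).trans (hC' x))
  · rw [hR x (by simpa using hx), mul_zero]

theorem IsBump.const_mul (hf : IsBump f) (a : ℝ) : IsBump (fun x => a * f x) :=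
  hf.mul (measurable_const (a := a)) (C' := |a|) fun _ => le_rfl

theorem IsBump.sub (hf : IsBump f) (hg : IsBump g) : IsBump (fun x => f x - g x) := by
  simpa [sub_eq_add_neg] using hf.add (hg.const_mul (-1))

theorem IsBump.indicator (hf : IsBump f) {A : Set V} (hA : MeasurableSet A) :
    IsBump (A.indicator f) := by
  have h := hf.mul (φ := A.indicator fun _ => (1 : ℝ)) (measurable_const.indicator hA) (C' := 1)
    fun x => by by_cases hx : x ∈ A <;> simp [hx]
  convert h using 2 with x
  by_cases hx : x ∈ A <;> simp [hx]

theorem isBump_indicator_one {A : Set V} (hA : MeasurableSet A) (hb : Bornology.IsBounded A) :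
    IsBump (A.indicator fun _ => (1 : ℝ)) := by
  obtain ⟨R, hR⟩ := hb.exists_norm_le
  refine ⟨measurable_const.indicator hA, ⟨1, fun x => ?_⟩, R, fun x hx => ?_⟩
  · by_cases hx : x ∈ A <;> simp [hx]
  · exact indicator_of_notMem (fun h => hx.not_ge (hR x h)) _

end Bump

/-! ### The bilinear logarithmic energy in one coordinate. -/

section Form

variable {V F : Type*} [NormedAddCommGroup V] [NormedSpace ℝ V] [FiniteDimensional ℝ V]
  [MeasurableSpace V] [BorelSpace V] (μ : Measure V) [μ.IsAddHaarMeasure]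
  [NormedAddCommGroup F] [NormedSpace ℝ F] [FiniteDimensional ℝ F]
  [MeasurableSpace F] [BorelSpace F] [Nontrivial F] (c : Coordinate V F) {f g k : V → ℝ}

/-- Logarithmic potential of the image of `f μ` under the projection. -/
noncomputable def pot (f : V → ℝ) (t : F) : ℝ := ∫ x, f x * Real.log ‖t - c.proj x‖ ∂μ

/-- Mutual logarithmic energy of the images of `f μ` and `g μ` under the projection. -/
noncomputable def form (f g : V → ℝ) : ℝ :=
  ∫ z, f z.1 * g z.2 * Real.log ‖c.proj z.1 - c.proj z.2‖ ∂(μ.prod μ)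

variable {μ} in
theorem IsBump.integrable_mul (hf : IsBump f) {φ : V → ℝ}
    (hφ : ∀ R, IntegrableOn φ (closedBall 0 R) μ) : Integrable (fun x => f x * φ x) μ := by
  obtain ⟨C, R, hC0, -, hC, hR⟩ := hf.exists_bound
  rw [← integrableOn_iff_integrable_of_support_subset (s := closedBall 0 R)]
  · exact (hφ R).bdd_mul hf.meas.aestronglyMeasurable (ae_of_all _ hC)
  · intro x hx
    by_contra h
    exact hx (by simp [hR x h])

variable {μ} in
theorem IsBump.integrable (hf : IsBump f) : Integrable f μ := by
  simpa using hf.integrable_mul (μ := μ) (φ := fun _ => 1) fun R =>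
    integrableOn_const (isCompact_closedBall (0 : V) R).measure_ne_top

variable {μ} in
theorem IsBump.integrable_mul_continuous (hf : IsBump f) {φ : V → ℝ} (hφ : Continuous φ) :
    Integrable (fun x => f x * φ x) μ :=
  hf.integrable_mul fun _ => hφ.continuousOn.integrableOn_compact (isCompact_closedBall _ _)

variable {μ} in
theorem IsBump.integrable_mul_log (hf : IsBump f) (t : F) :
    Integrable (fun x => f x * Real.log ‖t - c.proj x‖) μ :=
  hf.integrable_mul fun R => ((exists_integral_abs_log_le μ c R).choose_spec.2 t).1

variable {μ} in
theorem IsBump.integrable_form (hf : IsBump f) (hg : IsBump g) :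
    Integrable (fun z : V × V => f z.1 * g z.2 * Real.log ‖c.proj z.1 - c.proj z.2‖)
      (μ.prod μ) := by
  obtain ⟨C, R, hC0, -, hC, hR⟩ := hf.exists_bound
  obtain ⟨C', R', hC0', -, hC', hR'⟩ := hg.exists_bound
  rw [← integrableOn_iff_integrable_of_support_subset
    (s := closedBall 0 (max R R') ×ˢ closedBall 0 (max R R'))]
  · refine (integrableOn_prod_log μ c _).bdd_mul (c := C * C')
      ((hf.meas.comp measurable_fst).mul (hg.meas.comp measurable_snd)).aestronglyMeasurable
      (ae_of_all _ fun z => ?_)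
    rw [Real.norm_eq_abs, abs_mul]
    exact mul_le_mul (hC _) (hC' _) (abs_nonneg _) hC0
  · intro z hz
    by_contra h
    rw [mem_prod, not_and_or] at h
    refine hz ?_
    rcases h with h | h
    · simp [hR z.1 fun h' => h (closedBall_subset_closedBall (le_max_left _ _) h')]
    · simp [hR' z.2 fun h' => h (closedBall_subset_closedBall (le_max_right _ _) h')]

theorem form_comm : form μ c f g = form μ c g f := by
  rw [form, form, ← integral_prod_swap]
  simp only [Prod.fst_swap, Prod.snd_swap]
  congr with z
  rw [norm_sub_rev, mul_comm (f z.2)]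

theorem form_eq_integral_pot (hf : IsBump f) (hg : IsBump g) :
    form μ c f g = ∫ y, g y * pot μ c f (c.proj y) ∂μ := by
  rw [form, integral_prod_symm _ (hf.integrable_form c hg)]
  congr with y
  rw [pot, ← integral_const_mul]
  congr with x
  rw [norm_sub_rev]
  ring

variable {μ c} in
theorem form_add_left (hf : IsBump f) (hg : IsBump g) (hk : IsBump k) :
    form μ c (fun x => f x + g x) k = form μ c f k + form μ c g k := by
  rw [form, form, form, ← integral_add (hf.integrable_form c hk) (hg.integrable_form c hk)]
  congr with z
  ring

theorem form_const_mul_left (a : ℝ) : form μ c (fun x => a * f x) k = a * form μ c f k := by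
  rw [form, form, ← integral_const_mul]
  congr with z
  ring

variable {μ c} in
theorem form_add_right (hf : IsBump f) (hg : IsBump g) (hk : IsBump k) :
    form μ c k (fun x => f x + g x) = form μ c k f + form μ c k g := by
  simp only [form_comm μ c (f := k), form_add_left hf hg hk]

theorem form_const_mul_right (a : ℝ) : form μ c k (fun x => a * f x) = a * form μ c k f := by
  simp only [form_comm μ c (f := k), form_const_mul_left]

variable {μ c} in
theorem form_sub_left (hf : IsBump f) (hg : IsBump g) (hk : IsBump k) :
    form μ c (fun x => f x - g x) k = form μ c f k - form μ c g k := by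
  rw [form, form, form, ← integral_sub (hf.integrable_form c hk) (hg.integrable_form c hk)]
  congr with z
  ring

variable {μ c} in
theorem form_sub_right (hf : IsBump f) (hg : IsBump g) (hk : IsBump k) :
    form μ c k (fun x => f x - g x) = form μ c k f - form μ c k g := by
  simp only [form_comm μ c (f := k), form_sub_left hf hg hk]

variable {μ c} in
/-- Expansion of the energy of a sum. -/
theorem form_add_add (hf : IsBump f) (hg : IsBump g) :
    form μ c (fun x => f x + g x) (fun x => f x + g x)
      = form μ c f f + 2 * form μ c f g + form μ c g g := by
  rw [form_add_left hf hg (hf.add hg), form_add_right hf hg hf, form_add_right hf hg hg,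
    form_comm μ c (f := g) (g := f)]
  ring

end Form

/-! ### Affine involutions preserve Haar measure. -/

section Involution

variable {V F : Type*} [NormedAddCommGroup V] [NormedSpace ℝ V] [FiniteDimensional ℝ V]
  [MeasurableSpace V] [BorelSpace V] (μ : Measure V) [μ.IsAddHaarMeasure]
  [NormedAddCommGroup F] [NormedSpace ℝ F]

/-- The linear part squares to the identity, so its determinant is `±1`. -/
theorem measurePreserving_of_affine_involution (T : V → V) (L : V →L[ℝ] V) (b : V)
    (hT : ∀ x, T x = L x + b) (hTT : ∀ x, T (T x) = x) : MeasurePreserving T μ μ := by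
  have hb : L b + b = 0 := by simpa [hT] using hTT 0
  have hLL : ∀ x, L (L x) = x := fun x => by
    have h := hTT x
    rw [hT, hT, map_add, add_assoc, hb, add_zero] at h
    exact h
  have hdet : LinearMap.det (L : V →ₗ[ℝ] V) * LinearMap.det (L : V →ₗ[ℝ] V) = 1 := by
    rw [← LinearMap.det_comp, show (L : V →ₗ[ℝ] V) ∘ₗ (L : V →ₗ[ℝ] V) = LinearMap.id from
      LinearMap.ext hLL, LinearMap.det_id]
  have habs : |(LinearMap.det (L : V →ₗ[ℝ] V))⁻¹| = 1 := by
    rw [abs_inv, inv_eq_one]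
    have h := congrArg abs hdet
    rw [abs_mul, abs_one] at h
    nlinarith [abs_nonneg (LinearMap.det (L : V →ₗ[ℝ] V))]
  have hT' : T = (fun x => x + b) ∘ L := funext hT
  have hL : MeasurePreserving L μ μ := by
    refine ⟨L.continuous.measurable, ?_⟩
    have h := Measure.map_linearMap_addHaar_eq_smul_addHaar μ (f := (L : V →ₗ[ℝ] V))
      (left_ne_zero_of_mul_eq_one hdet)
    rw [habs, ENNReal.ofReal_one, one_smul] at h
    exact h
  rw [hT']
  exact (measurePreserving_add_right μ b).comp hL

/-- Action on one coordinate of a self-map of its target. -/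
def Coordinate.lift (c : Coordinate V F) (σ : F → F) (x : V) : V :=
  x + c.sec (σ (c.proj x) - c.proj x)

theorem Coordinate.proj_lift (c : Coordinate V F) (σ : F → F) (x : V) :
    c.proj (c.lift σ x) = σ (c.proj x) := by
  simp [lift, c.proj_sec]

theorem Coordinate.lift_lift (c : Coordinate V F) {σ : F → F} (h : ∀ z, σ (σ z) = z) (x : V) :
    c.lift σ (c.lift σ x) = x := by
  rw [lift, c.proj_lift, h, lift, add_assoc, ← map_add]
  simp

theorem Coordinate.measurePreserving_lift (c : Coordinate V F) {σ : F → F} (L : F →L[ℝ] F) (b : F)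
    (hσ : ∀ z, σ z = L z + b) (hσσ : ∀ z, σ (σ z) = z) : MeasurePreserving (c.lift σ) μ μ := by
  refine measurePreserving_of_affine_involution μ (c.lift σ)
    (.id ℝ V + c.sec ∘L ((L - .id ℝ F) ∘L c.proj)) (c.sec b) (fun x => ?_) (c.lift_lift hσσ)
  simp [lift, hσ]
  abel

end Involution

/-! ### Reflections in hyperplanes and the logarithmic kernel. -/

section Reflection

variable {F : Type*} [NormedAddCommGroup F] [InnerProductSpace ℝ F]

/-- Reflection in the hyperplane `⟪e, z⟫ = a`, for a unit vector `e`. -/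
noncomputable def refl (e : F) (a : ℝ) (z : F) : F := z - (2 * (inner ℝ e z - a)) • e

variable {e : F} (he : ‖e‖ = 1) (a : ℝ)
include he

theorem inner_refl (z : F) : inner ℝ e (refl e a z) - a = -(inner ℝ e z - a) := by
  rw [refl, inner_sub_right, inner_smul_right, real_inner_self_eq_norm_sq, he]
  ring

theorem refl_refl (z : F) : refl e a (refl e a z) = z := by
  rw [refl, inner_refl he, refl]
  module

/-- All sign arguments rest on this identity: the product of the signed distances to the mirror
decides whether `y` or its image is closer to `x`, and by how much. -/
theorem norm_sub_refl_sq (x y : F) :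
    ‖x - refl e a y‖ ^ 2 = ‖x - y‖ ^ 2 + 4 * (inner ℝ e x - a) * (inner ℝ e y - a) := by
  rw [refl, show x - (y - (2 * (inner ℝ e y - a)) • e) = (x - y) + (2 * (inner ℝ e y - a)) • e by
    module, norm_add_sq_real, inner_smul_right, norm_smul, he, real_inner_comm e (x - y),
    inner_sub_right, mul_one, Real.norm_eq_abs, sq_abs]
  ring

theorem norm_refl_sub_refl (x y : F) : ‖refl e a x - refl e a y‖ = ‖x - y‖ := by
  have h1 := norm_sub_refl_sq he a (refl e a x) y
  rw [inner_refl he, norm_sub_rev (refl e a x) y, norm_sub_refl_sq he a y x] at h1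
  refine (sq_eq_sq₀ (norm_nonneg _) (norm_nonneg _)).mp ?_
  rw [h1, norm_sub_rev y x]
  ring

theorem norm_refl_sub (x y : F) : ‖refl e a x - y‖ = ‖x - refl e a y‖ := by
  rw [← norm_refl_sub_refl he a x, refl_refl he]

theorem log_lt_log_refl {x y : F} (hxy : x ≠ y)
    (h : 0 < (inner ℝ e x - a) * (inner ℝ e y - a)) :
    Real.log ‖x - y‖ < Real.log ‖x - refl e a y‖ := by
  refine Real.log_lt_log (norm_pos_iff.mpr (sub_ne_zero.mpr hxy)) ?_
  refine lt_of_pow_lt_pow_left₀ 2 (norm_nonneg _) ?_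
  rw [norm_sub_refl_sq he]
  linarith

/-- The sign of the change of `log ‖x - y‖` under a reflection of `y`. -/
theorem mul_log_refl_pos {x y : F} (hx : inner ℝ e x - a ≠ 0) (hy : inner ℝ e y - a ≠ 0)
    (hxy : x ≠ y) (hxy' : x ≠ refl e a y) :
    0 < (inner ℝ e x - a) * (inner ℝ e y - a) *
      (Real.log ‖x - refl e a y‖ - Real.log ‖x - y‖) := by
  rcases (mul_ne_zero hx hy).lt_or_gt with h | h
  · refine mul_pos_of_neg_of_neg h (sub_neg.mpr ?_)
    have := log_lt_log_refl he a hxy' (by rw [inner_refl he]; linarith)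
    rwa [refl_refl he] at this
  · exact mul_pos h (sub_pos.mpr (log_lt_log_refl he a hxy h))

omit he in
theorem refl_eq (z : F) :
    refl e a z = (.id ℝ F - (2 : ℝ) • (innerSL ℝ e).smulRight e) z + (2 * a) • e := by
  simp only [refl, sub_apply, ContinuousLinearMap.id_apply,
    smul_apply, ContinuousLinearMap.smulRight_apply, innerSL_apply_apply]
  module

omit he in
theorem continuous_refl : Continuous (refl e a) := by
  unfold refl
  fun_prop

end Reflection

theorem measure_hyperplane {E : Type*} [NormedAddCommGroup E] [NormedSpace ℝ E]
    [FiniteDimensional ℝ E] [MeasurableSpace E] [BorelSpace E] (μ : Measure E)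
    [μ.IsAddHaarMeasure] {l : E →ₗ[ℝ] ℝ} (hl : l ≠ 0) (a : ℝ) : μ {x | l x = a} = 0 := by
  obtain ⟨x₀, hx₀⟩ := LinearMap.surjective hl a
  have h0 : μ (LinearMap.ker l : Set E) = 0 := by
    refine Measure.addHaar_submodule μ _ fun h => hl ?_
    exact LinearMap.ker_eq_top.mp h
  have : {x | l x = a} = (fun x => x + -x₀) ⁻¹' (LinearMap.ker l : Set E) := by
    ext x
    simp [hx₀, ← sub_eq_add_neg, sub_eq_zero]
  rw [this, measure_preimage_add_right, h0]

theorem integral_comp_measurePreserving {X Y : Type*} [MeasurableSpace X] [MeasurableSpace Y]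
    {μ : Measure X} {ν : Measure Y} {T : X → Y} (hT : MeasurePreserving T μ ν) {f : Y → ℝ}
    (hf : Measurable f) : ∫ x, f (T x) ∂μ = ∫ y, f y ∂ν := by
  rw [← hT.map_eq, integral_map hT.measurable.aemeasurable hf.aestronglyMeasurable]

/-! ### Admissible densities and polarization of a minimizer. -/

section Setting

variable {V : Type*} [NormedAddCommGroup V] [NormedSpace ℝ V] [FiniteDimensional ℝ V]
  [MeasurableSpace V] [BorelSpace V] (μ : Measure V) [μ.IsAddHaarMeasure]

theorem IsBump.comp {T : V → V} {f : V → ℝ} (hf : IsBump f) (hT : Continuous T)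
    (hTT : ∀ x, T (T x) = x) : IsBump (fun x => f (T x)) := by
  obtain ⟨C, R, -, -, hC, hR⟩ := hf.exists_bound
  obtain ⟨R', hR'⟩ := ((isCompact_closedBall (0 : V) R).image hT).isBounded.exists_norm_le
  refine ⟨hf.meas.comp hT.measurable, ⟨C, fun x => hC _⟩, R', fun x hx => hR _ fun h => ?_⟩
  exact hx.not_ge (hR' x ⟨T x, h, hTT x⟩)

theorem IsBump.measurable_integrand {F : Type*} [NormedAddCommGroup F] [NormedSpace ℝ F]
    [MeasurableSpace F] [BorelSpace F] [FiniteDimensional ℝ F]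
    (c : Coordinate V F) {f g : V → ℝ} (hf : IsBump f) (hg : IsBump g) :
    Measurable fun z : V × V => f z.1 * g z.2 * Real.log ‖c.proj z.1 - c.proj z.2‖ := by
  have := hf.meas
  have := hg.meas
  fun_prop

theorem form_comp {F : Type*} [NormedAddCommGroup F] [NormedSpace ℝ F]
    [MeasurableSpace F] [BorelSpace F] [FiniteDimensional ℝ F]
    (c : Coordinate V F) {f g : V → ℝ} (hf : IsBump f) (hg : IsBump g) {S T : V → V}
    (hS : MeasurePreserving S μ μ) (hT : MeasurePreserving T μ μ)
    (h : ∀ x y, ‖c.proj (S x) - c.proj (T y)‖ = ‖c.proj x - c.proj y‖) :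
    form μ c (fun x => f (S x)) (fun x => g (T x)) = form μ c f g := by
  rw [form, form, ← integral_comp_measurePreserving (hS.prod hT) (hf.measurable_integrand c hg)]
  simp [h]

/-- Probability densities that are bounded by one and have bounded support. -/
structure IsDensity (f : V → ℝ) : Prop where
  bump : IsBump f
  nonneg : ∀ x, 0 ≤ f x
  le_one : ∀ x, f x ≤ 1
  integral_eq_one : ∫ x, f x ∂μ = 1

section Polarization

variable {ι : Type*} [Fintype ι] {F : ι → Type*} [∀ i, NormedAddCommGroup (F i)]
  [∀ i, InnerProductSpace ℝ (F i)]
  [∀ i, FiniteDimensional ℝ (F i)] [∀ i, MeasurableSpace (F i)] [∀ i, BorelSpace (F i)]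
  [∀ i, Nontrivial (F i)]
  (c : ∀ i, Coordinate V (F i)) (d : ι → ℝ)

/-- `f` minimizes the weighted sum of the logarithmic energies of its projections. -/
structure IsMinimizer (f : V → ℝ) : Prop where
  density : IsDensity μ f
  le : ∀ g, IsDensity μ g → ∑ i, d i * form μ (c i) f f ≤ ∑ i, d i * form μ (c i) g g

/-- The hypothesis that the coordinates are independent of each other. -/
def IsOrthogonal : Prop := ∀ i j, j ≠ i → ∀ z, (c j).proj ((c i).sec z) = 0

variable {μ c d}

theorem IsOrthogonal.proj_lift (hc : IsOrthogonal c) {i j : ι} (hij : j ≠ i) (σ : F i → F i)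
    (x : V) : (c j).proj ((c i).lift σ x) = (c j).proj x := by
  rw [Coordinate.lift, map_add, hc i j hij, add_zero]

variable {f : V → ℝ} {i : ι} {e : F i}

theorem Coordinate.measurePreserving_refl (he : ‖e‖ = 1) (a : ℝ) :
    MeasurePreserving ((c i).lift (refl e a)) μ μ :=
  (c i).measurePreserving_lift μ _ _ (refl_eq a) (refl_refl he a)

theorem Coordinate.continuous_lift {σ : F i → F i} (hσ : Continuous σ) :
    Continuous ((c i).lift σ) := by
  unfold Coordinate.lift
  fun_prop

/-- Replacing `f` by `f ∘ T` on a `T`-invariant set `Q` gives a competitor. Energies in the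
coordinates other than `i` are unchanged because `T` does not move them. In coordinate `i` the
self-energies of the two pieces are unchanged because `T` is an isometry there, so only the cross
term between the pieces can differ. -/
theorem IsMinimizer.form_indicator_le (hf : IsMinimizer μ c d f) (hc : IsOrthogonal c)
    (hd : ∀ i, 0 < d i) (he : ‖e‖ = 1) (a : ℝ) {Q : Set V} (hQ : MeasurableSet Q)
    (hTQ : ∀ x, (c i).lift (refl e a) x ∈ Q ↔ x ∈ Q) :
    form μ (c i) (Qᶜ.indicator f) (Q.indicator f)
      ≤ form μ (c i) (Qᶜ.indicator f) (fun x => Q.indicator f ((c i).lift (refl e a) x)) := by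
  set T := (c i).lift (refl e a) with hT
  have hTT : ∀ x, T (T x) = x := (c i).lift_lift (refl_refl he a)
  have hTm : MeasurePreserving T μ μ := Coordinate.measurePreserving_refl he a
  have hTc : Continuous T := Coordinate.continuous_lift (continuous_refl a)
  have hfb := hf.density.bump
  have hα : IsBump (Qᶜ.indicator f) := hfb.indicator hQ.compl
  have hβ : IsBump (Q.indicator f) := hfb.indicator hQ
  have hβT : IsBump (fun x => Q.indicator f (T x)) := hβ.comp hTc hTT
  have hfαβ : (fun x => Qᶜ.indicator f x + Q.indicator f x) = f := by
    ext x
    by_cases hx : x ∈ Q <;> simp [hx]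
  set g := fun x => Qᶜ.indicator f x + Q.indicator f (T x) with hg
  have hgx : ∀ x, g x = if x ∈ Q then f (T x) else f x := fun x => by
    by_cases hx : x ∈ Q <;> simp [g, hx, hTQ]
  have hint : ∫ x, g x ∂μ = 1 := by
    rw [hg, integral_add hα.integrable hβT.integrable,
      integral_comp_measurePreserving hTm hβ.meas,
      ← integral_add hα.integrable hβ.integrable, hfαβ, hf.density.integral_eq_one]
  have hgd : IsDensity μ g := by
    refine ⟨hα.add hβT, fun x => ?_, fun x => ?_, hint⟩ <;> rw [hgx] <;> split_ifs
    exacts [hf.density.nonneg _, hf.density.nonneg _, hf.density.le_one _, hf.density.le_one _]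
  have hE := hf.le g hgd
  have hne : ∀ j, j ≠ i → form μ (c j) g g = form μ (c j) f f := fun j hj => by
    have hp : ∀ x, (c j).proj (T x) = (c j).proj x := hc.proj_lift hj _
    have h : form μ (c j) (Qᶜ.indicator f) (fun x => Q.indicator f (T x))
        = form μ (c j) (Qᶜ.indicator f) (Q.indicator f) :=
      form_comp μ (c j) hα hβ (.id μ) hTm (by simp [hp])
    rw [hg, form_add_add hα hβT, form_comp μ (c j) hβ hβ hTm hTm (by simp [hp]), h,
      ← form_add_add hα hβ, hfαβ]
  rw [← Finset.add_sum_erase _ _ (Finset.mem_univ i),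
    ← Finset.add_sum_erase _ (fun j => d j * form μ (c j) g g) (Finset.mem_univ i),
    Finset.sum_congr rfl fun j hj => by rw [← hne j (Finset.ne_of_mem_erase hj)],
    add_le_add_iff_right, mul_le_mul_iff_right₀ (hd i)] at hE
  have h1 := form_add_add (μ := μ) (c := c i) hα hβ
  have h2 := form_add_add (μ := μ) (c := c i) hα hβT
  rw [hfαβ] at h1
  rw [form_comp μ (c i) hβ hβ hTm hTm fun x y => by
    rw [hT, (c i).proj_lift, (c i).proj_lift, norm_refl_sub_refl he]] at h2
  linarith

/-- The difference is averaged over the images of both variables under `T`; the four combinations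
produce the factor `4⁻¹`. The antisymmetrized densities have signs that can be compared with that of
the kernel difference. -/
theorem form_sub_form_refl (he : ‖e‖ = 1) (a : ℝ) {α β : V → ℝ} (hα : IsBump α) (hβ : IsBump β) :
    let T := (c i).lift (refl e a)
    let J := fun z : V × V => (α z.1 - α (T z.1)) * (β z.2 - β (T z.2)) *
      (Real.log ‖(c i).proj z.1 - refl e a ((c i).proj z.2)‖
        - Real.log ‖(c i).proj z.1 - (c i).proj z.2‖)
    Integrable J (μ.prod μ) ∧
    form μ (c i) α (fun x => β (T x)) - form μ (c i) α β = 4⁻¹ * ∫ z, J z ∂(μ.prod μ) := by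
  intro T J
  have hTT : ∀ x, T (T x) = x := (c i).lift_lift (refl_refl he a)
  have hTm : MeasurePreserving T μ μ := Coordinate.measurePreserving_refl he a
  have hTc : Continuous T := Coordinate.continuous_lift (continuous_refl a)
  have hp : ∀ x, (c i).proj (T x) = refl e a ((c i).proj x) := (c i).proj_lift _
  have hαT := hα.comp hTc hTT
  have hβT := hβ.comp hTc hTT
  have hA := hα.sub hαT
  have hB := hβ.sub hβT
  set A := fun x => α x - α (T x)
  set B := fun x => β x - β (T x)
  have hBT : IsBump (fun x => B (T x)) := hB.comp hTc hTT
  have hBneg : (fun x => B (T x)) = fun x => (-1) * B x := by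
    ext x
    simp [B, hTT]
  have hid := (MeasurePreserving.id μ).prod hTm
  have hI1 := hA.integrable_form (μ := μ) (c i) hB
  have hI2 : Integrable (fun z : V × V =>
      A z.1 * B z.2 * Real.log ‖(c i).proj z.1 - refl e a ((c i).proj z.2)‖) (μ.prod μ) := by
    have h := hid.integrable_comp_of_integrable (hA.integrable_form (μ := μ) (c i) hBT)
    refine h.congr (ae_of_all _ fun z => ?_)
    simp [hp, hTT]
  have hJ : J = fun z => A z.1 * B z.2 * Real.log ‖(c i).proj z.1 - refl e a ((c i).proj z.2)‖
      - A z.1 * B z.2 * Real.log ‖(c i).proj z.1 - (c i).proj z.2‖ := by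
    ext z
    simp only [J, A, B]
    ring
  refine ⟨hJ ▸ hI2.sub hI1, ?_⟩
  have e1 : ∫ z, A z.1 * B z.2 * Real.log ‖(c i).proj z.1 - refl e a ((c i).proj z.2)‖ ∂(μ.prod μ)
      = form μ (c i) A (fun x => B (T x)) := by
    rw [form, ← integral_comp_measurePreserving hid (hA.measurable_integrand (c i) hBT)]
    simp [hp, hTT]
  rw [hJ, integral_sub hI2 hI1, e1, hBneg, form_const_mul_right]
  change _ = 4⁻¹ * (_ - form μ (c i) A B)
  have hiso : ∀ x y, ‖(c i).proj (T x) - (c i).proj (T y)‖ = ‖(c i).proj x - (c i).proj y‖ :=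
    fun x y => by rw [hp, hp, norm_refl_sub_refl he]
  have e2 : form μ (c i) (fun x => α (T x)) (fun x => β (T x)) = form μ (c i) α β :=
    form_comp μ (c i) hα hβ hTm hTm hiso
  have e3 : form μ (c i) (fun x => α (T x)) β = form μ (c i) α (fun x => β (T x)) := by
    rw [← form_comp μ (c i) hα hβT hTm hTm hiso]
    simp [hTT]
  rw [form_sub_left hα hαT hB, form_sub_right hβ hβT hα, form_sub_right hβ hβT hαT, e2, e3]
  ring

theorem Coordinate.ae_inner_ne (he : ‖e‖ = 1) (a : ℝ) :
    ∀ᵐ x ∂μ, inner ℝ e ((c i).proj x) - a ≠ 0 := by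
  have hl : ((innerSL ℝ e).toLinearMap ∘ₗ (c i).proj.toLinearMap) ≠ 0 := fun h => by
    have := LinearMap.congr_fun h ((c i).sec e)
    simp [(c i).proj_sec, he] at this
  filter_upwards [measure_eq_zero_iff_ae_notMem.mp (measure_hyperplane μ hl a)] with x hx h
  exact hx (by simpa [sub_eq_zero] using h)

theorem Coordinate.ae_proj_ne (t : F i) : ∀ᵐ x ∂μ, t ≠ (c i).proj x := by
  obtain ⟨e, he⟩ := exists_norm_eq (F i) zero_le_one
  filter_upwards [Coordinate.ae_inner_ne (μ := μ) (c := c) he (inner ℝ e t)] with x hx h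
  exact hx (by simp [h])

theorem Coordinate.ae_prod_ne (he : ‖e‖ = 1) (a : ℝ) :
    ∀ᵐ z ∂(μ.prod μ), inner ℝ e ((c i).proj z.1) - a ≠ 0 ∧ inner ℝ e ((c i).proj z.2) - a ≠ 0 ∧
      (c i).proj z.1 ≠ (c i).proj z.2 ∧ (c i).proj z.1 ≠ refl e a ((c i).proj z.2) := by
  have h1 := Measure.quasiMeasurePreserving_fst (μ := μ) (ν := μ) |>.ae
    (Coordinate.ae_inner_ne (μ := μ) (c := c) he a)
  have h2 := Measure.quasiMeasurePreserving_snd (μ := μ) (ν := μ) |>.ae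
    (Coordinate.ae_inner_ne (μ := μ) (c := c) he a)
  have hm3 : MeasurableSet {z : V × V | (c i).proj z.1 ≠ (c i).proj z.2} :=
    (measurableSet_eq_fun (by fun_prop) (by fun_prop)).compl
  have h3 : ∀ᵐ z ∂(μ.prod μ), (c i).proj z.1 ≠ (c i).proj z.2 :=
    (Measure.ae_prod_iff_ae_ae hm3).mpr (ae_of_all _ fun x => Coordinate.ae_proj_ne ((c i).proj x))
  have hm4 : MeasurableSet {z : V × V | (c i).proj z.1 ≠ refl e a ((c i).proj z.2)} :=
    (measurableSet_eq_fun (by fun_prop)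
      ((continuous_refl a).measurable.comp (by fun_prop))).compl
  have h4 : ∀ᵐ z ∂(μ.prod μ), (c i).proj z.1 ≠ refl e a ((c i).proj z.2) := by
    refine (Measure.ae_prod_iff_ae_ae hm4).mpr (ae_of_all _ fun x => ?_)
    filter_upwards [Coordinate.ae_proj_ne (μ := μ) (refl e a ((c i).proj x))] with y hy h
    exact hy (by rw [h, refl_refl he])
  filter_upwards [h1, h2, h3, h4] with z h1 h2 h3 h4
  exact ⟨h1, h2, h3, h4⟩

/-- A minimizer is, up to null sets, ordered by every reflection in a coordinate. -/
theorem IsMinimizer.ae_nonneg_or_ae_nonpos (hf : IsMinimizer μ c d f) (hc : IsOrthogonal c)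
    (hd : ∀ i, 0 < d i) (he : ‖e‖ = 1) (a : ℝ) :
    (∀ᵐ x ∂μ, 0 ≤ (inner ℝ e ((c i).proj x) - a) * (f x - f ((c i).lift (refl e a) x))) ∨
    (∀ᵐ x ∂μ, (inner ℝ e ((c i).proj x) - a) * (f x - f ((c i).lift (refl e a) x)) ≤ 0) := by
  set T := (c i).lift (refl e a) with hT
  have hTT : ∀ x, T (T x) = x := (c i).lift_lift (refl_refl he a)
  have hTc : Continuous T := Coordinate.continuous_lift (continuous_refl a)
  have hp : ∀ x, (c i).proj (T x) = refl e a ((c i).proj x) := (c i).proj_lift _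
  set u : V → ℝ := fun x => inner ℝ e ((c i).proj x) - a with hu
  have huT : ∀ x, u (T x) = - u x := fun x => by simp only [u, hp, inner_refl he]
  set D : V → ℝ := fun x => f x - f (T x) with hD
  have hDT : ∀ x, D (T x) = - D x := fun x => by simp [D, hTT]
  have hfb := hf.density.bump
  have hum : Measurable u := by fun_prop
  have hDm : Measurable D := (hfb.sub (hfb.comp hTc hTT)).meas
  -- The set on which the larger of the two values `f x`, `f (T x)` lies on the negative side of the
  -- mirror. Exchanging the values there sorts the density.
  set Q : Set V := {x | u x * D x < 0}
  have hQ : MeasurableSet Q := measurableSet_lt (hum.mul hDm) measurable_const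
  have hTQ : ∀ x, T x ∈ Q ↔ x ∈ Q := fun x => by simp [Q, huT, hDT]
  have hmin := hf.form_indicator_le hc hd he a hQ hTQ
  obtain ⟨hJi, hJ⟩ := form_sub_form_refl (μ := μ) (c := c) he a (hfb.indicator hQ.compl)
    (hfb.indicator hQ)
  have hα : ∀ x, Qᶜ.indicator f x - Qᶜ.indicator f (T x) = Qᶜ.indicator D x := fun x => by
    by_cases hx : x ∈ Q <;> simp [hx, hTQ, D]
  have hβ : ∀ x, Q.indicator f x - Q.indicator f (T x) = Q.indicator D x := fun x => by
    by_cases hx : x ∈ Q <;> simp [hx, hTQ, D]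
  rw [← hT] at hJi hJ
  simp only [hα, hβ] at hJi hJ
  have hsign : ∀ᵐ z ∂(μ.prod μ), Qᶜ.indicator D z.1 * Q.indicator D z.2 *
      (Real.log ‖(c i).proj z.1 - refl e a ((c i).proj z.2)‖
        - Real.log ‖(c i).proj z.1 - (c i).proj z.2‖) ≤ 0 ∧
      (Qᶜ.indicator D z.1 ≠ 0 → Q.indicator D z.2 ≠ 0 →
      Qᶜ.indicator D z.1 * Q.indicator D z.2 *
      (Real.log ‖(c i).proj z.1 - refl e a ((c i).proj z.2)‖
        - Real.log ‖(c i).proj z.1 - (c i).proj z.2‖) ≠ 0) := by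
    filter_upwards [Coordinate.ae_prod_ne (μ := μ) (c := c) he a] with z ⟨h1, h2, h3, h4⟩
    have hk := mul_log_refl_pos he a h1 h2 h3 h4
    set k := Real.log ‖(c i).proj z.1 - refl e a ((c i).proj z.2)‖
        - Real.log ‖(c i).proj z.1 - (c i).proj z.2‖
    change 0 < u z.1 * u z.2 * k at hk
    by_cases hz1 : z.1 ∈ Q
    · simp [hz1]
    by_cases hz2 : z.2 ∈ Q
    · simp only [indicator_of_mem (show z.1 ∈ Qᶜ from hz1), indicator_of_mem hz2]
      have hz1' : 0 ≤ u z.1 * D z.1 := not_lt.mp hz1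
      have hz2' : u z.2 * D z.2 < 0 := hz2
      refine ⟨?_, fun hn1 hn2 => mul_ne_zero (mul_ne_zero hn1 hn2) fun h => by simp [h] at hk⟩
      have h5 : (u z.1 * D z.1) * (u z.2 * D z.2) * (u z.1 * u z.2 * k) ≤ 0 :=
        mul_nonpos_of_nonpos_of_nonneg (mul_nonpos_of_nonneg_of_nonpos hz1' hz2'.le) hk.le
      have h6 : 0 < (u z.1 * u z.2) ^ 2 := by
        have : u z.1 * u z.2 ≠ 0 := mul_ne_zero h1 h2
        positivity
      by_contra hcon
      rw [not_le] at hcon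
      nlinarith [mul_pos h6 hcon]
    · simp [hz2]
  have hint0 : ∫ z, Qᶜ.indicator D z.1 * Q.indicator D z.2 *
      (Real.log ‖(c i).proj z.1 - refl e a ((c i).proj z.2)‖
        - Real.log ‖(c i).proj z.1 - (c i).proj z.2‖) ∂(μ.prod μ) = 0 := by
    refine le_antisymm (integral_nonpos_of_ae (hsign.mono fun z hz => hz.1)) ?_
    linarith
  have hzero := (integral_eq_zero_iff_of_nonneg_ae
    (hsign.mono fun z hz => by simpa using neg_nonneg.mpr hz.1) hJi.neg).mp
    (by simpa [integral_neg] using hint0)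
  -- The integrand vanishes only where one of the two factors `D` does. So the product of their
  -- supports is null and one of the supports is null, which gives the two alternatives.
  have hnull : (μ.prod μ) ({x | Qᶜ.indicator D x ≠ 0} ×ˢ {x | Q.indicator D x ≠ 0}) = 0 := by
    refine measure_eq_zero_iff_ae_notMem.mpr ?_
    filter_upwards [hzero, hsign] with z h1 h2 hz
    exact h2.2 hz.1 hz.2 (by simpa using h1)
  rw [Measure.prod_prod, mul_eq_zero] at hnull
  rcases hnull with h | h
  · right
    filter_upwards [measure_eq_zero_iff_ae_notMem.mp h] with x hx
    by_cases hxQ : x ∈ Q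
    · exact le_of_lt hxQ
    · have : D x = 0 := by simpa [hxQ] using hx
      change u x * D x ≤ 0
      rw [this, mul_zero]
  · left
    filter_upwards [measure_eq_zero_iff_ae_notMem.mp h] with x hx
    by_cases hxQ : x ∈ Q
    · have h0 : D x = 0 := by simpa [hxQ] using hx
      change 0 ≤ u x * D x
      rw [h0, mul_zero]
    · exact not_lt.mp hxQ

end Polarization
end Setting
-- The logarithmic potential in one coordinate.
theorem log_sub_log_le_sqrt {a b : ℝ} (hb : 0 < b) (hab : b ≤ a) :
    Real.log a - Real.log b ≤ 2 * (√(a - b) * (√b)⁻¹) := by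
  have ha := hb.trans_le hab
  have hsb := Real.sqrt_pos.mpr hb
  have hsa := Real.sqrt_pos.mpr ha
  have h1 : Real.log a - Real.log b = 2 * Real.log (√a / √b) := by
    rw [Real.log_div hsa.ne' hsb.ne', Real.log_sqrt ha.le, Real.log_sqrt hb.le]
    ring
  have h2 := Real.log_le_sub_one_of_pos (div_pos hsa hsb)
  have h3 : √a ≤ √b + √(a - b) := by
    rw [Real.sqrt_le_left (by positivity)]
    nlinarith [Real.sq_sqrt hb.le, Real.sq_sqrt (sub_nonneg.mpr hab), Real.sqrt_nonneg (a - b)]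
  have h4 : √a / √b - 1 ≤ √(a - b) * (√b)⁻¹ := by
    rw [← div_eq_mul_inv, div_sub_one hsb.ne']
    gcongr
    linarith
  linarith

/-- The exponent one half splits the singularity evenly: half a power goes into a Hölder modulus,
and the other half is a singularity that is integrable even on a line. -/
theorem abs_log_norm_sub_le {F : Type*} [NormedAddCommGroup F] {x y : F} (hx : x ≠ 0)
    (hy : y ≠ 0) :
    |Real.log ‖x‖ - Real.log ‖y‖|
      ≤ 2 * (√‖x - y‖ * (‖x‖ ^ (-(1 / 2) : ℝ) + ‖y‖ ^ (-(1 / 2) : ℝ))) := by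
  wlog h : ‖y‖ ≤ ‖x‖ generalizing x y
  · rw [abs_sub_comm, norm_sub_rev, add_comm]
    exact this hy hx (le_of_not_ge h)
  have hy' := norm_pos_iff.mpr hy
  rw [abs_of_nonneg (sub_nonneg.mpr (Real.log_le_log hy' h))]
  refine (log_sub_log_le_sqrt hy' h).trans ?_
  rw [Real.rpow_neg (norm_nonneg y), ← Real.sqrt_eq_rpow]
  gcongr
  · exact norm_sub_norm_le x y
  · exact le_add_of_nonneg_left (by positivity)

/-- The mirror is the perpendicular bisector of `x` and `y`; the points closer to `x` than to `y`,
among them `m` and `x`, form its positive side. -/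
theorem exists_refl_eq {F : Type*} [NormedAddCommGroup F] [InnerProductSpace ℝ F] {m x y : F}
    (h : ‖x - m‖ < ‖y - m‖) :
    ∃ (e : F) (a : ℝ), ‖e‖ = 1 ∧ a < inner ℝ e m ∧ a < inner ℝ e x ∧ refl e a x = y := by
  have hne : x - y ≠ 0 := sub_ne_zero.mpr fun h' => by simp [h'] at h
  have hn : ‖x - y‖ ≠ 0 := norm_ne_zero_iff.mpr hne
  have hn' : 0 < ‖x - y‖ := norm_pos_iff.mpr hne
  have key : ∀ z : F, inner ℝ (‖x - y‖⁻¹ • (x - y)) z - inner ℝ (‖x - y‖⁻¹ • (x - y))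
      ((2⁻¹ : ℝ) • (x + y)) = ‖x - y‖⁻¹ * (2⁻¹ * (‖y - z‖ ^ 2 - ‖x - z‖ ^ 2)) := fun z => by
    rw [← inner_sub_right, real_inner_smul_left]
    congr 1
    simp only [norm_sub_sq_real, inner_sub_left, inner_sub_right, inner_smul_right, inner_add_right,
      real_inner_self_eq_norm_sq, real_inner_comm x y]
    ring
  refine ⟨‖x - y‖⁻¹ • (x - y), inner ℝ (‖x - y‖⁻¹ • (x - y)) ((2⁻¹ : ℝ) • (x + y)), ?_, ?_, ?_, ?_⟩
  · rw [norm_smul, norm_inv, norm_norm, inv_mul_cancel₀ hn]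
  · rw [← sub_pos, key]
    have : ‖x - m‖ ^ 2 < ‖y - m‖ ^ 2 := by gcongr
    have := inv_pos.mpr hn'
    apply mul_pos this
    linarith
  · rw [← sub_pos, key]
    simp only [sub_self, norm_zero]
    rw [norm_sub_rev y x]
    have := inv_pos.mpr hn'
    have := pow_pos hn' 2
    apply mul_pos ‹_›
    linarith
  · rw [refl, key, smul_smul]
    simp only [sub_self, norm_zero]
    rw [norm_sub_rev y x]
    rw [show 2 * (‖x - y‖⁻¹ * (2⁻¹ * (‖x - y‖ ^ 2 - 0 ^ 2))) * ‖x - y‖⁻¹ = 1 by field_simp; ring]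
    simp

section Potential

variable {V F : Type*} [NormedAddCommGroup V] [NormedSpace ℝ V] [FiniteDimensional ℝ V]
  [MeasurableSpace V] [BorelSpace V] {μ : Measure V} [μ.IsAddHaarMeasure]
  [NormedAddCommGroup F] [InnerProductSpace ℝ F] [FiniteDimensional ℝ F]
  [MeasurableSpace F] [BorelSpace F] [Nontrivial F] (c : Coordinate V F) {f : V → ℝ}

theorem Coordinate.ae_ne (t : F) : ∀ᵐ x ∂μ, t ≠ c.proj x :=
  Coordinate.ae_proj_ne (ι := Unit) (F := fun _ => F) (c := fun _ => c) (i := ()) t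

/-- Logarithmic potentials of bounded densities are Hölder continuous. -/
theorem IsBump.exists_pot_holder (hf : IsBump f) :
    ∃ C, 0 ≤ C ∧ ∀ t t', |pot μ c f t - pot μ c f t'| ≤ C * √‖t - t'‖ := by
  obtain ⟨A, R, hA0, -, hA, hR⟩ := hf.exists_bound
  obtain ⟨C, hC0, hC⟩ := exists_integral_rpow_le μ c R (β := 1 / 2) (by norm_num) (by norm_num)
  refine ⟨A * (2 * (C + C)), by positivity, fun t t' => ?_⟩
  rw [pot, pot, ← integral_sub (hf.integrable_mul_log c t) (hf.integrable_mul_log c t')]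
  have h0 : ∀ x, x ∉ closedBall 0 R →
      f x * Real.log ‖t - c.proj x‖ - f x * Real.log ‖t' - c.proj x‖ = 0 := fun x hx => by
    simp [hR x hx]
  rw [← setIntegral_eq_integral_of_forall_compl_eq_zero h0]
  have hi := ((hC t).1.add (hC t').1).const_mul (A * (2 * √‖t - t'‖))
  rw [← Real.norm_eq_abs]
  refine (norm_integral_le_of_norm_le hi ?_).trans ?_
  · filter_upwards [ae_restrict_of_ae (c.ae_ne t), ae_restrict_of_ae (c.ae_ne t')] with x hx hx'
    have := abs_log_norm_sub_le (sub_ne_zero.mpr hx) (sub_ne_zero.mpr hx')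
    rw [sub_sub_sub_cancel_right] at this
    rw [← mul_sub, Real.norm_eq_abs, abs_mul, mul_assoc A]
    refine mul_le_mul (hA x) (this.trans_eq ?_) (abs_nonneg _) hA0
    simp only [Pi.add_apply]
    ring
  · rw [integral_const_mul]
    simp only [Pi.add_apply]
    rw [integral_add (hC t).1 (hC t').1]
    calc _ ≤ A * (2 * √‖t - t'‖) * (C + C) := by
          gcongr
          exacts [(hC t).2, (hC t').2]
      _ = _ := by ring

theorem IsBump.continuous_pot (hf : IsBump f) : Continuous (pot μ c f) := by
  obtain ⟨C, hC0, hC⟩ := hf.exists_pot_holder (μ := μ) c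
  rw [continuous_iff_continuousAt]
  intro t
  rw [ContinuousAt, tendsto_iff_norm_sub_tendsto_zero]
  refine squeeze_zero (fun _ => norm_nonneg _) (fun t' => hC t' t) ?_
  have : Continuous fun t' => C * √‖t' - t‖ := by fun_prop
  simpa using this.tendsto t

variable {c} in
-- Reflecting `t` amounts to reflecting the argument of the density. Averaging over `x` and `T x`
-- gives the factor `2⁻¹` and an integrand whose sign is known for polarized densities.
theorem pot_refl_sub_pot (hf : IsBump f) {e : F} (he : ‖e‖ = 1) (a : ℝ) (t : F) :
    let T := c.lift (refl e a)
    let J := fun x => (Real.log ‖t - refl e a (c.proj x)‖ - Real.log ‖t - c.proj x‖)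
      * (f x - f (T x))
    Integrable J μ ∧ pot μ c f (refl e a t) - pot μ c f t = 2⁻¹ * ∫ x, J x ∂μ := by
  intro T J
  have hTT : ∀ x, T (T x) = x := c.lift_lift (refl_refl he a)
  have hTm : MeasurePreserving T μ μ := c.measurePreserving_lift μ _ _ (refl_eq a) (refl_refl he a)
  have hTc : Continuous T := by
    have := continuous_refl (e := e) a
    unfold T Coordinate.lift
    fun_prop
  have hp : ∀ x, c.proj (T x) = refl e a (c.proj x) := c.proj_lift _
  have hfT := hf.comp hTc hTT
  have hfm := hf.meas
  have hfTm := hfT.meas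
  set L := fun x => Real.log ‖t - c.proj x‖
  have hLT : ∀ x, L (T x) = Real.log ‖t - refl e a (c.proj x)‖ := fun x => by simp only [L, hp]
  have hLm : Measurable L := by fun_prop
  have i1 : Integrable (fun x => f x * L x) μ := hf.integrable_mul_log c t
  have i2 : Integrable (fun x => f (T x) * L x) μ := hfT.integrable_mul_log c t
  have i3 : Integrable (fun x => f (T x) * L (T x)) μ := hTm.integrable_comp_of_integrable i1
  have i4 : Integrable (fun x => f x * L (T x)) μ := by
    have := hTm.integrable_comp_of_integrable i2
    simpa [Function.comp_def, hTT] using this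
  have hJ : J = fun x => (f x * L (T x) - f x * L x) - (f (T x) * L (T x) - f (T x) * L x) := by
    ext x
    simp only [J, hLT, L]
    ring
  have i5 : Integrable (fun x => f x * L (T x) - f x * L x) μ := i4.sub i1
  have i6 : Integrable (fun x => f (T x) * L (T x) - f (T x) * L x) μ := i3.sub i2
  refine ⟨hJ ▸ i5.sub i6, ?_⟩
  rw [hJ, integral_sub i5 i6, integral_sub i4 i1, integral_sub i3 i2,
    integral_comp_measurePreserving hTm (f := fun x => f x * L x) (hfm.mul hLm)]
  have e1 : ∫ x, f (T x) * L x ∂μ = ∫ x, f x * L (T x) ∂μ := by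
    rw [← integral_comp_measurePreserving hTm (f := fun x => f (T x) * L x) (hfTm.mul hLm)]
    simp [hTT]
  have e2 : pot μ c f (refl e a t) = ∫ x, f x * L (T x) ∂μ := by
    rw [pot]
    simp only [hLT, norm_refl_sub he]
  have e3 : pot μ c f t = ∫ x, f x * L x ∂μ := rfl
  rw [e1, e2, e3]
  ring

/-- A unit mass in a fixed ball is seen from far away at large distance, so the kernel exceeds `A`
on all of the mass. -/
theorem IsDensity.exists_le_pot (hf : IsDensity μ f) (A : ℝ) :
    ∃ M, ∀ t, M ≤ ‖t‖ → A ≤ pot μ c f t := by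
  obtain ⟨-, R, -, hR0, -, hR⟩ := hf.bump.exists_bound
  refine ⟨‖c.proj‖ * R + Real.exp A, fun t ht => ?_⟩
  calc A = ∫ x, f x * A ∂μ := by rw [integral_mul_const, hf.integral_eq_one, one_mul]
    _ ≤ pot μ c f t := by
      refine integral_mono (hf.bump.integrable.mul_const A) (hf.bump.integrable_mul_log c t)
        fun x => ?_
      by_cases hx : x ∈ closedBall (0 : V) R
      · refine mul_le_mul_of_nonneg_left ?_ (hf.nonneg x)
        have h1 : ‖c.proj x‖ ≤ ‖c.proj‖ * R :=
          (c.proj.le_opNorm x).trans (by gcongr; exact mem_closedBall_zero_iff.mp hx)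
        have h2 : Real.exp A ≤ ‖t - c.proj x‖ := by
          linarith [norm_sub_norm_le t (c.proj x)]
        simpa using Real.log_le_log (Real.exp_pos A) h2
      · simp [hR x hx]

/-- Centre of mass of the image of `f μ` under the projection. -/
noncomputable def center (μ : Measure V) (c : Coordinate V F) (f : V → ℝ) : F :=
  ∫ x, f x • c.proj x ∂μ

theorem inner_center (hf : IsBump f) (e : F) :
    inner ℝ e (center μ c f) = ∫ x, f x * inner ℝ e (c.proj x) ∂μ := by
  have hi : Integrable (fun x => f x • c.proj x) μ := by
    obtain ⟨C, R, -, -, hC, hR⟩ := hf.exists_bound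
    rw [← integrableOn_iff_integrable_of_support_subset (s := closedBall 0 R)]
    · exact (c.proj.continuous.continuousOn.integrableOn_compact
        (isCompact_closedBall _ _)).bdd_smul C hf.meas.aestronglyMeasurable (ae_of_all _ hC)
    · intro x hx
      by_contra h
      exact hx (by simp [hR x h])
  rw [center, ← integral_inner hi]
  simp [inner_smul_right]

end Potential

/-! ### Monotonicity of the potentials of a minimizer about the centre of mass. -/

section Setting

variable {V : Type*} [NormedAddCommGroup V] [NormedSpace ℝ V] [FiniteDimensional ℝ V]
  [MeasurableSpace V] [BorelSpace V] {μ : Measure V} [μ.IsAddHaarMeasure]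
  {ι : Type*} [Fintype ι] {F : ι → Type*} [∀ i, NormedAddCommGroup (F i)]
  [∀ i, InnerProductSpace ℝ (F i)]
  [∀ i, FiniteDimensional ℝ (F i)] [∀ i, MeasurableSpace (F i)] [∀ i, BorelSpace (F i)]
  [∀ i, Nontrivial (F i)]
  {c : ∀ i, Coordinate V (F i)} {d : ι → ℝ}

/-- Independent coordinates that determine a point, with positive weights. -/
structure IsCoordinateSystem (c : ∀ i, Coordinate V (F i)) (d : ι → ℝ) : Prop where
  orth : IsOrthogonal c
  inj : ∀ x, (∀ i, (c i).proj x = 0) → x = 0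
  pos : ∀ i, 0 < d i

variable {f : V → ℝ} (hf : IsMinimizer μ c d f) (hc : IsCoordinateSystem c d)
include hf hc

/-- The integral of the signed distance against `f - f ∘ T` is twice the signed distance of the
centre of mass from the mirror. If the centre lies on the positive side, this is positive and
excludes the reverse ordering. -/
theorem IsMinimizer.ae_refl (i : ι) {e : F i} (he : ‖e‖ = 1) {a : ℝ}
    (ha : a < inner ℝ e (center μ (c i) f)) :
    (∀ᵐ x ∂μ, 0 ≤ (inner ℝ e ((c i).proj x) - a) * (f x - f ((c i).lift (refl e a) x))) ∧
    0 < ∫ x, (inner ℝ e ((c i).proj x) - a) * (f x - f ((c i).lift (refl e a) x)) ∂μ := by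
  have hfb := hf.density.bump
  set T := (c i).lift (refl e a) with hT
  have hTT : ∀ x, T (T x) = x := (c i).lift_lift (refl_refl he a)
  have hTm : MeasurePreserving T μ μ := Coordinate.measurePreserving_refl he a
  have hTc : Continuous T := Coordinate.continuous_lift (continuous_refl a)
  have hfT := hfb.comp hTc hTT
  set u : V → ℝ := fun x => inner ℝ e ((c i).proj x) - a with hu
  have huc : Continuous u := by fun_prop
  have huT : ∀ x, u (T x) = - u x := fun x => by
    simp only [u, hT, (c i).proj_lift, inner_refl he]
  have h1 : ∫ x, f x * u x ∂μ = inner ℝ e (center μ (c i) f) - a := by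
    have : ∀ x, f x * u x = f x * inner ℝ e ((c i).proj x) - f x * a := fun x => by
      simp only [u]; ring
    simp_rw [this]
    rw [integral_sub (hfb.integrable_mul_continuous (by fun_prop)) (hfb.integrable.mul_const a),
      integral_mul_const, hf.density.integral_eq_one, inner_center (c i) hfb, one_mul]
  have h2 : ∫ x, f (T x) * u x ∂μ = - ∫ x, f x * u x ∂μ := by
    rw [← integral_comp_measurePreserving hTm (f := fun x => f x * u x)
      (hfb.meas.mul huc.measurable), ← integral_neg]
    simp [huT]
  have h3 : ∫ x, u x * (f x - f (T x)) ∂μ = 2 * (inner ℝ e (center μ (c i) f) - a) := by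
    have : ∀ x, u x * (f x - f (T x)) = f x * u x - f (T x) * u x := fun x => by ring
    simp_rw [this]
    rw [integral_sub (hfb.integrable_mul_continuous huc) (hfT.integrable_mul_continuous huc), h2,
      h1]
    ring
  have hpos : 0 < ∫ x, u x * (f x - f (T x)) ∂μ := by linarith
  refine ⟨?_, hpos⟩
  refine (hf.ae_nonneg_or_ae_nonpos hc.orth hc.pos he a).resolve_right fun h => ?_
  exact absurd (integral_nonpos_of_ae h) (not_le.mpr hpos)

theorem IsMinimizer.ae_log_refl_nonneg (i : ι) {e : F i} (he : ‖e‖ = 1) {a : ℝ}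
    (ha : a < inner ℝ e (center μ (c i) f)) {t : F i} (ht : a < inner ℝ e t) :
    ∀ᵐ x ∂μ, 0 ≤ (Real.log ‖t - refl e a ((c i).proj x)‖ - Real.log ‖t - (c i).proj x‖)
      * (f x - f ((c i).lift (refl e a) x)) := by
  filter_upwards [(hf.ae_refl hc i he ha).1, Coordinate.ae_inner_ne (μ := μ) (c := c) he a,
    Coordinate.ae_proj_ne (μ := μ) (c := c) t,
    Coordinate.ae_proj_ne (μ := μ) (c := c) (refl e a t)] with x h1 h2 h3 h4
  have h5 := mul_log_refl_pos he a (sub_pos.mpr ht).ne' h2 h3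
    fun h => h4 (by rw [h, refl_refl he])
  rw [mul_assoc, mul_pos_iff_of_pos_left (sub_pos.mpr ht)] at h5
  by_contra! hcon
  have h6 := mul_neg_of_pos_of_neg (pow_pos (abs_pos.mpr h2) 2) hcon
  rw [sq_abs] at h6
  have h7 := mul_nonneg h5.le h1
  nlinarith

/-- The integrand for the potential difference is nonnegative. If its integral were zero, `f - f ∘
T` would vanish almost everywhere, against the strict positivity in `IsMinimizer.ae_refl`. -/
theorem IsMinimizer.pot_lt_pot_refl (i : ι) {e : F i} (he : ‖e‖ = 1) {a : ℝ}
    (ha : a < inner ℝ e (center μ (c i) f)) {t : F i} (ht : a < inner ℝ e t) :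
    pot μ (c i) f t < pot μ (c i) f (refl e a t) := by
  obtain ⟨hJi, hJ⟩ := pot_refl_sub_pot (μ := μ) (c := c i) hf.density.bump he a t
  have hnn := hf.ae_log_refl_nonneg hc i he ha ht
  have h0 := integral_nonneg_of_ae hnn
  rcases h0.eq_or_lt with h | h
  · exfalso
    have hz := (integral_eq_zero_iff_of_nonneg_ae hnn hJi).mp h.symm
    refine (hf.ae_refl hc i he ha).2.ne' (integral_eq_zero_of_ae ?_)
    filter_upwards [hz, Coordinate.ae_inner_ne (μ := μ) (c := c) he a,
      Coordinate.ae_proj_ne (μ := μ) (c := c) t,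
      Coordinate.ae_proj_ne (μ := μ) (c := c) (refl e a t)] with x h1 h2 h3 h4
    have h5 := mul_log_refl_pos he a (sub_pos.mpr ht).ne' h2 h3
      fun h => h4 (by rw [h, refl_refl he])
    simp only [Pi.zero_apply, mul_eq_zero] at h1 ⊢
    refine h1.imp_left fun h => ?_
    rw [h, mul_zero] at h5
    exact absurd h5 (lt_irrefl _)
  · linarith

/-- The potential in each coordinate is strictly increasing in the distance from the centre. -/
theorem IsMinimizer.pot_lt (i : ι) {x y : F i}
    (h : ‖x - center μ (c i) f‖ < ‖y - center μ (c i) f‖) :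
    pot μ (c i) f x < pot μ (c i) f y := by
  obtain ⟨e, a, he, hm, hx, rfl⟩ := exists_refl_eq h
  exact hf.pot_lt_pot_refl hc i he hm hx

/-- Points at equal distance are reached by pushing `y` slightly outwards and using continuity. In
particular the potential is radial about the centre. -/
theorem IsMinimizer.pot_le (i : ι) {x y : F i}
    (h : ‖x - center μ (c i) f‖ ≤ ‖y - center μ (c i) f‖) :
    pot μ (c i) f x ≤ pot μ (c i) f y := by
  set m := center μ (c i) f
  rcases eq_or_ne y m with rfl | hy
  · have : x = m := by simpa [sub_eq_zero] using h
    rw [this]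
  have hpos : 0 < ‖y - m‖ := norm_pos_iff.mpr (sub_ne_zero.mpr hy)
  have hcont : Continuous fun r : ℝ => pot μ (c i) f (m + (1 + r) • (y - m)) :=
    (hf.density.bump.continuous_pot (c i)).comp (by fun_prop)
  have hlim := (hcont.tendsto 0).mono_left (nhdsWithin_le_nhds (s := Ioi 0))
  simp only [add_zero, one_smul, add_sub_cancel] at hlim
  refine ge_of_tendsto hlim ?_
  filter_upwards [self_mem_nhdsWithin] with r hr
  refine (hf.pot_lt hc i (h.trans_lt ?_)).le
  rw [add_sub_cancel_left, norm_smul, Real.norm_of_nonneg (by linarith [mem_Ioi.mp hr])]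
  nlinarith [mem_Ioi.mp hr]

theorem IsMinimizer.pot_lt_iff (i : ι) {x y : F i} : pot μ (c i) f x < pot μ (c i) f y ↔
    ‖x - center μ (c i) f‖ < ‖y - center μ (c i) f‖ :=
  ⟨fun h => not_le.mp fun h' => h.not_ge (hf.pot_le hc i h'), hf.pot_lt hc i⟩

end Setting
-- A minimizer is the indicator of a sublevel set of its total potential.
theorem setOf_lt_subset_setOf_le {X : Type*} (h : X → ℝ) (s : ℝ) :
    {x | h x < s} ⊆ {x | h x ≤ s} :=
  fun x (hx : h x < s) => hx.le

section Setting

variable {V : Type*} [NormedAddCommGroup V] [NormedSpace ℝ V] [FiniteDimensional ℝ V]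
  [MeasurableSpace V] [BorelSpace V] {μ : Measure V} [μ.IsAddHaarMeasure]
  {ι : Type*} [Fintype ι] {F : ι → Type*} [∀ i, NormedAddCommGroup (F i)]
  [∀ i, InnerProductSpace ℝ (F i)]
  [∀ i, FiniteDimensional ℝ (F i)] [∀ i, MeasurableSpace (F i)] [∀ i, BorelSpace (F i)]
  [∀ i, Nontrivial (F i)]
  {c : ∀ i, Coordinate V (F i)} {d : ι → ℝ}

variable (μ c d) in
/-- The potential of `f μ` for the weighted sum of the logarithmic kernels. -/
noncomputable def totalPot (f : V → ℝ) (x : V) : ℝ := ∑ i, d i * pot μ (c i) f ((c i).proj x)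

variable (μ c) in
/-- The point all of whose coordinates are centres of mass. -/
noncomputable def centerPoint (f : V → ℝ) : V := ∑ i, (c i).sec (center μ (c i) f)

variable {f : V → ℝ}

theorem IsOrthogonal.proj_sum_sec (hc : IsOrthogonal c) (z : ∀ i, F i) (j : ι) :
    (c j).proj (∑ i, (c i).sec (z i)) = z j := by
  rw [map_sum, Finset.sum_eq_single j, (c j).proj_sec]
  · exact fun i _ hij => hc i j hij.symm _
  · exact fun h => absurd (Finset.mem_univ j) h

theorem IsCoordinateSystem.sum_sec_proj (hc : IsCoordinateSystem c d) (x : V) :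
    ∑ i, (c i).sec ((c i).proj x) = x := by
  rw [← sub_eq_zero]
  refine hc.inj _ fun j => ?_
  rw [map_sub, hc.orth.proj_sum_sec (fun i => (c i).proj x), sub_self]

theorem proj_centerPoint (hc : IsCoordinateSystem c d) (i : ι) :
    (c i).proj (centerPoint μ c f) = center μ (c i) f :=
  hc.orth.proj_sum_sec (fun i => center μ (c i) f) i

theorem IsBump.continuous_totalPot (hf : IsBump f) : Continuous (totalPot μ c d f) := by
  unfold totalPot
  refine continuous_finsetSum _ fun i _ => continuous_const.mul ?_
  exact (hf.continuous_pot (c i)).comp (c i).proj.continuous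

theorem sum_form_eq_integral {g : V → ℝ} (hf : IsBump f) (hg : IsBump g) :
    ∑ i, d i * form μ (c i) f g = ∫ x, g x * totalPot μ c d f x ∂μ := by
  simp only [totalPot, Finset.mul_sum]
  rw [integral_finsetSum]
  · refine Finset.sum_congr rfl fun i _ => ?_
    rw [form_eq_integral_pot μ (c i) hf hg, ← integral_const_mul]
    congr with x
    ring
  · intro i _
    have : Continuous fun x => d i * pot μ (c i) f ((c i).proj x) :=
      continuous_const.mul ((hf.continuous_pot (c i)).comp (c i).proj.continuous)
    exact hg.integrable_mul_continuous this

theorem IsDensity.convex {g : V → ℝ} (hf : IsDensity μ f) (hg : IsDensity μ g) {t : ℝ}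
    (h0 : 0 ≤ t) (h1 : t ≤ 1) : IsDensity μ (fun x => (1 - t) * f x + t * g x) := by
  refine ⟨(hf.bump.const_mul _).add (hg.bump.const_mul _), fun x => ?_, fun x => ?_, ?_⟩
  · have := hf.nonneg x
    have := hg.nonneg x
    have : 0 ≤ 1 - t := by linarith
    positivity
  · nlinarith [hf.le_one x, hg.le_one x]
  · rw [integral_add (hf.bump.const_mul _).integrable (hg.bump.const_mul _).integrable,
      integral_const_mul, integral_const_mul, hf.integral_eq_one, hg.integral_eq_one]
    ring

/-- First variation of the energy at a minimizer. -/
theorem IsMinimizer.integral_totalPot_le (hf : IsMinimizer μ c d f) {g : V → ℝ}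
    (hg : IsDensity μ g) :
    ∫ x, f x * totalPot μ c d f x ∂μ ≤ ∫ x, g x * totalPot μ c d f x ∂μ := by
  have hfb := hf.density.bump
  have hgb := hg.bump
  rw [← sum_form_eq_integral hfb hfb, ← sum_form_eq_integral hfb hgb]
  set A := ∑ i, d i * form μ (c i) f f
  set B := ∑ i, d i * form μ (c i) f g
  set C := ∑ i, d i * form μ (c i) g g
  -- On the segment from `f` to `g` the energy is a quadratic polynomial in `t`; its increment is
  -- divided by `t` before letting `t` tend to zero.
  have key : ∀ t : ℝ, 0 < t → t ≤ 1 → 0 ≤ 2 * (B - A) + t * (A - 2 * B + C) := fun t h0 h1 => by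
    have h := hf.le _ (hf.density.convex hg h0.le h1)
    have hexp : ∑ i, d i * form μ (c i) (fun x => (1 - t) * f x + t * g x)
        (fun x => (1 - t) * f x + t * g x)
        = (1 - t) ^ 2 * A + 2 * ((1 - t) * t) * B + t ^ 2 * C := by
      simp only [A, B, C, Finset.mul_sum, ← Finset.sum_add_distrib]
      refine Finset.sum_congr rfl fun i _ => ?_
      rw [form_add_add (hfb.const_mul _) (hgb.const_mul _)]
      simp only [form_const_mul_left, form_const_mul_right]
      ring
    rw [hexp] at h
    have h2 : 0 ≤ t * (2 * (B - A) + t * (A - 2 * B + C)) := by linarith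
    exact nonneg_of_mul_nonneg_right h2 h0
  have hlim : Tendsto (fun t : ℝ => 2 * (B - A) + t * (A - 2 * B + C)) (𝓝[>] 0)
      (𝓝 (2 * (B - A))) := by
    have : Continuous fun t : ℝ => 2 * (B - A) + t * (A - 2 * B + C) := by fun_prop
    simpa using (this.tendsto 0).mono_left nhdsWithin_le_nhds
  have h := ge_of_tendsto hlim (by
    filter_upwards [Ioc_mem_nhdsGT one_pos] with t ht using key t ht.1 ht.2)
  linarith

variable (hf : IsMinimizer μ c d f) (hc : IsCoordinateSystem c d)
include hf hc

/-- Contraction towards the centre point shrinks the distance to the centre in every coordinate,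
strictly in at least one. This is the source of starlikeness. -/
theorem IsMinimizer.totalPot_smul_lt {x : V} (hx : x ≠ centerPoint μ c f) {r : ℝ} (hr0 : 0 ≤ r)
    (hr1 : r < 1) : totalPot μ c d f (centerPoint μ c f + r • (x - centerPoint μ c f))
      < totalPot μ c d f x := by
  set v := centerPoint μ c f
  have hn : ∀ i, ‖(c i).proj (v + r • (x - v)) - center μ (c i) f‖
      = r * ‖(c i).proj x - center μ (c i) f‖ := fun i => by
    rw [← proj_centerPoint hc, ← map_sub, add_sub_cancel_left, map_smul, norm_smul, map_sub,
      Real.norm_of_nonneg hr0]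
  obtain ⟨i, hi⟩ : ∃ i, (c i).proj (x - v) ≠ 0 := by
    by_contra! h
    exact hx (sub_eq_zero.mp (hc.inj _ h))
  refine Finset.sum_lt_sum (fun j _ => ?_) ⟨i, Finset.mem_univ i, ?_⟩
  · refine mul_le_mul_of_nonneg_left (hf.pot_le hc j ?_) (hc.pos j).le
    rw [hn]
    exact mul_le_of_le_one_left (norm_nonneg _) hr1.le
  · refine mul_lt_mul_of_pos_left (hf.pot_lt hc i ?_) (hc.pos i)
    rw [hn]
    refine mul_lt_of_lt_one_left ?_ hr1
    rwa [norm_pos_iff, ← proj_centerPoint hc, ← map_sub]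

theorem IsMinimizer.totalPot_center_le (x : V) :
    totalPot μ c d f (centerPoint μ c f) ≤ totalPot μ c d f x := by
  rcases eq_or_ne x (centerPoint μ c f) with rfl | hx
  · rfl
  · simpa using (hf.totalPot_smul_lt hc hx le_rfl one_pos).le

/-- Each summand of the total potential is at least its value at the centre and tends to infinity,
so a bound on the sum bounds every coordinate. -/
theorem IsMinimizer.isBounded_sublevel (s : ℝ) :
    Bornology.IsBounded {x | totalPot μ c d f x ≤ s} := by
  set b : ι → ℝ := fun i => d i * pot μ (c i) f (center μ (c i) f)
  have hb : ∀ i t, b i ≤ d i * pot μ (c i) f t := fun i t =>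
    mul_le_mul_of_nonneg_left (hf.pot_le hc i (by simp)) (hc.pos i).le
  -- The level is what remains of `s` for coordinate `i` when all others take their minimal values;
  -- the extra `1` makes the final contradiction strict.
  choose M hM using fun i => hf.density.exists_le_pot (c i) ((s + 1 - (∑ j, b j - b i)) / d i)
  refine isBounded_iff_forall_norm_le.mpr ⟨∑ i, ‖(c i).sec‖ * M i, fun x hx => ?_⟩
  have hlt : ∀ i, ‖(c i).proj x‖ ≤ M i := fun i => by
    by_contra! hcon
    have h1 := hM i _ hcon.le
    rw [div_le_iff₀' (hc.pos i)] at h1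
    have h2 : ∑ j, b j - b i ≤ totalPot μ c d f x - d i * pot μ (c i) f ((c i).proj x) := by
      rw [totalPot, ← Finset.add_sum_erase _ b (Finset.mem_univ i),
        ← Finset.add_sum_erase _ (fun i => d i * pot μ (c i) f ((c i).proj x)) (Finset.mem_univ i)]
      simp only [add_sub_cancel_left]
      exact Finset.sum_le_sum fun j _ => hb j _
    have h3 : totalPot μ c d f x ≤ s := hx
    linarith
  rw [← hc.sum_sec_proj x]
  refine norm_sum_le_of_le _ fun i _ => ((c i).sec.le_opNorm _).trans ?_
  gcongr
  exact hlt i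

theorem IsMinimizer.measure_sublevel_lt_top (s : ℝ) : μ {x | totalPot μ c d f x ≤ s} < ∞ :=
  (hf.isBounded_sublevel hc s).measure_lt_top

/-- The level sets of the potential are null sets. -/
theorem IsMinimizer.measure_level [Nontrivial V] (s : ℝ) : μ {x | totalPot μ c d f x = s} = 0 := by
  set h := totalPot μ c d f
  set v := centerPoint μ c f
  have hcont : Continuous h := hf.density.bump.continuous_totalPot
  have hfin : μ {x | h x < s} ≠ ∞ :=
    ((measure_mono (setOf_lt_subset_setOf_le h _)).trans_lt (hf.measure_sublevel_lt_top hc s)).ne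
  -- Contraction by `r⁻¹` about `v` sends the closed sublevel set, apart from `v`, into the open
  -- one. So their measures differ at most by a factor `r ^ dim V`, and `r` may tend to one.
  have hsub : ∀ r : ℝ, 1 < r →
      {x | h x ≤ s} ⊆ {v} ∪ AffineMap.homothety v r '' {x | h x < s} := fun r hr x hx => by
    rcases eq_or_ne x v with rfl | hxv
    · exact .inl rfl
    have h1 := hf.totalPot_smul_lt hc hxv (inv_nonneg.mpr (by linarith)) (inv_lt_one_of_one_lt₀ hr)
    refine .inr ⟨v + r⁻¹ • (x - v), lt_of_lt_of_le h1 hx, ?_⟩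
    have : r ≠ 0 := by linarith
    simp [AffineMap.homothety_apply, smul_smul, this]
  have hle : ∀ r : ℝ, 1 < r → μ {x | h x ≤ s}
      ≤ ENNReal.ofReal |r ^ Module.finrank ℝ V| * μ {x | h x < s} := fun r hr => by
    refine (measure_mono (hsub r hr)).trans ((measure_union_le _ _).trans ?_)
    rw [measure_singleton, zero_add, Measure.addHaar_image_homothety]
  have hlim : Tendsto (fun r : ℝ => ENNReal.ofReal |r ^ Module.finrank ℝ V| * μ {x | h x < s})
      (𝓝[>] 1) (𝓝 (μ {x | h x < s})) := by
    have h1 : Tendsto (fun r : ℝ => ENNReal.ofReal |r ^ Module.finrank ℝ V|) (𝓝[>] 1) (𝓝 1) := by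
      have : Continuous fun r : ℝ => ENNReal.ofReal |r ^ Module.finrank ℝ V| :=
        ENNReal.continuous_ofReal.comp (by fun_prop)
      simpa using (this.tendsto 1).mono_left nhdsWithin_le_nhds
    simpa using ENNReal.Tendsto.mul_const h1 (.inr hfin)
  have hle' : μ {x | h x ≤ s} ≤ μ {x | h x < s} :=
    ge_of_tendsto hlim (by filter_upwards [self_mem_nhdsWithin] with r hr using hle r hr)
  have heq : {x | h x = s} = {x | h x ≤ s} \ {x | h x < s} := by
    ext x
    simp [le_antisymm_iff]
  rw [heq, measure_sdiff (setOf_lt_subset_setOf_le h _)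
    (measurableSet_lt hcont.measurable measurable_const).nullMeasurableSet hfin,
    tsub_eq_zero_of_le hle']

/-- The level is the supremum of those whose open sublevel set has measure at most one. Continuity
from below gives one inequality; continuity from above gives the other for the closed sublevel set,
and the level set itself is null. -/
theorem IsMinimizer.exists_measure_sublevel_eq_one [Nontrivial V] :
    ∃ s, μ {x | totalPot μ c d f x < s} = 1 := by
  set h := totalPot μ c d f
  set v := centerPoint μ c f
  have hcont : Continuous h := hf.density.bump.continuous_totalPot
  have hmono : ∀ s t, s ≤ t → {x | h x < s} ⊆ {x | h x < t} := fun s t hst x hx =>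
    lt_of_lt_of_le hx hst
  set S := {s : ℝ | μ {x | h x < s} ≤ 1}
  have hne : S.Nonempty := by
    refine ⟨h v, ?_⟩
    have : {x | h x < h v} = ∅ := by
      ext x
      simpa using hf.totalPot_center_le hc x
    simp [S, this]
  have hbdd : BddAbove S := by
    have hlim := tendsto_measure_iUnion_atTop (μ := μ) (s := fun n : ℕ => {x | h x < n})
      fun m n hmn => hmono _ _ (by exact_mod_cast hmn)
    have huniv : ⋃ n : ℕ, {x | h x < n} = univ := by
      ext x
      simpa using exists_nat_gt (h x)
    have : NoncompactSpace V := NormedSpace.noncompactSpace ℝ V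
    rw [huniv, measure_univ_of_isAddLeftInvariant] at hlim
    obtain ⟨n, hn⟩ := (hlim.eventually_const_lt ENNReal.one_lt_top).exists
    refine ⟨n, fun s hs => ?_⟩
    by_contra! hcon
    exact (hn.trans_le ((measure_mono (hmono _ _ hcon.le)).trans hs)).false
  have hε : ∀ n : ℕ, (0 : ℝ) < 1 / (n + 1) := fun n => Nat.one_div_pos_of_nat
  have hε0 : Tendsto (fun n : ℕ => (1 : ℝ) / (n + 1)) atTop (𝓝 0) :=
    tendsto_one_div_add_atTop_nhds_zero_nat
  refine ⟨sSup S, le_antisymm ?_ ?_⟩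
  · have hU : {x | h x < sSup S} = ⋃ n : ℕ, {x | h x < sSup S - 1 / (n + 1)} := by
      ext x
      simp only [mem_ofPred_eq, mem_iUnion]
      constructor
      · intro hx
        obtain ⟨n, hn⟩ := (hε0.eventually_lt_const (sub_pos.mpr hx)).exists
        exact ⟨n, by linarith⟩
      · rintro ⟨n, hn⟩
        linarith [hε n]
    rw [hU]
    have hlim := tendsto_measure_iUnion_atTop (μ := μ)
      (s := fun n : ℕ => {x | h x < sSup S - 1 / (n + 1)})
      fun m n hmn => hmono _ _ (sub_le_sub_left (Nat.one_div_le_one_div hmn) _)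
    refine le_of_tendsto' hlim fun n => ?_
    obtain ⟨s, hs, hs'⟩ := exists_lt_of_lt_csSup hne (sub_lt_self (sSup S) (hε n))
    exact (measure_mono (hmono _ _ hs'.le)).trans hs
  · have hI : {x | h x ≤ sSup S} = ⋂ n : ℕ, {x | h x < sSup S + 1 / (n + 1)} := by
      ext x
      simp only [mem_ofPred_eq, mem_iInter]
      constructor
      · intro hx n
        linarith [hε n]
      · intro hx
        by_contra! hcon
        obtain ⟨n, hn⟩ := (hε0.eventually_lt_const (sub_pos.mpr hcon)).exists
        linarith [hx n]
    have hlim := tendsto_measure_iInter_atTop (μ := μ)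
      (s := fun n : ℕ => {x | h x < sSup S + 1 / (n + 1)})
      (fun n => (measurableSet_lt hcont.measurable measurable_const).nullMeasurableSet)
      (fun m n hmn => hmono _ _ (add_le_add_right (Nat.one_div_le_one_div hmn) _))
      ⟨0, ((measure_mono (setOf_lt_subset_setOf_le h _)).trans_lt
        (hf.measure_sublevel_lt_top hc _)).ne⟩
    rw [← hI] at hlim
    have h1 : 1 ≤ μ {x | h x ≤ sSup S} := by
      refine ge_of_tendsto' hlim fun n => ?_
      by_contra! hcon
      linarith [le_csSup hbdd (show sSup S + 1 / (n + 1) ∈ S from hcon.le), hε n]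
    refine h1.trans ?_
    have : {x | h x ≤ sSup S} = {x | h x < sSup S} ∪ {x | h x = sSup S} := by
      ext x
      simp [le_iff_lt_or_eq]
    rw [this]
    refine (measure_union_le _ _).trans ?_
    rw [hf.measure_level hc, add_zero]

/-- A minimizer is the indicator function of a sublevel set of its potential. -/
theorem IsMinimizer.exists_ae_eq_indicator [Nontrivial V] :
    ∃ s, μ {x | totalPot μ c d f x < s} = 1 ∧
      f =ᵐ[μ] {x | totalPot μ c d f x < s}.indicator fun _ => 1 := by
  obtain ⟨s, hs⟩ := hf.exists_measure_sublevel_eq_one hc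
  refine ⟨s, hs, ?_⟩
  set h := totalPot μ c d f
  have hcont : Continuous h := hf.density.bump.continuous_totalPot
  have hm : MeasurableSet {x | h x < s} := measurableSet_lt hcont.measurable measurable_const
  set g : V → ℝ := {x | h x < s}.indicator fun _ => 1 with hg
  have hgd : IsDensity μ g := by
    refine ⟨isBump_indicator_one hm
      ((hf.isBounded_sublevel hc s).subset (setOf_lt_subset_setOf_le h s)), fun x => ?_, fun x => ?_, ?_⟩
    · exact indicator_nonneg (fun _ _ => zero_le_one) x
    · exact indicator_le_self' (fun _ _ => zero_le_one) x
    · rw [hg, integral_indicator hm]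
      simp [Measure.real, hs]
  have hle := hf.integral_totalPot_le hgd
  have i1 := hf.density.bump.integrable_mul_continuous (μ := μ) hcont
  have i2 := hgd.bump.integrable_mul_continuous (μ := μ) hcont
  have i3 : Integrable (fun x => (f x - g x) * (h x - s)) μ :=
    (hf.density.bump.sub hgd.bump).integrable_mul_continuous (by fun_prop)
  -- Bathtub principle: the constraint `0 ≤ f ≤ 1` makes this product nonnegative. Its integral is
  -- at most zero by the first variation, `s` dropping out because both densities have mass one.
  have hnn : ∀ x, 0 ≤ (f x - g x) * (h x - s) := fun x => by
    by_cases hx : h x < s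
    · have : g x = 1 := indicator_of_mem (show x ∈ {x | h x < s} from hx) _
      rw [this]
      exact mul_nonneg_of_nonpos_of_nonpos (sub_nonpos.mpr (hf.density.le_one x))
        (by linarith)
    · have : g x = 0 := indicator_of_notMem (show x ∉ {x | h x < s} from hx) _
      rw [this, sub_zero]
      exact mul_nonneg (hf.density.nonneg x) (by linarith [not_lt.mp hx])
  have hz : ∫ x, (f x - g x) * (h x - s) ∂μ = 0 := by
    refine le_antisymm ?_ (integral_nonneg hnn)
    have : ∀ x, (f x - g x) * (h x - s) = (f x * h x - g x * h x) - (f x * s - g x * s) :=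
      fun x => by ring
    simp_rw [this]
    have i4 := hf.density.bump.integrable (μ := μ) |>.mul_const s
    have i5 := hgd.bump.integrable (μ := μ) |>.mul_const s
    have i6 : Integrable (fun x => f x * h x - g x * h x) μ := i1.sub i2
    have i7 : Integrable (fun x => f x * s - g x * s) μ := i4.sub i5
    rw [integral_sub i6 i7, integral_sub i1 i2, integral_sub i4 i5,
      integral_mul_const, integral_mul_const, hf.density.integral_eq_one, hgd.integral_eq_one]
    linarith
  have hae := (integral_eq_zero_iff_of_nonneg hnn i3).mp hz
  filter_upwards [hae, measure_eq_zero_iff_ae_notMem.mp (hf.measure_level hc s)] with x h1 h2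
  simp only [Pi.zero_apply, mul_eq_zero] at h1
  rcases h1 with h1 | h1
  · linarith
  · exact absurd (sub_eq_zero.mp h1) h2

end Setting
-- Sharp minimizers and quantitative monotonicity of their potentials.
theorem log_sub_log_ge {a b N : ℝ} (hb : 0 < b) (hab : b ≤ a) (haN : a ≤ N) :
    (a ^ 2 - b ^ 2) / (2 * N ^ 2) ≤ Real.log a - Real.log b := by
  have ha := hb.trans_le hab
  have hN := ha.trans_le haN
  have h1 := Real.one_sub_inv_le_log_of_pos (div_pos ha hb)
  rw [Real.log_div ha.ne' hb.ne', inv_div] at h1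
  refine le_trans ?_ h1
  rw [div_le_iff₀ (by positivity), one_sub_div ha.ne', div_mul_eq_mul_div, le_div_iff₀ ha]
  have h2 : a * (a + b) ≤ 2 * N ^ 2 := by nlinarith
  nlinarith [mul_le_mul_of_nonneg_left h2 (sub_nonneg.mpr hab)]

section Setting

variable {V : Type*} [NormedAddCommGroup V] [NormedSpace ℝ V] [FiniteDimensional ℝ V]
  [MeasurableSpace V] [BorelSpace V] {μ : Measure V} [μ.IsAddHaarMeasure]
  {ι : Type*} [Fintype ι] {F : ι → Type*} [∀ i, NormedAddCommGroup (F i)]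
  [∀ i, InnerProductSpace ℝ (F i)]
  [∀ i, FiniteDimensional ℝ (F i)] [∀ i, MeasurableSpace (F i)] [∀ i, BorelSpace (F i)]
  [∀ i, Nontrivial (F i)]
  {c : ∀ i, Coordinate V (F i)} {d : ι → ℝ} {f g : V → ℝ}

theorem pot_congr_ae (h : f =ᵐ[μ] g) (i : ι) : pot μ (c i) f = pot μ (c i) g := by
  ext t
  refine integral_congr_ae ?_
  filter_upwards [h] with x hx
  rw [hx]

theorem totalPot_congr_ae (h : f =ᵐ[μ] g) : totalPot μ c d f = totalPot μ c d g := by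
  ext x
  simp only [totalPot, pot_congr_ae h]

theorem IsMinimizer.congr_ae (hf : IsMinimizer μ c d f) (h : f =ᵐ[μ] g) (hg : IsDensity μ g) :
    IsMinimizer μ c d g := by
  refine ⟨hg, fun k hk => ?_⟩
  have : ∑ i, d i * form μ (c i) g g = ∑ i, d i * form μ (c i) f f := by
    rw [sum_form_eq_integral hg.bump hg.bump,
      sum_form_eq_integral hf.density.bump hf.density.bump, totalPot_congr_ae h]
    refine integral_congr_ae ?_
    filter_upwards [h] with x hx
    rw [hx]
  rw [this]
  exact hf.le k hk

/-- `f` is a minimizer and equals the indicator function of `{totalPot f < s}` everywhere. -/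
structure IsSharpMinimizer (μ : Measure V) (c : ∀ i, Coordinate V (F i)) (d : ι → ℝ) (f : V → ℝ)
    (s : ℝ) : Prop where
  isMinimizer : IsMinimizer μ c d f
  eq_indicator : f = {x | totalPot μ c d f x < s}.indicator fun _ => 1

/-- Potentials do not see null sets, so the indicator function has the same potential as `f` and is
the indicator of a sublevel set of its own potential. -/
theorem IsMinimizer.exists_isSharpMinimizer [Nontrivial V] (hf : IsMinimizer μ c d f)
    (hc : IsCoordinateSystem c d) : ∃ g s, IsSharpMinimizer μ c d g s ∧ f =ᵐ[μ] g := by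
  obtain ⟨s, hs, hfs⟩ := hf.exists_ae_eq_indicator hc
  have hm : MeasurableSet {x | totalPot μ c d f x < s} :=
    measurableSet_lt hf.density.bump.continuous_totalPot.measurable measurable_const
  refine ⟨_, s, ⟨hf.congr_ae hfs ⟨isBump_indicator_one hm
    ((hf.isBounded_sublevel hc s).subset (setOf_lt_subset_setOf_le _ s)), fun x => ?_,
      fun x => ?_, ?_⟩, ?_⟩, hfs⟩
  · exact indicator_nonneg (fun _ _ => zero_le_one) x
  · exact indicator_le_self' (fun _ _ => zero_le_one) x
  · rw [integral_indicator hm]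
    simp [Measure.real, hs]
  · conv_lhs => rw [totalPot_congr_ae hfs]

variable {s : ℝ} (hf : IsSharpMinimizer μ c d f s) (hc : IsCoordinateSystem c d)
include hf

theorem IsSharpMinimizer.eq_one {x : V} (hx : totalPot μ c d f x < s) : f x = 1 := by
  rw [hf.eq_indicator]
  exact indicator_of_mem (show x ∈ {x | totalPot μ c d f x < s} from hx) _

theorem IsSharpMinimizer.eq_zero {x : V} (hx : s ≤ totalPot μ c d f x) : f x = 0 := by
  rw [hf.eq_indicator]
  exact indicator_of_notMem (show x ∉ {x | totalPot μ c d f x < s} from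
    fun h : totalPot μ c d f x < s => h.not_ge hx) _

theorem IsSharpMinimizer.congr {x y : V} (h : totalPot μ c d f x = totalPot μ c d f y) :
    f x = f y := by
  rcases lt_or_ge (totalPot μ c d f x) s with hx | hx
  · rw [hf.eq_one hx, hf.eq_one (h ▸ hx)]
  · rw [hf.eq_zero hx, hf.eq_zero (h ▸ hx)]

include hc

theorem IsSharpMinimizer.totalPot_centerPoint_lt : totalPot μ c d f (centerPoint μ c f) < s := by
  by_contra! h
  have : ∀ x, f x = 0 := fun x => hf.eq_zero (h.trans (hf.isMinimizer.totalPot_center_le hc x))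
  have h1 := hf.isMinimizer.density.integral_eq_one
  simp [this] at h1

/-- A lower bound for the mass of a minimizer in a thin slab at the centre. -/
theorem IsSharpMinimizer.exists_le_integral_slab (i : ι) (M : ℝ) :
    ∃ κ, 0 < κ ∧ ∀ e : F i, ‖e‖ = 1 → ∀ r, 0 < r → r ≤ M →
      κ * r ^ Module.finrank ℝ V ≤ ∫ x, f x * ({x | 0 < inner ℝ e ((c i).proj x - center μ (c i) f) ∧
        inner ℝ e ((c i).proj x - center μ (c i) f) ≤ r}.indicator (fun _ => 1) x) ∂μ := by
  set v := centerPoint μ c f with hv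
  have hcont := hf.isMinimizer.density.bump.continuous_totalPot (μ := μ) (c := c) (d := d)
  obtain ⟨δ, hδ, hball⟩ := Metric.isOpen_iff.mp
    (isOpen_lt hcont continuous_const (g := fun _ => s)) v (hf.totalPot_centerPoint_lt hc)
  set P := ‖(c i).proj‖
  set S := ‖(c i).sec‖
  have hP : 0 ≤ P := norm_nonneg _
  have hS : 0 ≤ S := norm_nonneg _
  -- Chosen so that the projection of a ball of radius `η * p` has radius less than `η`: around a
  -- point at height `η` it then stays between heights `0` and `2 * η`.
  set p := (2 * (P + 1))⁻¹ with hp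
  have hp0 : 0 < p := by positivity
  have hp1 : p ≤ 1 := inv_le_one_of_one_le₀ (by linarith)
  have hPp : P * p < 1 := by
    rw [hp, ← div_eq_mul_inv, div_lt_one (by positivity)]
    linarith
  -- With `η = q * r`, the first bound gives `2 * η ≤ r`, so the ball lies in the slab; the second
  -- keeps it inside the ball about `v` on which `f = 1`.
  set q := min (1 / 2) (δ / ((|M| + 1) * (S + 1))) with hq
  have hq0 : 0 < q := by positivity
  set D := Module.finrank ℝ V
  have hb1 : 0 < μ.real (ball (0 : V) 1) :=
    ENNReal.toReal_pos (measure_ball_pos μ 0 one_pos).ne' measure_ball_lt_top.ne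
  refine ⟨(q * p) ^ D * μ.real (ball (0 : V) 1), by positivity, fun e he r hr0 hrM => ?_⟩
  set w : V → ℝ := fun x => inner ℝ e ((c i).proj x - center μ (c i) f) with hw
  have hwm : Measurable w := by fun_prop
  have hAm : MeasurableSet {x | 0 < w x ∧ w x ≤ r} :=
    (measurableSet_lt measurable_const hwm).inter (measurableSet_le hwm measurable_const)
  set η := q * r with hη
  have hη0 : 0 < η := by positivity
  set z₀ := v + η • (c i).sec e
  have hsub : ∀ x ∈ ball z₀ (η * p), f x * ({x | 0 < w x ∧ w x ≤ r}.indicator (fun _ => 1) x)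
      = 1 := fun x hx => by
    have hx' : ‖x - z₀‖ < η * p := by rwa [mem_ball_iff_norm] at hx
    have h1 : w x = η + inner ℝ e ((c i).proj (x - z₀)) := by
      have : (c i).proj x - center μ (c i) f = η • e + (c i).proj (x - z₀) := by
        simp only [z₀, map_sub, map_add, map_smul, (c i).proj_sec, hv, proj_centerPoint hc]
        abel
      simp only [w, this, inner_add_right, inner_smul_right, real_inner_self_eq_norm_sq, he]
      ring
    have h2 : |inner ℝ e ((c i).proj (x - z₀))| < η := by
      calc |inner ℝ e ((c i).proj (x - z₀))| ≤ ‖e‖ * ‖(c i).proj (x - z₀)‖ :=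
            abs_real_inner_le_norm _ _
        _ ≤ P * (η * p) := by
            rw [he, one_mul]
            refine ((c i).proj.le_opNorm _).trans ?_
            gcongr
        _ = η * (P * p) := by ring
        _ < η := mul_lt_of_lt_one_right hη0 hPp
    have hηr : 2 * η ≤ r := by
      have : q ≤ 1 / 2 := min_le_left _ _
      nlinarith
    rw [abs_lt] at h2
    have h3 : x ∈ {x | 0 < w x ∧ w x ≤ r} := ⟨by linarith, by linarith⟩
    have h4 : x ∈ ball v δ := by
      rw [mem_ball_iff_norm]
      have hx2 : x - v = (x - z₀) + η • (c i).sec e := by simp only [z₀]; abel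
      have h5 : ‖(c i).sec e‖ ≤ S := by simpa [he] using (c i).sec.le_opNorm e
      calc ‖x - v‖ ≤ ‖x - z₀‖ + η * ‖(c i).sec e‖ := by
            rw [hx2]
            refine (norm_add_le _ _).trans_eq ?_
            rw [norm_smul, Real.norm_of_nonneg hη0.le]
        _ < η * p + η * S := add_lt_add_of_lt_of_le hx' (mul_le_mul_of_nonneg_left h5 hη0.le)
        _ ≤ η * (S + 1) := by nlinarith
        _ ≤ δ / ((|M| + 1) * (S + 1)) * (|M| + 1) * (S + 1) := by
            gcongr
            refine mul_le_mul (min_le_right _ _) ?_ hr0.le (by positivity)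
            linarith [le_abs_self M]
        _ = δ := by field_simp
    rw [hf.eq_one (hball h4), indicator_of_mem h3, one_mul]
  have hint : Integrable (fun x => f x * ({x | 0 < w x ∧ w x ≤ r}.indicator (fun _ => 1) x)) μ := by
    have := (hf.isMinimizer.density.bump.indicator hAm).integrable (μ := μ)
    refine this.congr (ae_of_all _ fun x => ?_)
    by_cases hx : x ∈ {x | 0 < w x ∧ w x ≤ r}
    · simp only [indicator_of_mem hx, mul_one]
    · simp only [indicator_of_notMem hx, mul_zero]
  calc (q * p) ^ D * μ.real (ball (0 : V) 1) * r ^ D = μ.real (ball z₀ (η * p)) := by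
        have : μ.real (ball z₀ (η * p)) = (η * p) ^ D * μ.real (ball (0 : V) 1) := by
          rw [Measure.real, Measure.addHaar_ball_of_pos μ _ (by positivity), ENNReal.toReal_mul,
            ENNReal.toReal_ofReal (by positivity), Measure.real]
        rw [this, hη]
        ring
    _ = ∫ x in ball z₀ (η * p), f x * ({x | 0 < w x ∧ w x ≤ r}.indicator (fun _ => 1) x) ∂μ := by
        rw [setIntegral_congr_fun measurableSet_ball hsub]
        simp
    _ ≤ _ := by
        refine setIntegral_le_integral hint (ae_of_all _ fun x => ?_)
        exact mul_nonneg (hf.isMinimizer.density.nonneg x)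
          (indicator_nonneg (fun _ _ => zero_le_one) x)

set_option maxHeartbeats 1000000 in
/-- Quantitative monotonicity of the potentials of a minimizer. -/
theorem IsSharpMinimizer.exists_le_pot_sub_pot (i : ι) (M : ℝ) :
    ∃ κ, 0 < κ ∧ ∀ x y : F i, ‖x - center μ (c i) f‖ ≤ ‖y - center μ (c i) f‖ →
      ‖y - center μ (c i) f‖ ≤ M →
      κ * ((‖y - center μ (c i) f‖ - ‖x - center μ (c i) f‖) *
        (‖y - center μ (c i) f‖ + ‖x - center μ (c i) f‖) ^ (Module.finrank ℝ V + 1))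
      ≤ pot μ (c i) f y - pot μ (c i) f x := by
  set m := center μ (c i) f with hm
  set D := Module.finrank ℝ V
  have hfd := hf.isMinimizer.density
  have hfb := hfd.bump
  obtain ⟨κ, hκ, hslab⟩ := hf.exists_le_integral_slab hc i (2 * M)
  obtain ⟨-, R, -, hR0, -, hR⟩ := hfb.exists_bound
  set N := ‖m‖ + |M| + ‖(c i).proj‖ * R + 1
  have hN0 : 0 < N := by positivity
  refine ⟨κ / (4 * N ^ 2), by positivity, fun x' y' hxy' hyM => ?_⟩
  obtain ⟨e, he⟩ := exists_norm_eq (F i) zero_le_one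
  set s₁ := ‖x' - m‖ with hs₁
  set t₁ := ‖y' - m‖ with ht₁
  have hs0 : 0 ≤ s₁ := norm_nonneg _
  have ht0 : 0 ≤ t₁ := norm_nonneg _
  rcases hxy'.eq_or_lt with heq | hlt
  · rw [← heq, sub_self, zero_mul, mul_zero, sub_nonneg]
    exact hf.isMinimizer.pot_le hc i hxy'
  -- Since the potential is radial, both points may be moved to one ray from the centre. Their
  -- perpendicular bisector is then orthogonal to `e` at distance `r / 2 = (t₁ + s₁) / 2` from the
  -- centre.
  set x := m - s₁ • e with hx
  set y := m - t₁ • e with hy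
  have hnx : ‖x - m‖ = s₁ := by
    rw [hx, sub_sub_cancel_left, norm_neg, norm_smul, he, mul_one, Real.norm_of_nonneg hs0]
  have hny : ‖y - m‖ = t₁ := by
    rw [hy, sub_sub_cancel_left, norm_neg, norm_smul, he, mul_one, Real.norm_of_nonneg ht0]
  have hpx : pot μ (c i) f x' = pot μ (c i) f x :=
    le_antisymm (hf.isMinimizer.pot_le hc i (by rw [hnx])) (hf.isMinimizer.pot_le hc i (by rw [hnx]))
  have hpy : pot μ (c i) f y' = pot μ (c i) f y :=
    le_antisymm (hf.isMinimizer.pot_le hc i (by rw [hny])) (hf.isMinimizer.pot_le hc i (by rw [hny]))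
  rw [hpx, hpy]
  set r := t₁ + s₁ with hr
  have hr0 : 0 < r := by linarith
  set a := inner ℝ e m - r / 2 with ha
  have hee : inner ℝ e e = (1 : ℝ) := by rw [real_inner_self_eq_norm_sq, he, one_pow]
  have hix : inner ℝ e x = inner ℝ e m - s₁ := by
    rw [hx, inner_sub_right, inner_smul_right, hee, mul_one]
  have ham : a < inner ℝ e m := by linarith
  have hax : a < inner ℝ e x := by rw [hix]; linarith
  have hxy : refl e a x = y := by
    rw [refl, hix, hx, hy, ha, hr]
    module
  obtain ⟨hJi, hJ⟩ := pot_refl_sub_pot (μ := μ) (c := c i) hfb he a x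
  set T := (c i).lift (refl e a) with hT
  have hTT : ∀ z, T (T z) = z := (c i).lift_lift (refl_refl he a)
  have hTm : MeasurePreserving T μ μ := Coordinate.measurePreserving_refl he a
  have hTc : Continuous T := Coordinate.continuous_lift (continuous_refl a)
  have hpT : ∀ z, (c i).proj (T z) = refl e a ((c i).proj z) := (c i).proj_lift _
  have hfT := hfb.comp hTc hTT
  rw [hxy] at hJ
  rw [hJ]
  set w : V → ℝ := fun z => inner ℝ e ((c i).proj z - m) with hw
  have hwm : Measurable w := by fun_prop
  have hwT : ∀ z, w (T z) = - w z - r := fun z => by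
    have h1 := inner_refl he a ((c i).proj z)
    simp only [w, hpT, inner_sub_right]
    linarith
  -- Only the half space beyond the centre is kept, where the distance to the mirror is at least `r
  -- / 2`; the rest of the integrand is nonnegative and is discarded.
  set A : Set V := {z | 0 < w z}
  have hA : MeasurableSet A := measurableSet_lt measurable_const hwm
  set χ : V → ℝ := A.indicator fun _ => 1 with hχ
  have hχm : Measurable χ := measurable_const.indicator hA
  have hχ1 : ∀ z, |χ z| ≤ 1 := fun z => by
    by_cases hz : z ∈ A <;> simp [χ, hz]
  set k₀ := (t₁ - s₁) * r / (2 * N ^ 2) with hk₀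
  have hmain : ∀ᵐ z ∂μ, k₀ * (χ z * f z - χ z * f (T z)) ≤
      (Real.log ‖x - refl e a ((c i).proj z)‖ - Real.log ‖x - (c i).proj z‖) * (f z - f (T z)) := by
    filter_upwards [hf.isMinimizer.ae_log_refl_nonneg hc i he ham hax,
      (hf.isMinimizer.ae_refl hc i he ham).1, Coordinate.ae_proj_ne (μ := μ) (c := c) x]
      with z h1 h2 h3
    by_cases hz : z ∈ A
    · have hχz : χ z = 1 := indicator_of_mem hz _
      have hwz : 0 < w z := hz
      have hwz' : w z = inner ℝ e ((c i).proj z) - inner ℝ e m := inner_sub_right _ _ _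
      have hDz : 0 ≤ f z - f (T z) :=
        nonneg_of_mul_nonneg_right h2 (by linarith)
      rw [hχz, one_mul, one_mul]
      rcases hDz.eq_or_lt with h0 | h0
      · rw [← h0]; simp
      refine mul_le_mul_of_nonneg_right ?_ hDz
      have hzR : z ∈ closedBall (0 : V) R := by
        by_contra hcon
        rw [hR z hcon] at h0
        linarith [hfd.nonneg (T z)]
      have hpz : ‖(c i).proj z‖ ≤ ‖(c i).proj‖ * R :=
        ((c i).proj.le_opNorm z).trans (by gcongr; exact mem_closedBall_zero_iff.mp hzR)
      have hsq := norm_sub_refl_sq he a x ((c i).proj z)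
      have hge : (t₁ - s₁) * r ≤ ‖x - refl e a ((c i).proj z)‖ ^ 2 - ‖x - (c i).proj z‖ ^ 2 := by
        rw [hsq]
        have e1 : inner ℝ e x - a = (t₁ - s₁) / 2 := by rw [hix]; linarith
        have e2 : r / 2 ≤ inner ℝ e ((c i).proj z) - a := by linarith
        rw [e1]
        nlinarith
      have hpos : 0 ≤ (t₁ - s₁) * r := mul_nonneg (by linarith) hr0.le
      have hle : ‖x - (c i).proj z‖ ≤ ‖x - refl e a ((c i).proj z)‖ :=
        le_of_sq_le_sq (by linarith) (norm_nonneg _)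
      have hN : ‖x - refl e a ((c i).proj z)‖ ≤ N := by
        rw [← norm_refl_sub he, hxy]
        have hy1 : ‖y‖ ≤ ‖m‖ + |M| := by
          calc ‖y‖ = ‖m + (y - m)‖ := by rw [add_sub_cancel]
            _ ≤ ‖m‖ + ‖y - m‖ := norm_add_le _ _
            _ ≤ ‖m‖ + |M| := by rw [hny]; linarith [le_abs_self M]
        linarith [norm_sub_le y ((c i).proj z)]
      -- The reflection identity controls a difference of squares of distances, and this lower bound
      -- for a difference of logarithms is phrased accordingly.
      refine le_trans ?_ (log_sub_log_ge (norm_pos_iff.mpr (sub_ne_zero.mpr h3)) hle hN)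
      rw [hk₀]
      gcongr
    · have hχz : χ z = 0 := indicator_of_notMem hz _
      rw [hχz]
      simpa using h1
  have i1 : Integrable (fun z => χ z * f z) μ := (hfb.mul hχm hχ1).integrable
  have i2 : Integrable (fun z => χ z * f (T z)) μ := (hfT.mul hχm hχ1).integrable
  have hI := integral_mono_ae ((i1.sub i2).const_mul k₀) hJi hmain
  -- The density is invariant under reflection through the centre, because the potentials are
  -- radial. As `w ∘ T ∘ ρ = w - r`, the reflected mass in `A` equals the mass of `{r < w}`, and the
  -- difference is the mass of the slab `0 < w ≤ r`.
  set ρ := (c i).lift (refl e (inner ℝ e m)) with hρ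
  have hρm : MeasurePreserving ρ μ μ := Coordinate.measurePreserving_refl he _
  have hwρ : ∀ z, w (ρ z) = - w z := fun z => by
    have h1 := inner_refl he (inner ℝ e m) ((c i).proj z)
    simp only [w, inner_sub_right, hρ, (c i).proj_lift]
    linarith
  have hfρ : ∀ z, f (ρ z) = f z := fun z => by
    refine hf.congr (Finset.sum_congr rfl fun j _ => ?_)
    by_cases hj : j = i
    · subst hj
      rw [hρ, (c j).proj_lift]
      have hn : ‖refl e (inner ℝ e m) ((c j).proj z) - m‖ = ‖(c j).proj z - m‖ := by
        rw [norm_refl_sub he]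
        congr 2
        simp [refl]
      rw [le_antisymm (hf.isMinimizer.pot_le hc j hn.le) (hf.isMinimizer.pot_le hc j hn.ge)]
    · rw [hρ, hc.orth.proj_lift hj]
  have hχTm : Measurable fun z => χ (T z) := hχm.comp hTc.measurable
  have e1 : ∫ z, χ z * f (T z) ∂μ = ∫ z, χ (T (ρ z)) * f z ∂μ := by
    rw [← integral_comp_measurePreserving hTm (f := fun z => χ z * f (T z)) (hχm.mul hfT.meas)]
    simp only [hTT]
    rw [← integral_comp_measurePreserving hρm (f := fun z => χ (T z) * f z) (hχTm.mul hfb.meas)]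
    simp only [hfρ]
  have i3 : Integrable (fun z => χ (T (ρ z)) * f z) μ :=
    (hfb.mul (hχTm.comp hρm.measurable) (fun z => hχ1 _)).integrable
  have e2 : ∫ z, (χ z * f z - χ z * f (T z)) ∂μ = ∫ z, f z * ({z | 0 < w z ∧
      w z ≤ r}.indicator (fun _ => 1) z) ∂μ := by
    rw [integral_sub i1 i2, e1, ← integral_sub i1 i3]
    congr with z
    have h1 : χ z = if 0 < w z then 1 else 0 := rfl
    have h2 : χ (T (ρ z)) = if 0 < w (T (ρ z)) then 1 else 0 := rfl
    have h3 : ({z | 0 < w z ∧ w z ≤ r}.indicator (fun _ => (1 : ℝ)) z)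
      = if 0 < w z ∧ w z ≤ r then 1 else 0 := by
      by_cases h : 0 < w z ∧ w z ≤ r
      · rw [if_pos h]
        exact indicator_of_mem (show z ∈ {z | 0 < w z ∧ w z ≤ r} from h) _
      · rw [if_neg h]
        exact indicator_of_notMem (show z ∉ {z | 0 < w z ∧ w z ≤ r} from h) _
    rw [h1, h2, h3, hwT, hwρ]
    split_ifs <;> first | ring1 | (exfalso; grind)
  have hfin := hslab e he r hr0 (by linarith)
  simp only [Pi.sub_apply] at hI
  rw [integral_const_mul, e2] at hI
  have hk0 : 0 ≤ k₀ := by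
    have : 0 ≤ t₁ - s₁ := by linarith
    positivity
  have := mul_le_mul_of_nonneg_left hfin hk0
  calc κ / (4 * N ^ 2) * ((t₁ - s₁) * r ^ (D + 1)) = 2⁻¹ * (k₀ * (κ * r ^ D)) := by
        rw [hk₀]
        field_simp
        ring
    _ ≤ _ := by
        gcongr
        exact this.trans hI

end Setting
-- Thin layers around the boundary and the mass not symmetric under point reflection.
theorem exists_measure_annulus_le {E : Type*} [NormedAddCommGroup E] [NormedSpace ℝ E]
    [FiniteDimensional ℝ E] [Nontrivial E] [MeasurableSpace E] [BorelSpace E] (lam : Measure E)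
    [lam.IsAddHaarMeasure] (m : E) (M : ℝ) :
    ∃ C : ℝ≥0, ∀ r w : ℝ, 0 ≤ w →
      lam {z | ‖z - m‖ ≤ M ∧ |‖z - m‖ - r| ≤ w} ≤ C * ENNReal.ofReal w := by
  set k := Module.finrank ℝ E
  set L := lam (ball (0 : E) 1)
  have hL : L ≠ ∞ := measure_ball_lt_top.ne
  refine ⟨L.toNNReal * (2 * k * |M| ^ (k - 1)).toNNReal, fun r w hw => ?_⟩
  set b := min M (r + w)
  set a := max (r - w) 0
  have hsub : {z | ‖z - m‖ ≤ M ∧ |‖z - m‖ - r| ≤ w} ⊆ closedBall m b \ ball m a := by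
    rintro z ⟨h1, h2⟩
    rw [abs_le] at h2
    refine ⟨?_, ?_⟩
    · rw [mem_closedBall_iff_norm]
      exact le_min h1 (by linarith)
    · rw [mem_ball_iff_norm, not_lt]
      exact max_le (by linarith) (norm_nonneg _)
  have ha0 : 0 ≤ a := le_max_right _ _
  rcases lt_or_ge b a with hba | hab
  · have : closedBall m b \ ball m a = ∅ := by
      rw [sdiff_eq_empty]
      exact closedBall_subset_ball hba
    rw [this] at hsub
    simp [subset_empty_iff.mp hsub]
  have hb0 := ha0.trans hab
  have hbM : b ≤ |M| := (min_le_left _ _).trans (le_abs_self M)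
  have hdiff : b - a ≤ 2 * w := by
    have h1 : b ≤ r + w := min_le_right _ _
    have h2 : r - w ≤ a := le_max_left _ _
    linarith
  have hpow : b ^ k - a ^ k ≤ 2 * k * |M| ^ (k - 1) * w := by
    have h := (le_abs_self _).trans (abs_pow_sub_pow_le b a k)
    rw [abs_of_nonneg (sub_nonneg.mpr hab), abs_of_nonneg hb0, abs_of_nonneg ha0,
      max_eq_left hab] at h
    calc _ ≤ (b - a) * k * b ^ (k - 1) := h
      _ ≤ (2 * w) * k * |M| ^ (k - 1) := by gcongr
      _ = _ := by ring
  calc lam {z | ‖z - m‖ ≤ M ∧ |‖z - m‖ - r| ≤ w} ≤ lam (closedBall m b \ ball m a) :=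
        measure_mono hsub
    _ = ENNReal.ofReal (b ^ k) * L - ENNReal.ofReal (a ^ k) * L := by
        rw [measure_sdiff (ball_subset_closedBall.trans (closedBall_subset_closedBall hab))
          measurableSet_ball.nullMeasurableSet measure_ball_lt_top.ne,
          Measure.addHaar_closedBall _ _ hb0, Measure.addHaar_ball _ _ ha0]
    _ = ENNReal.ofReal (b ^ k - a ^ k) * L := by
        rw [ENNReal.ofReal_sub _ (by positivity), ENNReal.sub_mul fun _ _ => hL]
    _ ≤ ENNReal.ofReal (2 * k * |M| ^ (k - 1) * w) * L := by gcongr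
    _ = _ := by
        rw [ENNReal.ofReal_mul (by positivity), ENNReal.coe_mul, ENNReal.coe_toNNReal hL,
          ENNReal.ofReal]
        ring

section Setting

variable {V : Type*} [NormedAddCommGroup V] [NormedSpace ℝ V] [FiniteDimensional ℝ V]
  [MeasurableSpace V] [BorelSpace V] {μ : Measure V} [μ.IsAddHaarMeasure]
  {ι : Type*} [Fintype ι] {F : ι → Type*} [∀ i, NormedAddCommGroup (F i)]
  [∀ i, InnerProductSpace ℝ (F i)]
  [∀ i, FiniteDimensional ℝ (F i)] [∀ i, MeasurableSpace (F i)] [∀ i, BorelSpace (F i)]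
  [∀ i, Nontrivial (F i)]
  {c : ∀ i, Coordinate V (F i)} {d : ι → ℝ} {f : V → ℝ} {s : ℝ}

theorem IsOrthogonal.totalPot_add_sec (hc : IsOrthogonal c) (j : ι) (x : V) (z : F j) :
    totalPot μ c d f (x + (c j).sec z) = totalPot μ c d f x - d j * pot μ (c j) f ((c j).proj x)
      + d j * pot μ (c j) f ((c j).proj x + z) := by
  simp only [totalPot]
  rw [← Finset.add_sum_erase _ _ (Finset.mem_univ j),
    ← Finset.add_sum_erase _ (fun i => d i * pot μ (c i) f ((c i).proj x)) (Finset.mem_univ j),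
    map_add, (c j).proj_sec]
  have : ∀ i ∈ Finset.univ.erase j, d i * pot μ (c i) f ((c i).proj (x + (c j).sec z))
      = d i * pot μ (c i) f ((c i).proj x) := fun i hi => by
    rw [map_add, hc j i (Finset.ne_of_mem_erase hi), add_zero]
  rw [Finset.sum_congr rfl this]
  ring

variable (hf : IsSharpMinimizer μ c d f s) (hc : IsCoordinateSystem c d)
include hf hc

/-- The potentials of a minimizer have thin level sets. -/
theorem IsSharpMinimizer.exists_measure_pot_level_le (j : ι) (M : ℝ) :
    ∃ C : ℝ≥0, ∀ a δ : ℝ, 0 ≤ δ →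
      (Measure.addHaar : Measure (F j)) {z | ‖z - center μ (c j) f‖ ≤ M ∧
        |d j * pot μ (c j) f z - a| ≤ δ}
      ≤ C * ENNReal.ofReal (δ ^ (((Module.finrank ℝ V + 2 : ℕ) : ℝ)⁻¹)) := by
  set m := center μ (c j) f
  set D := Module.finrank ℝ V
  -- The potential grows at least like the power `D + 2` of the difference of radii, so a layer of
  -- potential width `δ` lies in an annulus of width of order `δ ^ θ`.
  set θ : ℝ := ((D + 2 : ℕ) : ℝ)⁻¹ with hθ
  obtain ⟨κ, hκ, hlow⟩ := hf.exists_le_pot_sub_pot hc j M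
  obtain ⟨C, hC⟩ := exists_measure_annulus_le (Measure.addHaar : Measure (F j)) m M
  have hdj := hc.pos j
  set K := 2 / (d j * κ) with hK
  have hK0 : 0 < K := by positivity
  refine ⟨C * (K ^ θ).toNNReal, fun a δ hδ => ?_⟩
  set Z := {z | ‖z - m‖ ≤ M ∧ |d j * pot μ (c j) f z - a| ≤ δ} with hZ
  rcases Z.eq_empty_or_nonempty with hemp | ⟨z₀, hz₀⟩
  · rw [hemp]; simp
  have key : ∀ x ∈ Z, ∀ y ∈ Z, ‖x - m‖ ≤ ‖y - m‖ → ‖y - m‖ - ‖x - m‖ ≤ K ^ θ * δ ^ θ := by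
    intro x hx y hy hxy
    have h1 := hlow x y hxy hy.1
    set t := ‖y - m‖ - ‖x - m‖
    have ht : 0 ≤ t := sub_nonneg.mpr hxy
    have h2 : t ^ (D + 2) ≤ t * (‖y - m‖ + ‖x - m‖) ^ (D + 1) := by
      rw [pow_succ' t (D + 1)]
      gcongr
      linarith [norm_nonneg (x - m)]
    have h3 : d j * (pot μ (c j) f y - pot μ (c j) f x) ≤ 2 * δ := by
      linarith [(abs_le.mp hy.2).2, (abs_le.mp hx.2).1]
    have h4 : t ^ (D + 2) ≤ K * δ := by
      rw [hK, div_mul_eq_mul_div, le_div_iff₀ (by positivity)]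
      nlinarith [mul_le_mul_of_nonneg_left h1 hdj.le, mul_le_mul_of_nonneg_left h2
        (mul_pos hdj hκ).le]
    calc t = (t ^ (D + 2)) ^ θ := (Real.pow_rpow_inv_natCast ht (by omega)).symm
      _ ≤ (K * δ) ^ θ := by gcongr
      _ = _ := Real.mul_rpow hK0.le hδ
  have hsub : Z ⊆ {z | ‖z - m‖ ≤ M ∧ |‖z - m‖ - ‖z₀ - m‖| ≤ K ^ θ * δ ^ θ} := fun z hz => by
    refine ⟨hz.1, ?_⟩
    rcases le_total ‖z - m‖ ‖z₀ - m‖ with h | h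
    · rw [abs_sub_comm, abs_of_nonneg (sub_nonneg.mpr h)]
      exact key z hz z₀ hz₀ h
    · rw [abs_of_nonneg (sub_nonneg.mpr h)]
      exact key z₀ hz₀ z hz h
  refine (measure_mono hsub).trans ((hC _ _ (by positivity)).trans_eq ?_)
  rw [ENNReal.ofReal_mul (by positivity), ENNReal.coe_mul, ← mul_assoc]
  rfl

/-- Mass near the boundary of a minimizer that is not invariant under the point reflection at `t`
in a coordinate. -/
theorem IsSharpMinimizer.exists_lintegral_reflect_le {i j : ι} (hij : j ≠ i) (M : ℝ) :
    ∃ η : ℝ, 0 < η ∧ η ≤ 1 ∧ ∃ C : ℝ≥0, ∀ t : F i, ‖t‖ ≤ M →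
      ∫⁻ x, ENNReal.ofReal (|f x - f ((c i).lift (fun z => (2 : ℝ) • t - z) x)| *
        ‖t - (c i).proj x‖ ^ (-(1 + η))) ∂μ ≤ C := by
  have hfd := hf.isMinimizer.density
  have hfb := hfd.bump
  set D := Module.finrank ℝ V
  set θ : ℝ := ((D + 2 : ℕ) : ℝ)⁻¹ with hθ
  have hθ0 : 0 < θ := by positivity
  have hθ1 : θ ≤ 1 := inv_le_one_of_one_le₀ (by exact_mod_cast (by omega : 1 ≤ D + 2))
  obtain ⟨H, hH0, hH⟩ := hfb.exists_pot_holder (μ := μ) (c i)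
  obtain ⟨-, R, -, hR0, -, hR⟩ := hfb.exists_bound
  -- A radius large enough to contain the support of `f` and its image under the point reflection at
  -- any `t` with `‖t‖ ≤ M`.
  set R₁ := R + ‖(c i).sec‖ * (2 * (|M| + ‖(c i).proj‖ * R)) with hR₁
  set m := center μ (c j) f
  obtain ⟨C₁, hC₁⟩ := hf.exists_measure_pot_level_le hc j (‖(c j).proj‖ * R₁ + ‖m‖)
  set R₂ := R₁ + ‖(c j).sec‖
  -- Layers of width of order `‖t - π x‖ ^ (1 / 2)` contribute a factor `‖t - π x‖ ^ (θ / 2)`.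
  -- Against the weight of exponent `-(1 + θ / 4)` this leaves `-(1 - θ / 4)`, which is integrable.
  obtain ⟨C₂, hC₂⟩ := exists_lintegral_rpow_le μ (c i).proj (c i).sec (c i).proj_sec R₂
    (β := 1 - θ / 4) (by linarith) (by linarith)
  set lam : Measure (F j) := Measure.addHaar
  set B : Set (F j) := closedBall 0 1
  have hB0 : lam B ≠ 0 := (measure_closedBall_pos lam 0 one_pos).ne'
  have hBtop : lam B ≠ ∞ := (isCompact_closedBall 0 1).measure_ne_top
  set K := d i * (H * √2)
  have hK0 : 0 ≤ K := by have := hc.pos i; positivity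
  set h := totalPot μ c d f with hh
  have hcont : Continuous h := hfb.continuous_totalPot
  set C₃ : ℝ≥0∞ := C₁ * ENNReal.ofReal (K ^ θ) with hC₃
  have hC₃top : C₃ ≠ ∞ := by finiteness
  refine ⟨θ / 4, by positivity, by linarith, ((lam B)⁻¹ * (C₃ * C₂)).toNNReal, fun t ht => ?_⟩
  rw [ENNReal.coe_toNNReal (by finiteness)]
  set τ := (c i).lift (fun z => (2 : ℝ) • t - z) with hτ
  set π := (c i).proj
  have hττ : ∀ x, τ (τ x) = x := (c i).lift_lift fun z => by simp
  have hpτ : ∀ x, π (τ x) = (2 : ℝ) • t - π x := (c i).proj_lift _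
  -- If `f x ≠ f (τ x)`, then `h x` and `h (τ x)` lie on different sides of `s`. They differ by at
  -- most `K * √‖t - π x‖` by Hölder continuity, so both are that close to `s`.
  set E : Set V := closedBall 0 R₁ ∩ {x | |h x - s| ≤ K * √‖t - π x‖}
  have hEm : MeasurableSet E := measurableSet_closedBall.inter
    (measurableSet_le (by fun_prop) (by fun_prop))
  have hτR : ∀ x, τ x ∈ closedBall (0 : V) R → x ∈ closedBall (0 : V) R₁ := fun x hx => by
    rw [mem_closedBall_zero_iff] at hx ⊢
    have h1 : ‖π (τ x)‖ ≤ ‖π‖ * R := (π.le_opNorm _).trans (by gcongr)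
    have h2 : x = τ x + (c i).sec ((2 : ℝ) • (t - π (τ x))) := by
      conv_lhs => rw [← hττ x, hτ, Coordinate.lift]
      congr 2
      module
    rw [h2, hR₁]
    refine (norm_add_le _ _).trans (add_le_add hx (((c i).sec.le_opNorm _).trans ?_))
    rw [norm_smul, Real.norm_ofNat]
    gcongr
    refine (norm_sub_le _ _).trans ?_
    gcongr
    exact ht.trans (le_abs_self M)
  have hRR₁ : R ≤ R₁ := le_add_of_nonneg_right (by positivity)
  have hpot : ∀ x, |h (τ x) - h x| ≤ K * √‖t - π x‖ := fun x => by
    have h1 : h (τ x) - h x = d i * (pot μ (c i) f ((2 : ℝ) • t - π x) - pot μ (c i) f (π x)) := by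
      rw [hh, hτ, Coordinate.lift, hc.orth.totalPot_add_sec]
      simp only [add_sub_cancel]
      ring
    rw [h1, abs_mul, abs_of_pos (hc.pos i), mul_assoc]
    refine mul_le_mul_of_nonneg_left ((hH _ _).trans_eq ?_) (hc.pos i).le
    rw [show (2 : ℝ) • t - π x - π x = (2 : ℝ) • (t - π x) by module, norm_smul, Real.norm_ofNat,
      Real.sqrt_mul (by norm_num)]
    ring
  have hE : ∀ x, f x ≠ f (τ x) → x ∈ E := fun x hx => by
    have h1 := abs_le.mp (hpot x)
    refine ⟨?_, ?_⟩
    · by_cases hxR : x ∈ closedBall (0 : V) R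
      · exact closedBall_subset_closedBall hRR₁ hxR
      · refine hτR x (by_contra fun h' => hx ?_)
        rw [hR _ hxR, hR _ h']
    · change |h x - s| ≤ _
      rw [abs_le]
      rcases lt_or_ge (h x) s with h2 | h2 <;> rcases lt_or_ge (h (τ x)) s with h3 | h3
      · exact absurd ((hf.eq_one h2).trans (hf.eq_one h3).symm) hx
      · constructor <;> linarith
      · constructor <;> linarith
      · exact absurd ((hf.eq_zero h2).trans (hf.eq_zero h3).symm) hx
  set φ : V → ℝ≥0∞ := fun x => ENNReal.ofReal (‖t - π x‖ ^ (-(1 + θ / 4))) with hφ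
  have hφm : Measurable φ := by fun_prop
  have hφs : ∀ x z, φ (x + (c j).sec z) = φ x := fun x z => by
    simp only [hφ, π, map_add, hc.orth j i hij.symm, add_zero]
  have hstep1 : ∫⁻ x, ENNReal.ofReal (|f x - f (τ x)| * ‖t - π x‖ ^ (-(1 + θ / 4))) ∂μ
      ≤ ∫⁻ x, E.indicator φ x ∂μ := by
    refine lintegral_mono fun x => ?_
    by_cases hx : f x = f (τ x)
    · simp [hx]
    · rw [indicator_of_mem (hE x hx)]
      refine ENNReal.ofReal_le_ofReal (mul_le_of_le_one_left (by positivity) ?_)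
      rw [abs_le]
      constructor <;> linarith [hfd.nonneg x, hfd.le_one x, hfd.nonneg (τ x), hfd.le_one (τ x)]
  -- Averaging in the direction of coordinate `j` leaves the weight `φ` unchanged and replaces the
  -- indicator of `E` by the measure of its slice, a thin layer of the potential in coordinate `j`.
  have hinner : ∀ x, ∫⁻ z in B, E.indicator φ (x + (c j).sec z) ∂lam
      ≤ (closedBall 0 R₂).indicator
        (fun x => C₃ * ENNReal.ofReal (‖t - π x‖ ^ (-(1 - θ / 4)))) x := fun x => by
    by_cases hx : x ∈ closedBall (0 : V) R₂
    · rw [indicator_of_mem hx]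
      set Z : Set (F j) := {z | x + (c j).sec z ∈ E}
      have hZm : MeasurableSet Z := hEm.preimage (by fun_prop)
      calc ∫⁻ z in B, E.indicator φ (x + (c j).sec z) ∂lam
          ≤ ∫⁻ z, Z.indicator (fun _ => φ x) z ∂lam := by
            refine (setLIntegral_le_lintegral _ _).trans (lintegral_mono fun z => ?_)
            by_cases hz : x + (c j).sec z ∈ E
            · rw [indicator_of_mem hz, indicator_of_mem (show z ∈ Z from hz), hφs]
            · rw [indicator_of_notMem hz]
              exact zero_le
        _ = lam Z * φ x := by
            rw [lintegral_indicator hZm, setLIntegral_const, mul_comm]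
        _ ≤ C₁ * ENNReal.ofReal ((K * √‖t - π x‖) ^ θ) * φ x := by
            gcongr
            set y := (c j).proj x
            have hsub : Z ⊆ (fun z => y + z) ⁻¹' {z | ‖z - m‖ ≤ ‖(c j).proj‖ * R₁ + ‖m‖ ∧
                |d j * pot μ (c j) f z - (s - (h x - d j * pot μ (c j) f y))|
                  ≤ K * √‖t - π x‖} := fun z hz => by
              obtain ⟨hz1, hz2⟩ : x + (c j).sec z ∈ E := hz
              refine ⟨?_, ?_⟩
              · have : y + z = (c j).proj (x + (c j).sec z) := by rw [map_add, (c j).proj_sec]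
                change ‖y + z - m‖ ≤ _
                rw [this]
                refine (norm_sub_le _ _).trans ?_
                gcongr
                refine ((c j).proj.le_opNorm _).trans ?_
                gcongr
                exact mem_closedBall_zero_iff.mp hz1
              · have hz3 : |h (x + (c j).sec z) - s| ≤ K * √‖t - π (x + (c j).sec z)‖ := hz2
                have e1 : π (x + (c j).sec z) = π x := by
                  rw [map_add, hc.orth j i hij.symm, add_zero]
                rw [e1, hh, hc.orth.totalPot_add_sec] at hz3
                convert hz3 using 2
                ring
            refine (measure_mono hsub).trans ?_
            rw [measure_preimage_add]
            exact hC₁ _ _ (by positivity)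
        _ ≤ _ := by
            rw [hC₃, mul_assoc, mul_assoc (C₁ : ℝ≥0∞) (ENNReal.ofReal (K ^ θ))]
            gcongr (C₁ : ℝ≥0∞) * ?_
            rw [← ENNReal.ofReal_mul (by positivity), ← ENNReal.ofReal_mul (by positivity)]
            refine ENNReal.ofReal_le_ofReal ?_
            rw [Real.mul_rpow hK0 (Real.sqrt_nonneg _), mul_assoc]
            gcongr
            rcases (norm_nonneg (t - π x)).eq_or_lt with h0 | h0
            · rw [← h0, Real.sqrt_zero, Real.zero_rpow hθ0.ne', zero_mul]
              positivity
            · rw [Real.sqrt_eq_rpow, ← Real.rpow_mul h0.le, ← Real.rpow_add h0]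
              refine le_of_eq ?_
              congr 1
              ring
    · rw [indicator_of_notMem hx]
      refine (setLIntegral_eq_zero measurableSet_closedBall fun z hz => ?_).le
      refine indicator_of_notMem (fun h' => hx ?_) _
      have h1 := h'.1
      simp only [mem_closedBall_zero_iff] at h1 hz ⊢
      calc ‖x‖ = ‖x + (c j).sec z - (c j).sec z‖ := by simp
        _ ≤ ‖x + (c j).sec z‖ + ‖(c j).sec z‖ := norm_sub_le _ _
        _ ≤ R₁ + ‖(c j).sec‖ := by
          gcongr
          exact ((c j).sec.le_opNorm z).trans (mul_le_of_le_one_right (norm_nonneg _) hz)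
  have havg := addHaar_mul_lintegral μ (c j).sec (hφm.indicator hEm) B
  have hfinal : lam B * ∫⁻ x, E.indicator φ x ∂μ ≤ C₃ * C₂ := by
    rw [havg]
    refine (lintegral_mono hinner).trans ?_
    rw [lintegral_indicator measurableSet_closedBall, lintegral_const_mul' _ _ hC₃top]
    gcongr
    exact hC₂ t
  refine hstep1.trans ?_
  rwa [← ENNReal.div_eq_inv_mul, ENNReal.le_div_iff_mul_le (.inl hB0) (.inl hBtop), mul_comm]

end Setting
-- Smoothed kernels and the gradient of the potential as a symmetrized integral.
section Kernel

variable {F : Type*} [NormedAddCommGroup F] [InnerProductSpace ℝ F]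

/-- The gradient of the smoothed logarithmic kernel `log (‖u‖ ^ 2 + ε ^ 2) / 2`. -/
noncomputable def gradKernel (ε : ℝ) (u : F) : F := (‖u‖ ^ 2 + ε ^ 2)⁻¹ • u

theorem gradKernel_neg (ε : ℝ) (u : F) : gradKernel ε (-u) = -gradKernel ε u := by
  simp [gradKernel]

theorem continuous_gradKernel {ε : ℝ} (hε : 0 < ε) : Continuous (gradKernel ε : F → F) := by
  have h : Continuous fun u : F => (‖u‖ ^ 2 + ε ^ 2)⁻¹ :=
    Continuous.inv₀ (by fun_prop) fun u => by positivity
  exact h.smul continuous_id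

theorem norm_gradKernel_le {ε : ℝ} (hε : 0 < ε) (u : F) : ‖gradKernel ε u‖ ≤ ε⁻¹ := by
  rw [gradKernel, norm_smul, norm_inv, Real.norm_of_nonneg (by positivity),
    inv_mul_le_iff₀ (by positivity), ← div_eq_mul_inv, le_div_iff₀ hε]
  nlinarith [sq_nonneg (‖u‖ - ε), norm_nonneg u, sq_nonneg ‖u‖, sq_nonneg ε]

theorem hasFDerivAt_half_log {ε : ℝ} (hε : 0 < ε) (u : F) :
    HasFDerivAt (fun u : F => 2⁻¹ * Real.log (‖u‖ ^ 2 + ε ^ 2)) (innerSL ℝ (gradKernel ε u)) u := by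
  have h1 : HasFDerivAt (fun u : F => ‖u‖ ^ 2 + ε ^ 2) (2 • innerSL ℝ u) u :=
    (hasStrictFDerivAt_norm_sq u).hasFDerivAt.add_const (ε ^ 2)
  refine ((h1.log (by positivity)).const_mul 2⁻¹).congr_fderiv ?_
  ext v
  simp [gradKernel]
  ring

/-- The difference is `ε² / (r² + ε²)` times `r⁻¹`, and the first factor is at most `min 1 ((ε / r)
^ 2) ≤ (ε / r) ^ η`. An extra `η` of integrability at the singularity thus becomes a rate `ε ^ η`.
-/
theorem norm_gradKernel_sub_le {ε η : ℝ} (hε : 0 < ε) (hη0 : 0 < η) (hη1 : η ≤ 1) (u : F) :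
    ‖gradKernel ε u - gradKernel 0 u‖ ≤ ε ^ η * ‖u‖ ^ (-(1 + η)) := by
  rcases eq_or_ne u 0 with rfl | hu
  · simp only [gradKernel, smul_zero, sub_self, norm_zero]
    positivity
  have hr : 0 < ‖u‖ := norm_pos_iff.mpr hu
  set r := ‖u‖
  have h1 : ‖gradKernel ε u - gradKernel 0 u‖ = ε ^ 2 / (r ^ 2 + ε ^ 2) * r⁻¹ := by
    rw [gradKernel, gradKernel, ← sub_smul, norm_smul, norm_sub_rev,
      Real.norm_of_nonneg]
    · simp only [ne_eq, OfNat.ofNat_ne_zero, not_false_eq_true, zero_pow, add_zero]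
      field_simp
      ring
    · rw [sub_nonneg]
      refine inv_anti₀ (by simpa using pow_pos hr 2) ?_
      simpa using sq_nonneg ε
  have h2 : ε ^ 2 / (r ^ 2 + ε ^ 2) ≤ (ε / r) ^ η := by
    rcases le_total ε r with h | h
    · have h3 : ε / r ≤ 1 := (div_le_one hr).mpr h
      calc ε ^ 2 / (r ^ 2 + ε ^ 2) ≤ ε ^ 2 / r ^ 2 := by
            gcongr
            exact le_add_of_nonneg_right (sq_nonneg ε)
        _ = (ε / r) ^ (2 : ℝ) := by rw [Real.rpow_ofNat, div_pow]
        _ ≤ (ε / r) ^ η := Real.rpow_le_rpow_of_exponent_ge (by positivity) h3 (by linarith)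
    · have h3 : 1 ≤ ε / r := (one_le_div hr).mpr h
      refine le_trans ?_ (Real.one_le_rpow h3 hη0.le)
      rw [div_le_one (by positivity)]
      exact le_add_of_nonneg_left (sq_nonneg r)
  rw [h1]
  refine (mul_le_mul_of_nonneg_right h2 (by positivity)).trans_eq ?_
  rw [Real.div_rpow hε.le hr.le, Real.rpow_neg hr.le, Real.rpow_add hr, Real.rpow_one]
  field_simp

theorem abs_half_log_sub_log_le {ε r : ℝ} (hε : 0 < ε) (hr : 0 < r) :
    |2⁻¹ * Real.log (r ^ 2 + ε ^ 2) - Real.log r| ≤ √ε * (2 * r ^ (-(1 / 2) : ℝ)) := by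
  have h1 : 2⁻¹ * Real.log (r ^ 2 + ε ^ 2) = Real.log √(r ^ 2 + ε ^ 2) := by
    rw [Real.log_sqrt (by positivity)]
    ring
  have h2 : r ≤ √(r ^ 2 + ε ^ 2) := Real.le_sqrt_of_sq_le (by nlinarith)
  have h3 : √(r ^ 2 + ε ^ 2) ≤ r + ε := by
    rw [Real.sqrt_le_left (by positivity)]
    nlinarith
  rw [h1, abs_of_nonneg (sub_nonneg.mpr (Real.log_le_log hr h2))]
  refine (log_sub_log_le_sqrt hr h2).trans ?_
  rw [Real.rpow_neg hr.le, ← Real.sqrt_eq_rpow, mul_left_comm]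
  gcongr
  linarith

end Kernel

section Smooth

variable {V F : Type*} [NormedAddCommGroup V] [NormedSpace ℝ V] [FiniteDimensional ℝ V]
  [MeasurableSpace V] [BorelSpace V] {μ : Measure V} [μ.IsAddHaarMeasure]
  [NormedAddCommGroup F] [InnerProductSpace ℝ F] [FiniteDimensional ℝ F]
  [MeasurableSpace F] [BorelSpace F] [Nontrivial F] (c : Coordinate V F) {f : V → ℝ}

theorem IsBump.integrable_smul_continuous {E : Type*} [NormedAddCommGroup E] [NormedSpace ℝ E]
    (hf : IsBump f) {φ : V → E} (hφ : Continuous φ) : Integrable (fun x => f x • φ x) μ := by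
  obtain ⟨C, R, -, -, hC, hR⟩ := hf.exists_bound
  rw [← integrableOn_iff_integrable_of_support_subset (s := closedBall 0 R)]
  · exact (hφ.continuousOn.integrableOn_compact (isCompact_closedBall _ _)).bdd_smul C
      hf.meas.aestronglyMeasurable (ae_of_all _ hC)
  · intro x hx
    by_contra h
    exact hx (by simp [hR x h])

theorem IsBump.hasFDerivAt_smooth (hf : IsBump f) {ε : ℝ} (hε : 0 < ε) (t : F) :
    HasFDerivAt (fun t => ∫ x, f x * (2⁻¹ * Real.log (‖t - c.proj x‖ ^ 2 + ε ^ 2)) ∂μ)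
      (innerSL ℝ (∫ x, f x • gradKernel ε (t - c.proj x) ∂μ)) t := by
  have hc : ∀ t : F, Continuous fun x => 2⁻¹ * Real.log (‖t - c.proj x‖ ^ 2 + ε ^ 2) := fun t =>
    continuous_const.mul (Continuous.log (by fun_prop) fun x => by positivity)
  have hg : Continuous fun x => gradKernel ε (t - c.proj x) :=
    (continuous_gradKernel hε).comp (by fun_prop)
  have hI := hf.integrable_smul_continuous (μ := μ) hg
  rw [← (innerSL ℝ).integral_comp_comm hI]
  refine hasFDerivAt_integral_of_dominated_of_fderiv_le (s := univ)
    (F' := fun t x => innerSL ℝ (f x • gradKernel ε (t - c.proj x))) (bound := fun x => |f x| * ε⁻¹) univ_mem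
    (.of_forall fun t => (hf.integrable_mul_continuous (hc t)).aestronglyMeasurable)
    (hf.integrable_mul_continuous (hc t))
    ((innerSL ℝ).continuous.comp_aestronglyMeasurable hI.aestronglyMeasurable)
    (ae_of_all _ fun x t _ => ?_) (hf.integrable.abs.mul_const _)
    (ae_of_all _ fun x t _ => ?_)
  · rw [innerSL_apply_norm, norm_smul, Real.norm_eq_abs]
    gcongr
    exact norm_gradKernel_le hε _
  · refine (((hasFDerivAt_half_log hε (t - c.proj x)).comp t
      ((hasFDerivAt_id t).sub_const _)).const_mul (f x)).congr_fderiv ?_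
    ext v
    simp

theorem IsBump.continuous_smoothGrad (hf : IsBump f) {ε : ℝ} (hε : 0 < ε) :
    Continuous fun t : F => ∫ x, f x • gradKernel ε (t - c.proj x) ∂μ := by
  refine continuous_of_dominated (bound := fun x => |f x| * ε⁻¹) (fun t => ?_) (fun t => ?_)
    (hf.integrable.abs.mul_const _) (ae_of_all _ fun x => ?_)
  · have hg : Continuous fun x => gradKernel ε (t - c.proj x) :=
      (continuous_gradKernel hε).comp (by fun_prop)
    exact (hf.integrable_smul_continuous hg).aestronglyMeasurable
  · refine ae_of_all _ fun x => ?_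
    rw [norm_smul, Real.norm_eq_abs]
    gcongr
    exact norm_gradKernel_le hε _
  · have hg : Continuous fun t => gradKernel ε (t - c.proj x) :=
      (continuous_gradKernel hε).comp (by fun_prop)
    exact hg.const_smul _

theorem IsBump.tendsto_smooth (hf : IsBump f) (t : F) {ε : ℕ → ℝ} (hε : ∀ n, 0 < ε n)
    (hlim : Tendsto ε atTop (𝓝 0)) :
    Tendsto (fun n => ∫ x, f x * (2⁻¹ * Real.log (‖t - c.proj x‖ ^ 2 + ε n ^ 2)) ∂μ) atTop
      (𝓝 (pot μ c f t)) := by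
  have hI : Integrable (fun x => f x * (2 * ‖t - c.proj x‖ ^ (-(1 / 2) : ℝ))) μ :=
    hf.integrable_mul fun R => (((exists_integral_rpow_le μ c R (β := 1 / 2) (by norm_num)
      (by norm_num)).choose_spec.2 t).1).const_mul 2
  have hc : ∀ ε : ℝ, 0 < ε → Continuous fun x => 2⁻¹ * Real.log (‖t - c.proj x‖ ^ 2 + ε ^ 2) :=
    fun ε hε => continuous_const.mul (Continuous.log (by fun_prop) fun x => by positivity)
  rw [tendsto_iff_norm_sub_tendsto_zero]
  have hle : ∀ n, ‖∫ x, f x * (2⁻¹ * Real.log (‖t - c.proj x‖ ^ 2 + ε n ^ 2)) ∂μ - pot μ c f t‖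
      ≤ √(ε n) * ∫ x, ‖f x * (2 * ‖t - c.proj x‖ ^ (-(1 / 2) : ℝ))‖ ∂μ := fun n => by
    rw [pot, ← integral_sub (hf.integrable_mul_continuous (hc _ (hε n)))
      (hf.integrable_mul_log c t), ← integral_const_mul]
    refine norm_integral_le_of_norm_le (hI.norm.const_mul _) ?_
    filter_upwards [c.ae_ne t] with x hx
    have hr : 0 < ‖t - c.proj x‖ := norm_pos_iff.mpr (sub_ne_zero.mpr hx)
    rw [← mul_sub, norm_mul, norm_mul, mul_left_comm]
    gcongr
    refine (abs_half_log_sub_log_le (hε n) hr).trans ?_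
    gcongr
    exact Real.le_norm_self _
  refine squeeze_zero (fun _ => norm_nonneg _) hle ?_
  have h1 : Tendsto (fun n => √(ε n)) atTop (𝓝 0) := by
    simpa [Function.comp_def] using (Real.continuous_sqrt.tendsto 0).comp hlim
  simpa using h1.mul_const _

/-- The gradient of the potential, as an integral symmetrized by the point reflection at `t`. -/
noncomputable def potGrad (μ : Measure V) (c : Coordinate V F) (f : V → ℝ) (t : F) : F :=
  (2⁻¹ : ℝ) • ∫ x, (f x - f (c.lift (fun z => (2 : ℝ) • t - z) x)) • gradKernel 0 (t - c.proj x) ∂μ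

/-- The kernel is odd about `t`, so `f` may be replaced by half of `f - f ∘ τ` with `τ` the point
reflection. This difference is small near `t` in the integrated sense of `hC`, which makes the
unsmoothed kernel integrable against it even when `F` is a line. -/
theorem IsBump.norm_smoothGrad_sub_le (hf : IsBump f) {ε η : ℝ} (hε : 0 < ε) (hη0 : 0 < η)
    (hη1 : η ≤ 1) {t : F} {C : ℝ≥0}
    (hC : ∫⁻ x, ENNReal.ofReal (|f x - f (c.lift (fun z => (2 : ℝ) • t - z) x)| *
      ‖t - c.proj x‖ ^ (-(1 + η))) ∂μ ≤ C) :
    ‖∫ x, f x • gradKernel ε (t - c.proj x) ∂μ - potGrad μ c f t‖ ≤ ε ^ η * C := by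
  set σ : F → F := fun z => (2 : ℝ) • t - z
  have hσσ : ∀ z, σ (σ z) = z := fun z => by simp [σ]
  set τ := c.lift σ with hτ
  have hττ : ∀ x, τ (τ x) = x := c.lift_lift hσσ
  have hpτ : ∀ x, c.proj (τ x) = (2 : ℝ) • t - c.proj x := c.proj_lift _
  have hτm : MeasurePreserving τ μ μ :=
    c.measurePreserving_lift μ (-.id ℝ F) ((2 : ℝ) • t) (fun z => by simp [σ]; abel) hσσ
  have hτc : Continuous τ := by
    unfold τ Coordinate.lift σ
    fun_prop
  have hfτ := hf.comp hτc hττ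
  have hg : Continuous fun x => gradKernel ε (t - c.proj x) :=
    (continuous_gradKernel hε).comp (by fun_prop)
  set D : V → ℝ := fun x => f x - f (τ x)
  have hD : IsBump D := hf.sub hfτ
  have i1 := hf.integrable_smul_continuous (μ := μ) hg
  have i2 := hfτ.integrable_smul_continuous (μ := μ) hg
  have e1 : ∫ x, f (τ x) • gradKernel ε (t - c.proj x) ∂μ
      = - ∫ x, f x • gradKernel ε (t - c.proj x) ∂μ := by
    have h := integral_map (μ := μ) hτm.measurable.aemeasurable
      (f := fun x => f x • gradKernel ε (t - c.proj x)) (by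
        rw [hτm.map_eq]
        exact i1.aestronglyMeasurable)
    rw [hτm.map_eq] at h
    rw [h, ← integral_neg]
    congr with x : 1
    rw [hpτ, show t - ((2 : ℝ) • t - c.proj x) = -(t - c.proj x) by module, gradKernel_neg,
      smul_neg, neg_neg]
  have e2 : ∫ x, f x • gradKernel ε (t - c.proj x) ∂μ
      = (2⁻¹ : ℝ) • ∫ x, D x • gradKernel ε (t - c.proj x) ∂μ := by
    simp only [D, sub_smul]
    rw [integral_sub i1 i2, e1, sub_neg_eq_add, ← two_smul ℝ, smul_smul]
    norm_num
  have i3 : Integrable (fun x => D x • gradKernel ε (t - c.proj x)) μ :=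
    hD.integrable_smul_continuous hg
  have hbound : ∀ x, ‖D x • (gradKernel ε (t - c.proj x) - gradKernel 0 (t - c.proj x))‖
      ≤ ε ^ η * (|D x| * ‖t - c.proj x‖ ^ (-(1 + η))) := fun x => by
    rw [norm_smul, Real.norm_eq_abs, mul_left_comm]
    gcongr
    exact norm_gradKernel_sub_le hε hη0 hη1 _
  have hm0 : AEStronglyMeasurable (fun x => gradKernel 0 (t - c.proj x)) μ := by
    unfold gradKernel
    exact Measurable.aestronglyMeasurable (by fun_prop)
  have hDm := hD.meas
  have hmr : Measurable fun x => |D x| * ‖t - c.proj x‖ ^ (-(1 + η)) := by fun_prop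
  have hnn : ∀ x, 0 ≤ |D x| * ‖t - c.proj x‖ ^ (-(1 + η)) := fun x => by positivity
  have i4 : Integrable (fun x => |D x| * ‖t - c.proj x‖ ^ (-(1 + η))) μ := by
    refine ⟨hmr.aestronglyMeasurable, ?_⟩
    rw [hasFiniteIntegral_iff_ofReal (ae_of_all _ hnn)]
    exact hC.trans_lt ENNReal.coe_lt_top
  have i5 : Integrable
      (fun x => D x • (gradKernel ε (t - c.proj x) - gradKernel 0 (t - c.proj x))) μ :=
    Integrable.mono' (i4.const_mul _)
      (hDm.aestronglyMeasurable.smul (hg.aestronglyMeasurable.sub hm0)) (ae_of_all _ hbound)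
  have i6 : Integrable (fun x => D x • gradKernel 0 (t - c.proj x)) μ := by
    have := i3.sub i5
    refine this.congr (ae_of_all _ fun x => ?_)
    simp only [Pi.sub_apply, smul_sub, sub_sub_cancel]
  rw [e2, potGrad, ← smul_sub, ← integral_sub i3 i6, norm_smul]
  have h1 : ‖∫ x, (D x • gradKernel ε (t - c.proj x) - D x • gradKernel 0 (t - c.proj x)) ∂μ‖
      ≤ ε ^ η * ∫ x, |D x| * ‖t - c.proj x‖ ^ (-(1 + η)) ∂μ := by
    rw [← integral_const_mul]
    refine norm_integral_le_of_norm_le (i4.const_mul _) (ae_of_all _ fun x => ?_)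
    rw [← smul_sub]
    exact hbound x
  have h2 : ∫ x, |D x| * ‖t - c.proj x‖ ^ (-(1 + η)) ∂μ ≤ C := by
    rw [integral_eq_lintegral_of_nonneg_ae (ae_of_all _ hnn) hmr.aestronglyMeasurable]
    exact ENNReal.toReal_le_of_le_ofReal C.2 (by simpa using hC)
  calc _ ≤ 1 * (ε ^ η * ∫ x, |D x| * ‖t - c.proj x‖ ^ (-(1 + η)) ∂μ) := by
        gcongr
        norm_num
    _ ≤ ε ^ η * C := by
        rw [one_mul]
        gcongr

end Smooth

/-! ### Continuous differentiability of the potentials when there are two coordinates. -/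

section Setting

variable {V : Type*} [NormedAddCommGroup V] [NormedSpace ℝ V] [FiniteDimensional ℝ V]
  [MeasurableSpace V] [BorelSpace V] {μ : Measure V} [μ.IsAddHaarMeasure]
  {ι : Type*} [Fintype ι] {F : ι → Type*} [∀ i, NormedAddCommGroup (F i)]
  [∀ i, InnerProductSpace ℝ (F i)]
  [∀ i, FiniteDimensional ℝ (F i)] [∀ i, MeasurableSpace (F i)] [∀ i, BorelSpace (F i)]
  [∀ i, Nontrivial (F i)]
  {c : ∀ i, Coordinate V (F i)} {d : ι → ℝ} {f : V → ℝ} {s : ℝ}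
  (hf : IsSharpMinimizer μ c d f s) (hc : IsCoordinateSystem c d)
include hf hc

/-- The smoothed potentials converge pointwise and their gradients locally uniformly. The second
coordinate `j` is essential: the potential of an interval on a line is not differentiable at its end
points. -/
theorem IsSharpMinimizer.hasFDerivAt_pot_and_continuous {i j : ι} (hij : j ≠ i) :
    (∀ t, HasFDerivAt (pot μ (c i) f) (innerSL ℝ (potGrad μ (c i) f t)) t) ∧
      Continuous (potGrad μ (c i) f) := by
  have hfb := hf.isMinimizer.density.bump
  set ε : ℕ → ℝ := fun n => 1 / (n + 1)
  have hε : ∀ n, 0 < ε n := fun n => Nat.one_div_pos_of_nat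
  have hε0 : Tendsto ε atTop (𝓝 0) := tendsto_one_div_add_atTop_nhds_zero_nat
  have hunif : ∀ M, TendstoUniformlyOn
      (fun n t => ∫ x, f x • gradKernel (ε n) (t - (c i).proj x) ∂μ) (potGrad μ (c i) f) atTop
      (ball 0 M) := fun M => by
    obtain ⟨η, hη0, hη1, C, hC⟩ := hf.exists_lintegral_reflect_le hc hij M
    have hlim : Tendsto (fun n => ε n ^ η * C) atTop (𝓝 0) := by
      have h := ((Real.continuous_rpow_const hη0.le).tendsto 0).comp hε0
      rw [Real.zero_rpow hη0.ne'] at h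
      simpa [Function.comp_def] using h.mul_const (C : ℝ)
    rw [Metric.tendstoUniformlyOn_iff]
    intro δ hδ
    filter_upwards [hlim.eventually_lt_const hδ] with n hn t ht
    rw [dist_comm, dist_eq_norm]
    exact (hfb.norm_smoothGrad_sub_le (c i) (hε n) hη0 hη1
      (hC t (mem_ball_zero_iff.mp ht).le)).trans_lt hn
  have hmem : ∀ t : F i, t ∈ ball (0 : F i) (‖t‖ + 1) := fun t => by simp
  refine ⟨fun t => ?_, continuous_iff_continuousAt.mpr fun t => ?_⟩
  · exact hasFDerivAt_of_tendstoUniformlyOn isOpen_ball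
      ((innerSL ℝ).uniformContinuous.comp_tendstoUniformlyOn (hunif (‖t‖ + 1)))
      (fun n x _ => hfb.hasFDerivAt_smooth (c i) (hε n) x)
      (fun x _ => hfb.tendsto_smooth (c i) x hε hε0) (hmem t)
  · exact ((hunif (‖t‖ + 1)).continuousOn (.of_forall fun n =>
      (hfb.continuous_smoothGrad (c i) (hε n)).continuousOn)).continuousAt
      (isOpen_ball.mem_nhds (hmem t))

/-- Strict monotonicity alone would only give a nonnegative radial derivative; the quantitative
bound keeps the outward difference quotients above `κ * ‖t - m‖ ^ (D + 2)`. -/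
theorem IsSharpMinimizer.potGrad_pos {i j : ι} (hij : j ≠ i) {t : F i}
    (ht : t ≠ center μ (c i) f) : 0 < inner ℝ (potGrad μ (c i) f t) (t - center μ (c i) f) := by
  set m := center μ (c i) f
  have hρ : 0 < ‖t - m‖ := norm_pos_iff.mpr (sub_ne_zero.mpr ht)
  set D := Module.finrank ℝ V
  -- The radius `2 * ‖t - m‖` covers the outward points `t + r • (t - m)` with `r ≤ 1`.
  obtain ⟨κ, hκ, hlow⟩ := hf.exists_le_pot_sub_pot hc i (2 * ‖t - m‖)
  have hder := (((hf.hasFDerivAt_pot_and_continuous hc hij).1 t).hasLineDerivAt (t - m))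
  have hslope := (hasDerivAt_iff_tendsto_slope_zero.mp hder).mono_left
    (nhdsWithin_mono 0 fun r (hr : r ∈ Ioi (0 : ℝ)) => ne_of_gt hr)
  refine lt_of_lt_of_le (show 0 < κ * ‖t - m‖ ^ (D + 2) by positivity) (ge_of_tendsto hslope ?_)
  filter_upwards [Ioc_mem_nhdsGT (one_pos : (0 : ℝ) < 1)] with r hr
  simp only [zero_add, zero_smul, add_zero, smul_eq_mul]
  have hn : ‖t + r • (t - m) - m‖ = (1 + r) * ‖t - m‖ := by
    rw [show t + r • (t - m) - m = (1 + r) • (t - m) by module, norm_smul,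
      Real.norm_of_nonneg (by linarith [hr.1])]
  have h := hlow t (t + r • (t - m)) (by rw [hn]; nlinarith [hr.1]) (by rw [hn]; nlinarith [hr.2])
  rw [hn] at h
  rw [le_inv_mul_iff₀ hr.1]
  refine le_trans ?_ h
  have h2 : ‖t - m‖ ^ (D + 1) ≤ ((1 + r) * ‖t - m‖ + ‖t - m‖) ^ (D + 1) := by
    gcongr
    nlinarith [hr.1]
  calc r * (κ * ‖t - m‖ ^ (D + 2)) = κ * (((1 + r) * ‖t - m‖ - ‖t - m‖) * ‖t - m‖ ^ (D + 1)) := by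
        ring
    _ ≤ _ := by
      have : 0 ≤ (1 + r) * ‖t - m‖ - ‖t - m‖ := by nlinarith [hr.1]
      gcongr

end Setting
-- The boundary of the optimal set.
/-- A level set of a `C¹` function without critical points is a hypersurface. -/
theorem isC1Submanifold_of_level {E : Type*} [NormedAddCommGroup E] [NormedSpace ℝ E]
    {Ω M : Set E} (hΩ : IsOpen Ω) {h : E → ℝ} (hh : ContDiff ℝ 1 h)
    (hne : ∀ y ∈ Ω, ∃ u, fderiv ℝ h y u ≠ 0) (hM : M = {y ∈ Ω | h y = 0}) :
    IsC1Submanifold 1 Ω M := by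
  subst hM
  refine ⟨fun x hx => hx.1, fun x hx => ⟨Ω, hΩ, hx.1, Subset.rfl, fun y _ => h y, ?_, ?_, ?_⟩⟩
  · exact (contDiff_pi.mpr fun _ => hh).contDiffOn
  · intro y hy z
    obtain ⟨u, hu⟩ := hne y hy
    have hd : HasFDerivAt (fun y (_ : Fin 1) => h y)
        (ContinuousLinearMap.pi fun _ => fderiv ℝ h y) y :=
      hasFDerivAt_pi.mpr fun _ => ((hh.differentiable one_ne_zero) y).hasFDerivAt
    refine ⟨(z 0 / fderiv ℝ h y u) • u, ?_⟩
    ext k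
    rw [hd.fderiv, Subsingleton.elim k 0]
    simp [hu]
  · ext y
    simp only [mem_inter_iff, mem_ofPred_eq, funext_iff, Pi.zero_apply, forall_const]
    tauto

section Setting

variable {V : Type*} [NormedAddCommGroup V] [NormedSpace ℝ V] [FiniteDimensional ℝ V]
  [MeasurableSpace V] [BorelSpace V] {μ : Measure V} [μ.IsAddHaarMeasure]
  {ι : Type*} [Fintype ι] {F : ι → Type*} [∀ i, NormedAddCommGroup (F i)]
  [∀ i, InnerProductSpace ℝ (F i)]
  [∀ i, FiniteDimensional ℝ (F i)] [∀ i, MeasurableSpace (F i)] [∀ i, BorelSpace (F i)]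
  [∀ i, Nontrivial (F i)]
  {c : ∀ i, Coordinate V (F i)} {d : ι → ℝ} {f : V → ℝ} {s : ℝ}
  (hf : IsSharpMinimizer μ c d f s) (hc : IsCoordinateSystem c d)
include hf hc

theorem IsSharpMinimizer.smul_mem_of_mem_closure {x : V}
    (hx : x ∈ closure {x | totalPot μ c d f x < s}) {r : ℝ} (hr0 : 0 ≤ r) (hr1 : r < 1) :
    totalPot μ c d f (centerPoint μ c f + r • (x - centerPoint μ c f)) < s := by
  have hcont := hf.isMinimizer.density.bump.continuous_totalPot (μ := μ) (c := c) (d := d)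
  rcases eq_or_ne x (centerPoint μ c f) with rfl | hne
  · simpa using hf.totalPot_centerPoint_lt hc
  · exact (hf.isMinimizer.totalPot_smul_lt hc hne hr0 hr1).trans_le
      (closure_minimal (setOf_lt_subset_setOf_le _ s) (isClosed_le hcont continuous_const) hx)

/-- A point of the level set is the limit of its contractions towards the centre point, which lie
strictly inside. -/
theorem IsSharpMinimizer.frontier_eq :
    frontier {x | totalPot μ c d f x < s} = {x | totalPot μ c d f x = s} := by
  have hcont := hf.isMinimizer.density.bump.continuous_totalPot (μ := μ) (c := c) (d := d)
  refine (frontier_lt_subset_eq hcont continuous_const).antisymm fun x hx => ?_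
  have hx : totalPot μ c d f x = s := hx
  rw [(isOpen_lt hcont continuous_const).frontier_eq]
  refine ⟨?_, fun h : totalPot μ c d f x < s => h.ne hx⟩
  set v := centerPoint μ c f
  have hne : x ≠ v := fun h => (hf.totalPot_centerPoint_lt hc).ne (by rw [h] at hx; exact hx)
  have hlim : Tendsto (fun r : ℝ => v + r • (x - v)) (𝓝[<] 1) (𝓝 x) := by
    have h : Continuous fun r : ℝ => v + r • (x - v) := by fun_prop
    simpa using (h.tendsto 1).mono_left nhdsWithin_le_nhds
  refine mem_closure_of_tendsto hlim ?_
  filter_upwards [Ioo_mem_nhdsLT (zero_lt_one : (0 : ℝ) < 1)] with r hr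
  exact (hf.isMinimizer.totalPot_smul_lt hc hne hr.1.le hr.2).trans_eq hx

theorem IsSharpMinimizer.contDiff_pot {i j : ι} (hij : j ≠ i) : ContDiff ℝ 1 (pot μ (c i) f) := by
  obtain ⟨h1, h2⟩ := hf.hasFDerivAt_pot_and_continuous hc hij
  exact contDiff_one_iff_hasFDerivAt.mpr ⟨_, (innerSL ℝ).continuous.comp h2, h1⟩

theorem IsSharpMinimizer.contDiff_totalPot [Nontrivial ι] : ContDiff ℝ 1 (totalPot μ c d f) := by
  unfold totalPot
  refine ContDiff.sum fun i _ => contDiff_const.mul ?_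
  obtain ⟨j, hij⟩ := exists_ne i
  exact (hf.contDiff_pot hc hij).comp (c i).proj.contDiff

theorem IsSharpMinimizer.exists_fderiv_totalPot_ne_zero [Nontrivial ι] {x : V} {i : ι}
    (hx : (c i).proj x ≠ center μ (c i) f) : ∃ u, fderiv ℝ (totalPot μ c d f) x u ≠ 0 := by
  obtain ⟨j, hij⟩ := exists_ne i
  set m := center μ (c i) f
  set t := (c i).proj x
  refine ⟨(c i).sec (t - m), ne_of_gt ?_⟩
  have h1 : HasDerivAt (fun r : ℝ => totalPot μ c d f (x + r • (c i).sec (t - m)))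
      (fderiv ℝ (totalPot μ c d f) x ((c i).sec (t - m))) 0 :=
    (((hf.contDiff_totalPot hc).differentiable one_ne_zero x).hasFDerivAt).hasLineDerivAt _
  have h2 : HasDerivAt (fun r : ℝ => pot μ (c i) f (t + r • (t - m)))
      (inner ℝ (potGrad μ (c i) f t) (t - m)) 0 :=
    ((hf.hasFDerivAt_pot_and_continuous hc hij).1 t).hasLineDerivAt _
  have h3 := (((h2.sub_const (pot μ (c i) f t)).const_mul (d i)).const_add (totalPot μ c d f x))
  rw [h1.unique (h3.congr_of_eventuallyEq (.of_forall fun r => ?_))]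
  · exact mul_pos (hc.pos i) (hf.potGrad_pos hc hij hx)
  · simp only
    rw [← map_smul, hc.orth.totalPot_add_sec]
    ring

/-- With a single coordinate the level sets are spheres about the centre, so their smoothness does
not require differentiability of the potential. -/
theorem IsSharpMinimizer.totalPot_eq_iff [Subsingleton ι] (i : ι) {x y : V} :
    totalPot μ c d f x = totalPot μ c d f y ↔
      ‖(c i).proj x - center μ (c i) f‖ = ‖(c i).proj y - center μ (c i) f‖ := by
  have : ∀ x, totalPot μ c d f x = d i * pot μ (c i) f ((c i).proj x) := fun x =>
    Fintype.sum_subsingleton _ i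
  rw [this, this, mul_right_inj' (hc.pos i).ne']
  have h1 := hf.isMinimizer.pot_lt_iff hc i (x := (c i).proj x) (y := (c i).proj y)
  have h2 := hf.isMinimizer.pot_lt_iff hc i (x := (c i).proj y) (y := (c i).proj x)
  constructor <;> intro h
  · exact le_antisymm (not_lt.mp fun h' => (h2.mpr h').ne' h) (not_lt.mp fun h' => (h1.mpr h').ne h)
  · exact le_antisymm (not_lt.mp fun h' => (h2.mp h').ne' h) (not_lt.mp fun h' => (h1.mp h').ne h)

theorem IsSharpMinimizer.isC1Submanifold [Nonempty ι] :
    IsC1Submanifold 1 {y : V | ∀ i, (c i).proj y ≠ 0}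
      {y | (∀ i, (c i).proj y ≠ 0) ∧ totalPot μ c d f (centerPoint μ c f + y) = s} := by
  set Ω := {y : V | ∀ i, (c i).proj y ≠ 0} with hΩdef
  set v := centerPoint μ c f
  have hΩ : IsOpen Ω := by
    simp only [hΩdef, ofPred_forall]
    exact isOpen_iInter_of_finite fun i => isOpen_ne_fun (c i).proj.continuous continuous_const
  obtain ⟨i⟩ := ‹Nonempty ι›
  -- With one coordinate the defining function is the squared norm minus its value at one boundary
  -- point; with several it is the total potential itself.
  rcases subsingleton_or_nontrivial ι with hι | hι
  · by_cases hM : ∃ y ∈ Ω, totalPot μ c d f (v + y) = s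
    · obtain ⟨x, hx, hxs⟩ := hM
      refine isC1Submanifold_of_level hΩ (h := fun y => ‖(c i).proj y‖ ^ 2 - ‖(c i).proj x‖ ^ 2)
        ?_ (fun y hy => ⟨y, ?_⟩) ?_
      · exact ((c i).proj.contDiff.norm_sq ℝ).sub contDiff_const
      · have hd := (((c i).proj.hasFDerivAt (x := y)).norm_sq).sub_const (‖(c i).proj x‖ ^ 2)
        rw [hd.fderiv]
        simpa using hy i
      · ext y
        have key := hf.totalPot_eq_iff hc i (x := v + y) (y := v + x)
        have hv : ∀ z, (c i).proj (v + z) - center μ (c i) f = (c i).proj z := fun z => by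
          rw [map_add, proj_centerPoint hc, add_sub_cancel_left]
        rw [hxs, hv, hv] at key
        simp only [mem_ofPred_eq, key, sub_eq_zero, pow_left_inj₀ (norm_nonneg _) (norm_nonneg _)
          two_ne_zero, Ω]
    · exact ⟨fun y hy => hy.1, fun y hy => absurd ⟨y, hy.1, hy.2⟩ hM⟩
  · refine isC1Submanifold_of_level hΩ (h := fun y => totalPot μ c d f (v + y) - s)
      (((hf.contDiff_totalPot hc).comp (contDiff_const.add contDiff_id)).sub contDiff_const)
      (fun y hy => ?_) ?_
    · rw [fderiv_sub_const, fderiv_comp_add_left]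
      refine hf.exists_fderiv_totalPot_ne_zero hc (i := i) ?_
      rw [map_add, proj_centerPoint hc, ne_eq, add_eq_left]
      exact hy i
    · ext y
      simp only [mem_ofPred_eq, sub_eq_zero, Ω]

end Setting

section Setting

variable {V : Type*} [NormedAddCommGroup V] [NormedSpace ℝ V] [FiniteDimensional ℝ V]
  [MeasurableSpace V] [BorelSpace V] {μ : Measure V} [μ.IsAddHaarMeasure]
  {ι : Type*} [Fintype ι] {F : ι → Type*} [∀ i, NormedAddCommGroup (F i)]
  [∀ i, InnerProductSpace ℝ (F i)]
  [∀ i, FiniteDimensional ℝ (F i)] [∀ i, MeasurableSpace (F i)] [∀ i, BorelSpace (F i)]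
  [∀ i, Nontrivial (F i)]
  {c : ∀ i, Coordinate V (F i)} {d : ι → ℝ} {f : V → ℝ}

theorem IsMinimizer.exists_isOpen [Nontrivial V] [Nonempty ι] (hf : IsMinimizer μ c d f)
    (hc : IsCoordinateSystem c d) :
    ∃ (U : Set V) (v : V), IsOpen U ∧ f =ᵐ[μ] U.indicator (fun _ => 1) ∧
      (∀ r : ℝ, 0 ≤ r → r < 1 → r • ((· - v) '' closure U) ⊆ (· - v) '' U) ∧
      IsC1Submanifold 1 {y : V | ∀ i, (c i).proj y ≠ 0}
        (((· - v) '' frontier U) ∩ {y : V | ∀ i, (c i).proj y ≠ 0}) := by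
  obtain ⟨g, s, hg, hfg⟩ := hf.exists_isSharpMinimizer hc
  have hcont := hg.isMinimizer.density.bump.continuous_totalPot (μ := μ) (c := c) (d := d)
  refine ⟨{x | totalPot μ c d g x < s}, centerPoint μ c g, isOpen_lt hcont continuous_const,
    hg.eq_indicator ▸ hfg, ?_, ?_⟩
  · rintro r hr0 hr1 _ ⟨_, ⟨x, hx, rfl⟩, rfl⟩
    exact ⟨_, hg.smul_mem_of_mem_closure hc hx hr0 hr1, add_sub_cancel_left _ _⟩
  · convert hg.isC1Submanifold hc using 1
    rw [hg.frontier_eq hc]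
    ext y
    simp only [image_sub_right, mem_inter_iff, mem_preimage, mem_ofPred_eq, add_comm y, and_comm]

end Setting
-- The coordinates of `K ⊗ ℝ` and the translation between measures and densities.
open InfinitePlace in
/-- The completion of `K` at an infinite place. -/
def PlaceSpace (K : Type*) [Field K] :
    {w : InfinitePlace K // IsReal w} ⊕ {w : InfinitePlace K // IsComplex w} → Type
  | .inl _ => ℝ
  | .inr _ => ℂ

section Places

open mixedEmbedding InfinitePlace

variable (K : Type*) [Field K]

section

variable (i : {w : InfinitePlace K // IsReal w} ⊕ {w : InfinitePlace K // IsComplex w})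

noncomputable instance : NormedAddCommGroup (PlaceSpace K i) :=
  match i with
  | .inl _ => inferInstanceAs (NormedAddCommGroup ℝ)
  | .inr _ => inferInstanceAs (NormedAddCommGroup ℂ)

noncomputable instance : InnerProductSpace ℝ (PlaceSpace K i) :=
  match i with
  | .inl _ => inferInstanceAs (InnerProductSpace ℝ ℝ)
  | .inr _ => inferInstanceAs (InnerProductSpace ℝ ℂ)

instance : FiniteDimensional ℝ (PlaceSpace K i) :=
  match i with
  | .inl _ => inferInstanceAs (FiniteDimensional ℝ ℝ)
  | .inr _ => inferInstanceAs (FiniteDimensional ℝ ℂ)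

instance : MeasurableSpace (PlaceSpace K i) :=
  match i with
  | .inl _ => inferInstanceAs (MeasurableSpace ℝ)
  | .inr _ => inferInstanceAs (MeasurableSpace ℂ)

instance : BorelSpace (PlaceSpace K i) :=
  match i with
  | .inl _ => inferInstanceAs (BorelSpace ℝ)
  | .inr _ => inferInstanceAs (BorelSpace ℂ)

instance : Nontrivial (PlaceSpace K i) :=
  match i with
  | .inl _ => inferInstanceAs (Nontrivial ℝ)
  | .inr _ => inferInstanceAs (Nontrivial ℂ)

end

/-- The coordinate of the mixed space at an infinite place. -/
noncomputable def placeCoordinate [NumberField K]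
    (i : {w : InfinitePlace K // IsReal w} ⊕ {w : InfinitePlace K // IsComplex w}) : Coordinate (mixedSpace K) (PlaceSpace K i) :=
  match i with
  | .inl w =>
    { proj := (ContinuousLinearMap.proj w).comp (ContinuousLinearMap.fst ℝ _ _)
      sec := (ContinuousLinearMap.inl ℝ _ _).comp (ContinuousLinearMap.single ℝ (fun _ => ℝ) w)
      proj_sec := fun z => Pi.single_eq_same (M := fun _ => ℝ) w z }
  | .inr w =>
    { proj := (ContinuousLinearMap.proj w).comp (ContinuousLinearMap.snd ℝ _ _)
      sec := (ContinuousLinearMap.inr ℝ _ _).comp (ContinuousLinearMap.single ℝ (fun _ => ℂ) w)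
      proj_sec := fun z => Pi.single_eq_same (M := fun _ => ℂ) w z }

/-- The weight of an infinite place. -/
def placeWeight
    (i : {w : InfinitePlace K // IsReal w} ⊕ {w : InfinitePlace K // IsComplex w}) : ℝ := i.elim (fun _ => 1) (fun _ => 2)

variable [NumberField K]

theorem isCoordinateSystem_placeCoordinate :
    IsCoordinateSystem (placeCoordinate K) (placeWeight K) where
  orth := by
    rintro (w | w) (w' | w') h z
    · exact Pi.single_eq_of_ne (M := fun _ => ℝ) (fun h' => h (congrArg _ h')) z
    · rfl
    · rfl
    · exact Pi.single_eq_of_ne (M := fun _ => ℂ) (fun h' => h (congrArg _ h')) z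
  inj := fun x hx => Prod.ext (funext fun w => hx (.inl w)) (funext fun w => hx (.inr w))
  pos := by rintro (w | w) <;> simp [placeWeight]

theorem unitSet_eq : unitSet K = {x | ∀ i, (placeCoordinate K i).proj x ≠ 0} := by
  ext x
  simp only [unitSet, mem_ofPred_eq, Prod.isUnit_iff, Pi.isUnit_iff, isUnit_iff_ne_zero, Sum.forall]
  rfl

/-- The coordinates must be nonzero because of the convention `Real.log 0 = 0`: if one vanishes, the
left side is zero, whatever the others are. The excluded points are null and do not affect the
energy. -/
theorem log_norm_eq_sum {x : mixedSpace K} (hx : ∀ i, (placeCoordinate K i).proj x ≠ 0) :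
    Real.log (mixedEmbedding.norm x)
      = ∑ i, placeWeight K i * Real.log ‖(placeCoordinate K i).proj x‖ := by
  have h1 : ∀ w, ‖x.1 w‖ ≠ 0 := fun w => norm_ne_zero_iff.mpr (hx (.inl w))
  have h2 : ∀ w, ‖x.2 w‖ ≠ 0 := fun w => norm_ne_zero_iff.mpr (hx (.inr w))
  have h3 : mixedEmbedding.norm x = (∏ w, ‖x.1 w‖) * ∏ w, ‖x.2 w‖ ^ 2 := by
    rw [mixedEmbedding.norm_apply, prod_eq_prod_mul_prod]
    congr 1
    · refine Finset.prod_congr rfl fun w _ => ?_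
      rw [normAtPlace_apply_of_isReal w.2, mult_isReal, pow_one]
    · refine Finset.prod_congr rfl fun w _ => ?_
      rw [normAtPlace_apply_of_isComplex w.2, mult_isComplex]
  rw [h3, Real.log_mul (Finset.prod_ne_zero_iff.mpr fun w _ => h1 w)
    (Finset.prod_ne_zero_iff.mpr fun w _ => pow_ne_zero 2 (h2 w)),
    Real.log_prod fun w _ => h1 w, Real.log_prod fun w _ => pow_ne_zero 2 (h2 w),
    Fintype.sum_sum_type]
  congr 1
  · refine Finset.sum_congr rfl fun w _ => ?_
    simp only [placeWeight, Sum.elim_inl, one_mul]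
    rfl
  · refine Finset.sum_congr rfl fun w _ => ?_
    simp only [placeWeight, Sum.elim_inr, Real.log_pow, Nat.cast_ofNat]
    rfl

variable {K}

theorem IsBump.integral_mul_log_norm {g : mixedSpace K → ℝ} (hg : IsBump g) (y : mixedSpace K) :
    ∫ x, g x * Real.log (mixedEmbedding.norm (x - y))
      = totalPot volume (placeCoordinate K) (placeWeight K) g y := by
  have hae : ∀ᵐ x : mixedSpace K, ∀ i, (placeCoordinate K i).proj y ≠ (placeCoordinate K i).proj x :=
    ae_all_iff.mpr fun i => Coordinate.ae_ne (placeCoordinate K i) _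
  have h : (fun x => g x * Real.log (mixedEmbedding.norm (x - y))) =ᵐ[volume]
      fun x => ∑ i, placeWeight K i *
        (g x * Real.log ‖(placeCoordinate K i).proj y - (placeCoordinate K i).proj x‖) := by
    filter_upwards [hae] with x hx
    rw [log_norm_eq_sum K fun i => by rw [map_sub, sub_ne_zero]; exact (hx i).symm, Finset.mul_sum]
    refine Finset.sum_congr rfl fun i _ => ?_
    rw [map_sub, norm_sub_rev]
    ring
  rw [integral_congr_ae h, integral_finsetSum _ fun i _ =>
    (hg.integrable_mul_log (placeCoordinate K i) _).const_mul _, totalPot]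
  simp only [integral_const_mul, pot]

theorem IsDensity.energy_eq {g : mixedSpace K → ℝ} (hg : IsDensity volume g) :
    energy K (volume.withDensity fun x => ENNReal.ofReal (g x))
      = ∑ i, placeWeight K i * form volume (placeCoordinate K i) g g := by
  have h : ∀ φ : mixedSpace K → ℝ,
      ∫ x, φ x ∂(volume.withDensity fun x => ENNReal.ofReal (g x)) = ∫ x, g x * φ x := fun φ => by
    rw [integral_withDensity_eq_integral_toReal_smul hg.bump.meas.ennreal_ofReal
      (ae_of_all _ fun x => ENNReal.ofReal_lt_top)]
    simp only [ENNReal.toReal_ofReal (hg.nonneg _), smul_eq_mul]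
  rw [energy, sum_form_eq_integral hg.bump hg.bump]
  simp only [h, hg.bump.integral_mul_log_norm]

theorem IsDensity.isAdmissible {g : mixedSpace K → ℝ} (hg : IsDensity volume g) :
    IsAdmissible K (volume.withDensity fun x => ENNReal.ofReal (g x)) where
  prob := by
    constructor
    rw [withDensity_apply _ MeasurableSet.univ, setLIntegral_univ,
      ← ofReal_integral_eq_lintegral_ofReal hg.bump.integrable (ae_of_all _ hg.nonneg),
      hg.integral_eq_one, ENNReal.ofReal_one]
  compactSupport := by
    obtain ⟨R, hR⟩ := hg.bump.supp
    refine ⟨closedBall 0 R, isCompact_closedBall 0 R, ?_⟩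
    rw [withDensity_apply _ measurableSet_closedBall.compl]
    refine setLIntegral_eq_zero measurableSet_closedBall.compl fun x hx => ?_
    rw [hR x (by simpa using hx), ENNReal.ofReal_zero, Pi.zero_apply]
  density := ⟨_, hg.bump.meas.ennreal_ofReal, fun x => ENNReal.ofReal_le_one.mpr (hg.le_one x), rfl⟩

theorem IsAdmissible.exists_isDensity {ν : Measure (mixedSpace K)} (hν : IsAdmissible K ν) :
    ∃ g, IsDensity volume g ∧ ν = volume.withDensity fun x => ENNReal.ofReal (g x) := by
  obtain ⟨C, hC, hνC⟩ := hν.compactSupport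
  obtain ⟨f, hf, hf1, hνf⟩ := hν.density
  have hCm := hC.isClosed.measurableSet
  have hle : ∀ x, C.indicator f x ≤ 1 := fun x => (indicator_le_self C f x).trans (hf1 x)
  have hm : Measurable (C.indicator f) := hf.indicator hCm
  have hofReal : ∀ x, ENNReal.ofReal (C.indicator f x).toReal = C.indicator f x := fun x =>
    ENNReal.ofReal_toReal ((hle x).trans_lt ENNReal.one_lt_top).ne
  -- As `ν` gives no mass to the complement of `C`, its density may be cut off there; this provides
  -- bounded support everywhere and not only almost everywhere.
  have hν' : ν = volume.withDensity (C.indicator f) := by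
    rw [withDensity_indicator hCm, ← restrict_withDensity hCm, ← hνf,
      Measure.restrict_eq_self_of_ae_mem (show ∀ᵐ x ∂ν, x ∈ C from hνC)]
  have hle' : ∀ x, (C.indicator f x).toReal ≤ 1 := fun x =>
    ENNReal.toReal_le_of_le_ofReal zero_le_one (by simpa using hle x)
  refine ⟨fun x => (C.indicator f x).toReal, ⟨⟨hm.ennreal_toReal, ⟨1, fun x => ?_⟩, ?_⟩,
    fun x => ENNReal.toReal_nonneg, hle', ?_⟩, by simpa only [hofReal] using hν'⟩
  · rw [abs_of_nonneg ENNReal.toReal_nonneg]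
    exact hle' x
  · obtain ⟨R, hR⟩ := hC.isBounded.exists_norm_le
    refine ⟨R, fun x hx => ?_⟩
    rw [indicator_of_notMem fun h => (hR x h).not_gt hx, ENNReal.toReal_zero]
  · rw [integral_toReal hm.aemeasurable
      (ae_of_all _ fun x => (hle x).trans_lt ENNReal.one_lt_top)]
    have := hν.prob.measure_univ
    rw [hν', withDensity_apply _ MeasurableSet.univ, setLIntegral_univ] at this
    rw [this, ENNReal.toReal_one]

end Places

end LogNormEnergy

theorem mainTheorem10 (K : Type*) [Field K] [NumberField K]
    (ν : Measure (mixedEmbedding.mixedSpace K))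
    (hν : LogNormEnergy.IsEnergyMinimizer K ν) :
    ∃ (U : Set (mixedEmbedding.mixedSpace K)) (v : mixedEmbedding.mixedSpace K),
      IsOpen U ∧
      ν = volume.restrict U ∧
      (∀ c : ℝ, 0 ≤ c → c < 1 → c • ((· - v) '' closure U) ⊆ (· - v) '' U) ∧
      LogNormEnergy.IsC1Submanifold 1 (LogNormEnergy.unitSet K)
        (((· - v) '' frontier U) ∩ LogNormEnergy.unitSet K) := by
  open LogNormEnergy in
  obtain ⟨g, hg, hνg⟩ := hν.1.exists_isDensity
  have hmin : IsMinimizer volume (placeCoordinate K) (placeWeight K) g := ⟨hg, fun k hk => by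
    rw [← hg.energy_eq, ← hk.energy_eq, ← hνg]
    exact hν.2 _ hk.isAdmissible⟩
  have : Nonempty ({w : InfinitePlace K // w.IsReal} ⊕ {w : InfinitePlace K // w.IsComplex}) := by
    obtain ⟨w⟩ := (inferInstance : Nonempty (InfinitePlace K))
    exact w.isReal_or_isComplex.elim (fun h => ⟨.inl ⟨w, h⟩⟩) fun h => ⟨.inr ⟨w, h⟩⟩
  obtain ⟨U, v, hU, hgU, hstar, hC1⟩ :=
    hmin.exists_isOpen (isCoordinateSystem_placeCoordinate K)
  rw [← unitSet_eq] at hC1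
  refine ⟨U, v, hU, ?_, hstar, hC1⟩
  rw [hνg, ← withDensity_indicator_one hU.measurableSet]
  refine withDensity_congr_ae ?_
  filter_upwards [hgU] with x hx
  rw [hx]
  by_cases h : x ∈ U <;> simp [h]
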